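/- **Setting.** For $\rho\in[0,1)$ let $\mathbb A_\rho:=\{z\in\mathbb C:\rho<|z|<1\}$, and let $\omega(\rho):=-\pi/\log\rho$ for $\rho\in(0,1)$, $\omega(0):=0$. Let $d\in[1,+\infty]$ and let $D_t:=\mathbb A_{r(t)}$, $t\ge0$, with $r:[0,+\infty)\to[0,1)$, be a *canonical domain system of order $d$*: the function $t\mapsto\omega(r(t))$ is non-increasing, locally absolutely continuous on $[0,+\infty)$, and its derivative is in $L^d_{\rm loc}([0,+\infty))$. Put $\mathcal D:=\{(z,t):t\ge0,\ z\in D_t\}$. An *$L^d$-evolution family over $(D_t)$* is a family $(\varphi_{s,t})_{0\le s\le t<+\infty}$ of holomorphic maps $\varphi_{s,t}:D_s\to D_t$ such that 1. $\varphi_{s,s}=\mathrm{id}_{D_s}$ for all $s\ge 0$; 2. $\varphi_{s,t}=\varphi_{u,t}\circ\varphi_{s,u}$ whenever $0\le s\le u\le t$; 3. for any $[S,T]\subset[0,+\infty)$ and any $z\in D_S$ there is a non-negative $k_{z,[S,T]}\in L^d([S,T],\mathbb R)$ such that $|\varphi_{s,u}(z)-\varphi_{s,t}(z)|\le\int_u^t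 k_{z,[S,T]}(\xi)\,d\xi$ whenever $S\le s\le u\le t\le T$. A *weak holomorphic vector field of order $d$ in $\mathcal D$* is a function $G:\mathcal D\to\mathbb C$ such that $G(z,\cdot)$ is (Lebesgue) measurable on $\{t:(z,t)\in\mathcal D\}$ for each $z\in\mathbb C$, $G(\cdot,t)$ is holomorphic in $D_t$ for each $t\ge0$, and for each compact $K\subset\mathcal D$ there is a non-negative $k_K\in L^d(\mathrm{pr}_{\mathbb R}(K),\mathbb R)$, where $\mathrm{pr}_{\mathbb R}(K):=\{t:\exists z,\ (z,t)\in K\}$, with $|G(z,t)|\le k_K(t)$ for all $(z,t)\in K$. For $(z,s)\in\mathcal D$, a *solution* of $$\dot w=G(w,t),\qquad w(s)=z \tag{1}$$ on an interval $J\ni s$ is a locally absolutely continuous function $w:J\to\mathbb C$ with $w(s)=z$, with $(w(t),t)\in\mathcal D$ for all $t\in J$, and with $\dot w(t)=G(w(t),t)$ for a.e. $t\in J$. The *non-extendable solution* of (1) is a solution of which every other solution of (1) is a restriction. The field $G$ is *semicomplete* if for every $(z,s)\in\mathcal D$ problem (1) has a solution defined on all of $[s,+\infty)$. Let $U\subset\mathbb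 C$ be a domain and $I\subset\mathbb R$ an interval. The set $\mathrm{Hol}(U,\mathbb C)$ of holomorphic functions on $U$ carries the topology of uniform convergence on compact sets, and $\|f\|_K:=\sup_K|f|$. A map $\psi:I\to\mathrm{Hol}(U,\mathbb C)$ is *locally absolutely continuous* if for every compact interval $J\subset I$, every $\varepsilon>0$ and every compact $K\subset U$ there is $\delta>0$ such that, for any finite family of pairwise disjoint intervals $(a_j,b_j)$ with $a_j,b_j\in J$ and $\sum_j(b_j-a_j)<\delta$, one has $\sum_j\|\psi(b_j)-\psi(a_j)\|_K<\varepsilon$. It is *differentiable at $t_0\in I$ with derivative* $g\in\mathrm{Hol}(U,\mathbb C)$ if $(\psi(t)-\psi(t_0))/(t-t_0)\to g$ uniformly on every compact subset of $U$ as $t\to t_0$, $t\in I\setminus\{t_0\}$. A semicomplete weak holomorphic vector field $G:\mathcal D\to\mathbb C$ of order $d$ *corresponds* to a family $(\varphi_{s,t})$ if there is a null set $N\subset[0,+\infty)$ such that for all $s\ge0$: * (i) the map $[s,+\infty)\ni t\mapsto\varphi_{s,t}\in\mathrm{Hol}(D_s,\mathbb C)$ is locally absolutely continuous; * (ii) the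 map $[s,+\infty)\ni t\mapsto\varphi_{s,t}\in\mathrm{Hol}(D_s,\mathbb C)$ is differentiable at every $t\in[s,+\infty)\setminus N$; * (iii) $d\varphi_{s,t}/dt=G(\cdot,t)\circ\varphi_{s,t}$ for all $t\in[s,+\infty)\setminus N$. **Theorem.** Let $d\in[1,+\infty]$ and let $(D_t)$ be a canonical domain system of order $d$. **(A)** For every $L^d$-evolution family $(\varphi_{s,t})$ over $(D_t)$ there exists a semicomplete weak holomorphic vector field $G:\mathcal D\to\mathbb C$ of order $d$ corresponding to $(\varphi_{s,t})$. It is essentially unique: if $G_1,G_2$ both correspond to $(\varphi_{s,t})$, then $G_1(\cdot,t)=G_2(\cdot,t)$ on $D_t$ for a.e. $t\ge0$. **(B)** Conversely, let $G:\mathcal D\to\mathbb C$ be a semicomplete weak holomorphic vector field of order $d$. Then for every $(z,s)\in\mathcal D$ problem (1) has a unique non-extendable solution $w^*_s(z,\cdot)$, its interval of definition contains $[s,+\infty)$, and the formula $\varphi_{s,t}(z):=w^*_s(z,t)$, $t\ge s\ge0$, $z\in D_s$, defines an $L^d$-evolution family over $(D_t)$. -/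

import Mathlib

open Set Filter Topology MeasureTheory
open scoped ENNReal

noncomputable section

namespace AnnulusLoewner

/-- The annulus `𝔸_ρ = {z : ρ < |z| < 1}`; for `ρ = 0` it is the punctured unit disk. -/
def annulus (ρ : ℝ) : Set ℂ := {z | ρ < ‖z‖ ∧ ‖z‖ < 1}

/-- The modulus-type parameter `ω(ρ) = -π / log ρ` for `ρ ∈ (0,1)` and `ω(0) = 0`. -/
def omega (ρ : ℝ) : ℝ := if ρ = 0 then 0 else -Real.pi / Real.log ρ

/-- The class `AC^d` on an interval `X`: locally absolutely continuous functions whose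
(almost everywhere existing) derivative is locally of class `L^d` on `X`. -/
def IsACd (d : ℝ≥0∞) (X : Set ℝ) (f : ℝ → ℝ) : Prop :=
  ∀ a b : ℝ, a ≤ b → Icc a b ⊆ X →
    AbsolutelyContinuousOnInterval f a b ∧ MemLp (derivWithin f X) d (volume.restrict (Icc a b))

/-- `D_t = 𝔸_{r(t)}`, `t ≥ 0`, is a (doubly connected) canonical domain system of order `d`.
Only the values of `r` on `[0,∞)` matter. -/
structure IsCanonicalDomainSystem (d : ℝ≥0∞) (r : ℝ → ℝ) : Prop where
  mem_Ico : ∀ t, 0 ≤ t → r t ∈ Ico (0 : ℝ) 1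
  isACd : IsACd d (Ici 0) (fun t => omega (r t))
  antitone : AntitoneOn (fun t => omega (r t)) (Ici 0)

/-- `𝒟 = {(z,t) : t ≥ 0, z ∈ D_t}` with `D_t = 𝔸_{r(t)}`. -/
def spaceTime (r : ℝ → ℝ) : Set (ℂ × ℝ) := {p | 0 ≤ p.2 ∧ p.1 ∈ annulus (r p.2)}

/-- `φ s t`, `0 ≤ s ≤ t`, is an evolution family of order `d` over `D_t = 𝔸_{r(t)}`.
Only the values `φ s t z` with `0 ≤ s ≤ t` and `z ∈ D_s` matter. -/
structure IsEvolutionFamily (d : ℝ≥0∞) (r : ℝ → ℝ) (φ : ℝ → ℝ → ℂ → ℂ) : Prop where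
  holo : ∀ s t, 0 ≤ s → s ≤ t → DifferentiableOn ℂ (φ s t) (annulus (r s))
  mapsTo : ∀ s t, 0 ≤ s → s ≤ t → MapsTo (φ s t) (annulus (r s)) (annulus (r t))
  ef1 : ∀ s, 0 ≤ s → ∀ z ∈ annulus (r s), φ s s z = z
  ef2 : ∀ s u t, 0 ≤ s → s ≤ u → u ≤ t → ∀ z ∈ annulus (r s), φ s t z = φ u t (φ s u z)
  ef3 : ∀ S T, 0 ≤ S → S ≤ T → ∀ z ∈ annulus (r S),
    ∃ k : ℝ → ℝ, (∀ ξ ∈ Icc S T, 0 ≤ k ξ) ∧ MemLp k d (volume.restrict (Icc S T)) ∧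
      ∀ s u t, S ≤ s → s ≤ u → u ≤ t → t ≤ T → ‖φ s u z - φ s t z‖ ≤ ∫ ξ in u..t, k ξ

/-- `G` is a weak holomorphic vector field of order `d` in `𝒟 ⊆ ℂ × ℝ`. Measurability is
Lebesgue measurability. Only the values `G z t` with `(z,t) ∈ 𝒟` matter. -/
structure IsWeakHolVectorField (d : ℝ≥0∞) (𝒟 : Set (ℂ × ℝ)) (G : ℂ → ℝ → ℂ) : Prop where
  meas : ∀ z : ℂ, AEMeasurable (fun t => G z t) (volume.restrict {t | (z, t) ∈ 𝒟})
  holo : ∀ t : ℝ, DifferentiableOn ℂ (fun z => G z t) {z | (z, t) ∈ 𝒟}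
  bound : ∀ K : Set (ℂ × ℝ), IsCompact K → K ⊆ 𝒟 →
    ∃ k : ℝ → ℝ, (∀ t ∈ Prod.snd '' K, 0 ≤ k t) ∧
      MemLp k d (volume.restrict (Prod.snd '' K)) ∧ ∀ p ∈ K, ‖G p.1 p.2‖ ≤ k p.2

/-- `w` is a Carathéodory solution on the interval `J ∋ s` of `ẇ = G(w,t)`, `w(s) = z`, in `𝒟`:
it is locally absolutely continuous on `J`, its graph lies in `𝒟`, and it satisfies the equation
almost everywhere on `J`. -/
structure IsSolution (𝒟 : Set (ℂ × ℝ)) (G : ℂ → ℝ → ℂ) (s : ℝ) (z : ℂ) (J : Set ℝ)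
    (w : ℝ → ℂ) : Prop where
  ordConnected : J.OrdConnected
  mem : s ∈ J
  init : w s = z
  graph : ∀ t ∈ J, (w t, t) ∈ 𝒟
  absCont : ∀ a ∈ J, ∀ b ∈ J, AbsolutelyContinuousOnInterval w a b
  ode : ∀ᵐ t ∂(volume.restrict J), HasDerivWithinAt w (G (w t) t) J t

/-- `w`, considered on `J`, is the unique non-extendable solution: it is a solution, and every
solution of the same initial value problem is a restriction of it. -/
def IsNonextendableSolution (𝒟 : Set (ℂ × ℝ)) (G : ℂ → ℝ → ℂ) (s : ℝ) (z : ℂ) (J : Set ℝ)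
    (w : ℝ → ℂ) : Prop :=
  IsSolution 𝒟 G s z J w ∧
    ∀ (J' : Set ℝ) (w' : ℝ → ℂ), IsSolution 𝒟 G s z J' w' → J' ⊆ J ∧ EqOn w' w J'

/-- Every initial value problem with data in `𝒟` has a solution on the whole of `[s,∞)`. -/
def IsSemicomplete (𝒟 : Set (ℂ × ℝ)) (G : ℂ → ℝ → ℂ) : Prop :=
  ∀ (z : ℂ) (s : ℝ), (z, s) ∈ 𝒟 → ∃ w : ℝ → ℂ, IsSolution 𝒟 G s z (Ici s) w

/-- The Chebyshev norm `‖f‖_K = sup_{z ∈ K} |f(z)|` (used for `f` continuous on `K` compact). -/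
def supNormOn (K : Set ℂ) (f : ℂ → ℂ) : ℝ := sSup ((fun z => ‖f z‖) '' K)

/-- `t ↦ ψ t` is a locally absolutely continuous map from the interval `I` to `Hol(U,ℂ)`. -/
def IsLocallyACHol (U : Set ℂ) (I : Set ℝ) (ψ : ℝ → ℂ → ℂ) : Prop :=
  (∀ t ∈ I, DifferentiableOn ℂ (ψ t) U) ∧
  ∀ α β : ℝ, α ≤ β → Icc α β ⊆ I →
    ∀ ε > 0, ∀ K : Set ℂ, IsCompact K → K ⊆ U → ∃ δ > 0,
      ∀ (n : ℕ) (a b : Fin n → ℝ),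
        (∀ j, a j ∈ Icc α β ∧ b j ∈ Icc α β ∧ a j ≤ b j) →
        (∀ i j, i ≠ j → Disjoint (Ioo (a i) (b i)) (Ioo (a j) (b j))) →
        ∑ j, (b j - a j) < δ →
        ∑ j, supNormOn K (fun z => ψ (b j) z - ψ (a j) z) < ε

/-- `g ∈ Hol(U,ℂ)` is the derivative at `t₀` of `t ↦ ψ t`, as a map from the interval `I` to
`Hol(U,ℂ)` with the topology of uniform convergence on compact sets. -/
def HasHolDeriv (U : Set ℂ) (I : Set ℝ) (ψ : ℝ → ℂ → ℂ) (g : ℂ → ℂ) (t₀ : ℝ) : Prop :=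
  DifferentiableOn ℂ g U ∧
  ∀ K : Set ℂ, IsCompact K → K ⊆ U →
    TendstoUniformlyOn (fun (t : ℝ) (z : ℂ) => (ψ t z - ψ t₀ z) / ((t - t₀ : ℝ) : ℂ)) g
      (𝓝[I \ {t₀}] t₀) K

/-- `G` is a semicomplete weak holomorphic vector field of order `d` corresponding to the
family `φ`. -/
def IsCorrespondingField (d : ℝ≥0∞) (r : ℝ → ℝ) (φ : ℝ → ℝ → ℂ → ℂ) (G : ℂ → ℝ → ℂ) : Prop :=
  IsWeakHolVectorField d (spaceTime r) G ∧ IsSemicomplete (spaceTime r) G ∧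
  ∃ N : Set ℝ, N ⊆ Ici 0 ∧ volume N = 0 ∧ ∀ s, 0 ≤ s →
    IsLocallyACHol (annulus (r s)) (Ici s) (φ s) ∧
    (∀ t ∈ Ici s \ N, ∃ g : ℂ → ℂ, HasHolDeriv (annulus (r s)) (Ici s) (φ s) g t) ∧
    (∀ t ∈ Ici s \ N,
      HasHolDeriv (annulus (r s)) (Ici s) (φ s) (fun z => G (φ s t z) t) t)

end AnnulusLoewner

end

/-!
Both directions rest on integral inequalities with `L^d` coefficients, combined with Cauchy's
estimates.

**From evolution families to vector fields.** The condition on an evolution family bounds the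
increments of each single trajectory, with a coefficient that depends on the point. The main step
makes this bound uniform on compact sets, with one coefficient (`IsEvolutionFamily.exists_control`).
It relies on an estimate for a single holomorphic map `f : 𝔸_{r₁} → 𝔸_{r₂}`, `r₂ ≤ r₁`, that is
close to the identity on a circle: on closed subannuli `‖f z - z‖` is at most a constant times
`κ + r₁ log (r₁ / r₂)`, where `κ` bounds the displacement at finitely many points of the circle
(`exists_displacement_bound`). For the proof, let `H` be the logarithm of `f(z)/z` in the coordinate
`ζ = log z`, a `2πi`-periodic function on a strip. The conditions `|f| < 1` and `|f| > r₂` bound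
`Re H` on the two sides of the strip. Hence the coefficients of the Laurent expansion of `H` are
dominated by `-Re c₀` and `log (r₁ / r₂)` (`laurent_coeff_bounds`), and averaging `H` over
sufficiently many equidistributed points recovers `c₀` from the values at these points.

The term `r₁ log (r₁ / r₂)` is at most twice the decrease of the inner radius if the radius is not
more than halved, and the inner radius is a smooth function of `ω`, so that it decreases at an `L^d`
rate. Applied to `φ_{u,t}` for `t` close to `u`, the estimate gives a local bound, which integrates
to `‖φ_{s,t}(z) - φ_{s,u}(z)‖ ≤ C ∫_u^t k` on compact sets. At almost every time `t` the primitive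
of `k` and countably many trajectories are differentiable. The difference quotients of `τ ↦ φ_{s,τ}`
at `t` are then locally bounded and converge on a dense set, and a theorem of Vitali type
(`exists_tendstoLocallyUniformlyOn_of_dense`) gives their locally uniform convergence. For `s = t`
the required density holds because `φ_{σ,t}(q) → q` as `σ ↑ t`. The vector field is the derivative
of `φ_{t,τ}` at `τ = t`.

**From vector fields to evolution families.** By Cauchy's estimates a weak holomorphic vector field
and its divided differences are Lipschitz in a tube around a trajectory, with an integrable
coefficient (`IsWeakHolVectorField.exists_lipschitz_tube`). A Grönwall inequality restricted to the
tube (`gronwall_tube`) gives uniqueness in both time directions, and therefore the non-extendable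
solution as the union of all solutions. It also gives the stability of trajectories, and shows that
the difference quotients in the initial value form a Cauchy family, so that the semiflow is
holomorphic (`IsSemiflow.differentiableAt`). The increments of the trajectories of one point,
started at all times of a compact interval, are bounded uniformly because these trajectories stay in
a compact subset of `𝒟` (`IsSemiflow.exists_compact`).
-/

namespace AnnulusLoewner

/-! ### Absolutely continuous functions and integral inequalities -/

/-- Absolute continuity passes from `f` to `g` when the increments of `g` are controlled by
those of `f`. -/
theorem absolutelyContinuousOnInterval_of_dist_le {X Y : Type*} [PseudoMetricSpace X]
    [PseudoMetricSpace Y] {f : ℝ → X} {g : ℝ → Y} {a b C : ℝ}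
    (hf : AbsolutelyContinuousOnInterval f a b)
    (h : ∀ x ∈ uIcc a b, ∀ y ∈ uIcc a b, dist (g x) (g y) ≤ C * dist (f x) (f y)) :
    AbsolutelyContinuousOnInterval g a b := by
  unfold AbsolutelyContinuousOnInterval at *
  have h2 := hf.const_mul C
  rw [mul_zero] at h2
  refine squeeze_zero' (Eventually.of_forall fun E => Finset.sum_nonneg fun _ _ => dist_nonneg) ?_ h2
  have h3 : ∀ᶠ E in AbsolutelyContinuousOnInterval.totalLengthFilter ⊓
      𝓟 (AbsolutelyContinuousOnInterval.disjWithin a b),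
      E ∈ AbsolutelyContinuousOnInterval.disjWithin a b :=
    eventually_inf_principal.mpr (by simp)
  filter_upwards [h3] with E hE
  rw [Finset.mul_sum]
  refine Finset.sum_le_sum fun i hi => ?_
  exact h _ (hE.1 i hi).1 _ (hE.1 i hi).2

/-- The mean value inequality for absolutely continuous functions. -/
theorem norm_sub_le_integral_of_ae_hasDerivAt {w : ℝ → ℂ} {k : ℝ → ℝ} {a b : ℝ} (hab : a ≤ b)
    (hw : AbsolutelyContinuousOnInterval w a b) (hk : IntervalIntegrable k volume a b)
    (hd : ∀ᵐ t, t ∈ Ioo a b → ∃ v, HasDerivAt w v t ∧ ‖v‖ ≤ k t) :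
    ‖w b - w a‖ ≤ ∫ t in a..b, k t := by
  set v := w b - w a with hv
  -- testing against the direction of the increment reduces to the real valued theorem
  set u : ℝ → ℝ := fun t => (starRingEnd ℂ v * w t).re with hu
  have hne : ∀ᵐ t : ℝ, t ≠ b := by simp [ae_iff, measure_singleton]
  have hu1 : AbsolutelyContinuousOnInterval u a b := by
    refine absolutelyContinuousOnInterval_of_dist_le (C := ‖v‖) hw fun x _ y _ => ?_
    rw [dist_eq_norm, dist_eq_norm]
    have : u x - u y = (starRingEnd ℂ v * (w x - w y)).re := by
      simp only [hu]; rw [mul_sub, Complex.sub_re]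
    rw [this, Real.norm_eq_abs]
    refine (Complex.abs_re_le_norm _).trans ?_
    rw [norm_mul, RCLike.norm_conj]
  have h1 := hu1.integral_deriv_eq_sub
  have h2 : u b - u a = ‖v‖ ^ 2 := by
    simp only [hu]
    rw [← Complex.sub_re, ← mul_sub, ← hv, mul_comm, Complex.mul_conj, Complex.normSq_eq_norm_sq]
    norm_cast
  have h3 : ∫ t in a..b, deriv u t ≤ ∫ t in a..b, ‖v‖ * k t := by
    refine intervalIntegral.integral_mono_ae_restrict hab hu1.intervalIntegrable_deriv (hk.const_mul _) ?_
    rw [EventuallyLE, ae_restrict_iff' measurableSet_Icc]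
    have hne' : ∀ᵐ t : ℝ, t ≠ a := by simp [ae_iff, measure_singleton]
    filter_upwards [hd, hne, hne'] with t ht htb hta hmem
    obtain ⟨d, hd1, hd2⟩ := ht ⟨lt_of_le_of_ne hmem.1 (Ne.symm hta), lt_of_le_of_ne hmem.2 htb⟩
    have h4 : HasDerivAt u (starRingEnd ℂ v * d).re t := by
      have := (hd1.const_mul (starRingEnd ℂ v))
      exact (Complex.reCLM.hasFDerivAt.comp_hasDerivAt t this)
    rw [h4.deriv]
    refine (Complex.re_le_norm _).trans ?_
    rw [norm_mul, RCLike.norm_conj]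
    gcongr
  rw [h1, h2, intervalIntegral.integral_const_mul] at h3
  rcases (norm_nonneg v).eq_or_lt with h0 | h0
  · rw [← h0]
    refine intervalIntegral.integral_nonneg_of_ae_restrict hab ?_
    rw [EventuallyLE, ae_restrict_iff' measurableSet_Icc]
    have hne' : ∀ᵐ t : ℝ, t ≠ a := by simp [ae_iff, measure_singleton]
    filter_upwards [hd, hne, hne'] with t ht htb hta hmem
    obtain ⟨d, hd1, hd2⟩ := ht ⟨lt_of_le_of_ne hmem.1 (Ne.symm hta), lt_of_le_of_ne hmem.2 htb⟩
    exact (norm_nonneg _).trans hd2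
  · nlinarith

/-- A function whose increments are dominated by the integral of an integrable function is
absolutely continuous. -/
theorem absolutelyContinuousOnInterval_of_norm_sub_le_integral {w : ℝ → ℂ} {k : ℝ → ℝ} {a b : ℝ}
    (hab : a ≤ b) (hk : IntervalIntegrable k volume a b)
    (h : ∀ u t, a ≤ u → u ≤ t → t ≤ b → ‖w u - w t‖ ≤ ∫ x in u..t, k x) :
    AbsolutelyContinuousOnInterval w a b := by
  have h1 := hk.absolutelyContinuousOnInterval_intervalIntegral (c := a) left_mem_uIcc
  refine absolutelyContinuousOnInterval_of_dist_le (C := 1) h1 fun x hx y hy => ?_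
  rw [uIcc_of_le hab] at hx hy
  have key : ∀ x ∈ Icc a b, ∀ y ∈ Icc a b, x ≤ y →
      dist (w x) (w y) ≤ 1 * dist (∫ v in a..x, k v) (∫ v in a..y, k v) := by
    intro x hx y hy hxy
    rw [one_mul, dist_comm (∫ v in a..x, k v), Real.dist_eq, intervalIntegral.integral_interval_sub_left,
      dist_eq_norm]
    · exact (h x y hx.1 hxy hy.2).trans (le_abs_self _)
    · exact hk.mono_set (by rw [uIcc_of_le hab, uIcc_of_le hy.1]; exact Icc_subset_Icc_right hy.2)
    · exact hk.mono_set (by rw [uIcc_of_le hab, uIcc_of_le hx.1]; exact Icc_subset_Icc_right hx.2)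
  rcases le_total x y with hxy | hxy
  · exact key x hx y hy hxy
  · rw [dist_comm, dist_comm (∫ v in a..x, k v)]; exact key y hy x hx hxy

theorem continuousOn_integral_Icc {k : ℝ → ℝ} {a b c : ℝ} (hab : a ≤ b)
    (hk : IntervalIntegrable k volume a b) (hc : c ∈ Icc a b) :
    ContinuousOn (fun t => ∫ x in c..t, k x) (Icc a b) := by
  have := intervalIntegral.continuousOn_primitive_interval' hk (by rwa [uIcc_of_le hab])
  rwa [uIcc_of_le hab] at this

theorem intervalIntegrable_of_mem_Icc {k : ℝ → ℝ} {a b c d : ℝ} (hab : a ≤ b)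
    (hk : IntervalIntegrable k volume a b) (hc : c ∈ Icc a b) (hd : d ∈ Icc a b) :
    IntervalIntegrable k volume c d :=
  hk.mono_set (by
    rw [uIcc_of_le hab]
    exact uIcc_subset_Icc hc hd)

/-- A bound for the increments by the integral of a fixed function that is only known to hold
locally to the right of each point holds globally. -/
theorem norm_sub_le_integral_of_local_right {E : Type*} [NormedAddCommGroup E] {x : ℝ → E}
    {k : ℝ → ℝ} {a b : ℝ} (hk : IntervalIntegrable k volume a b)
    (hx : ContinuousOn x (Icc a b))
    (hloc : ∀ u ∈ Ico a b, ∃ δ > 0, ∀ t ∈ Icc a b, u ≤ t → t < u + δ →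
      ‖x u - x t‖ ≤ ∫ ξ in u..t, k ξ) (hab : a ≤ b) :
    ‖x a - x b‖ ≤ ∫ ξ in a..b, k ξ := by
  have hsub : Icc a b ⊆ {t | ‖x a - x t‖ ≤ ∫ ξ in a..t, k ξ} := by
    refine IsClosed.Icc_subset_of_forall_exists_gt ?_ (by simp) ?_
    · have : {t | ‖x a - x t‖ ≤ ∫ ξ in a..t, k ξ} ∩ Icc a b = Icc a b ∩
          (fun t => (∫ ξ in a..t, k ξ) - ‖x a - x t‖) ⁻¹' Ici 0 := by
        ext t; simp [and_comm]
      rw [this]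
      exact ContinuousOn.preimage_isClosed_of_isClosed
        ((continuousOn_integral_Icc hab hk (left_mem_Icc.2 hab)).sub
          (continuousOn_const.sub hx).norm) isClosed_Icc isClosed_Ici
    · intro u hu y hy
      obtain ⟨δ, hδ, h⟩ := hloc u hu.2
      have hlt : u < min y (min b (u + δ / 2)) := by
        simp only [lt_min_iff]; exact ⟨hy, hu.2.2, by linarith⟩
      set t := min y (min b (u + δ / 2)) with ht
      have htb : t ≤ b := (min_le_right _ _).trans (min_le_left _ _)
      have htd : t ≤ u + δ / 2 := (min_le_right _ _).trans (min_le_right _ _)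
      refine ⟨t, ?_, hlt, min_le_left _ _⟩
      have h1 := h t ⟨hu.2.1.trans hlt.le, htb⟩ hlt.le (by linarith)
      have h2 : ‖x a - x u‖ ≤ ∫ ξ in a..u, k ξ := hu.1
      have hum : u ∈ Icc a b := ⟨hu.2.1, hu.2.2.le⟩
      have htm : t ∈ Icc a b := ⟨hu.2.1.trans hlt.le, htb⟩
      have h3 := intervalIntegral.integral_add_adjacent_intervals
        (intervalIntegrable_of_mem_Icc hab hk (left_mem_Icc.2 hab) hum)
        (intervalIntegrable_of_mem_Icc hab hk hum htm)
      show ‖x a - x t‖ ≤ _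
      rw [← h3]
      have := norm_sub_le_norm_sub_add_norm_sub (x a) (x u) (x t)
      linarith
  exact hsub (right_mem_Icc.2 hab)

/-- A Grönwall inequality with an integrable coefficient, localized to a tube of radius `ε`: the
growth hypothesis is only required where `x ≤ ε`, and the conclusion keeps `x` inside the tube. As
the growth hypothesis is stated for the maximum of `x`, one step costs a factor `1 / (1 - η)` with
`η` the mass of `lam`; this is at most `exp (2η)` for `η ≤ 1/2`, whence the factor `2`. -/
theorem gronwall_tube {x lam : ℝ → ℝ} {a b ε : ℝ} (hab : a ≤ b)
    (hx : ContinuousOn x (Icc a b)) (hx0 : ∀ t ∈ Icc a b, 0 ≤ x t)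
    (hlam : IntervalIntegrable lam volume a b) (hlam0 : ∀ t ∈ Icc a b, 0 ≤ lam t)
    (hgrow : ∀ t ∈ Icc a b, ∀ t' ∈ Icc a b, t ≤ t' → ∀ M ≤ ε, (∀ τ ∈ Icc t t', x τ ≤ M) →
      x t' ≤ x t + M * ∫ ξ in t..t', lam ξ)
    (hstart : x a * Real.exp (2 * ∫ ξ in a..b, lam ξ) < ε) :
    ∀ t ∈ Icc a b, x t ≤ x a * Real.exp (2 * ∫ ξ in a..t, lam ξ) := by
  have hcl : ContinuousOn (fun t => ∫ ξ in a..t, lam ξ) (Icc a b) :=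
    continuousOn_integral_Icc hab hlam (left_mem_Icc.2 hab)
  have hxa := hx0 a (left_mem_Icc.2 hab)
  have hmono : ∀ u ∈ Icc a b, ∀ t ∈ Icc a b, u ≤ t → 0 ≤ ∫ ξ in u..t, lam ξ := by
    intro u hu t ht hut
    exact intervalIntegral.integral_nonneg hut fun ξ hξ =>
      hlam0 ξ ⟨hu.1.trans hξ.1, hξ.2.trans ht.2⟩
  have hadd : ∀ u ∈ Icc a b, ∀ t ∈ Icc a b,
      (∫ ξ in a..u, lam ξ) + ∫ ξ in u..t, lam ξ = ∫ ξ in a..t, lam ξ := by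
    intro u hu t ht
    exact intervalIntegral.integral_add_adjacent_intervals
      (intervalIntegrable_of_mem_Icc hab hlam (left_mem_Icc.2 hab) hu)
      (intervalIntegrable_of_mem_Icc hab hlam hu ht)
  refine IsClosed.Icc_subset_of_forall_exists_gt (s := {t | x t ≤ x a * Real.exp (2 * ∫ ξ in a..t, lam ξ)}) ?_ ?_ ?_
  · have : {t | x t ≤ x a * Real.exp (2 * ∫ ξ in a..t, lam ξ)} ∩ Icc a b = Icc a b ∩
        (fun t => x a * Real.exp (2 * ∫ ξ in a..t, lam ξ) - x t) ⁻¹' Ici 0 := by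
      ext t; simp [and_comm]
    rw [this]
    exact ContinuousOn.preimage_isClosed_of_isClosed
      ((continuousOn_const.mul (Real.continuous_exp.comp_continuousOn
        (continuousOn_const.mul hcl))).sub hx) isClosed_Icc isClosed_Ici
  · simp
  · intro u hu y hy
    have hum : u ∈ Icc a b := ⟨hu.2.1, hu.2.2.le⟩
    have hxu : x u ≤ x a * Real.exp (2 * ∫ ξ in a..u, lam ξ) := hu.1
    have hlt : x u < ε := by
      refine hxu.trans_lt (lt_of_le_of_lt ?_ hstart)
      gcongr
      rw [← hadd u hum b (right_mem_Icc.2 hab)]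
      have := hmono u hum b (right_mem_Icc.2 hab) hum.2
      linarith
    -- near `u` the function stays in the tube and the coefficient has small mass
    have hev1 : ∀ᶠ t in 𝓝[Icc a b] u, x t < ε := (hx u hum).eventually_lt continuousWithinAt_const hlt
    have hev2 : ∀ᶠ t in 𝓝[Icc a b] u, ∫ ξ in u..t, lam ξ < 1 / 2 := by
      have h1 := continuousOn_integral_Icc hab hlam hum u hum
      refine h1.eventually_lt continuousWithinAt_const ?_
      simp
    obtain ⟨δ, hδ, hball⟩ := Metric.mem_nhdsWithin_iff.1 (hev1.and hev2)
    have hltt : u < min y (min b (u + δ / 2)) := by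
      simp only [lt_min_iff]; exact ⟨hy, hu.2.2, by linarith⟩
    set t := min y (min b (u + δ / 2)) with ht
    have htb : t ≤ b := (min_le_right _ _).trans (min_le_left _ _)
    have htd : t ≤ u + δ / 2 := (min_le_right _ _).trans (min_le_right _ _)
    have htm : t ∈ Icc a b := ⟨hum.1.trans hltt.le, htb⟩
    have hin : ∀ τ ∈ Icc u t, x τ < ε ∧ ∫ ξ in u..τ, lam ξ < 1 / 2 := by
      intro τ hτ
      refine hball ⟨?_, hum.1.trans hτ.1, hτ.2.trans htb⟩
      rw [Metric.mem_ball, Real.dist_eq, abs_of_nonneg (by linarith [hτ.1])]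
      linarith [hτ.2]
    refine ⟨t, ?_, hltt, min_le_left _ _⟩
    show x t ≤ x a * Real.exp (2 * ∫ ξ in a..t, lam ξ)
    obtain ⟨τ, hτ, hmax⟩ := isCompact_Icc.exists_isMaxOn (nonempty_Icc.2 hltt.le)
      (hx.mono (Icc_subset_Icc hum.1 htb))
    have hτm : τ ∈ Icc a b := ⟨hum.1.trans hτ.1, hτ.2.trans htb⟩
    have hg := hgrow u hum τ hτm hτ.1 (x τ) (hin τ hτ).1.le
      (fun σ hσ => hmax ⟨hσ.1, hσ.2.trans hτ.2⟩)
    set η := ∫ ξ in u..t, lam ξ with hη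
    have hητ : ∫ ξ in u..τ, lam ξ ≤ η := by
      have h1 := hadd u hum t htm
      have h2 := hadd u hum τ hτm
      have h3 := hadd τ hτm t htm
      have := hmono τ hτm t htm hτ.2
      linarith
    have hη0 : 0 ≤ η := hmono u hum t htm hltt.le
    have hη1 : η < 1 / 2 := (hin t (right_mem_Icc.2 hltt.le)).2
    have hxτ0 := hx0 τ hτm
    have h1 : x τ * (1 - η) ≤ x u := by nlinarith
    have h2 : x t ≤ x τ := hmax (right_mem_Icc.2 hltt.le)
    have h3 : 1 ≤ Real.exp (2 * η) * (1 - η) := by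
      have := Real.quadratic_le_exp_of_nonneg (x := 2 * η) (by linarith)
      nlinarith
    have h4 : x t ≤ x u * Real.exp (2 * η) := by
      have hx0u := hx0 u hum
      have he := Real.exp_pos (2 * η)
      calc x t ≤ x τ := h2
        _ ≤ x τ * (Real.exp (2 * η) * (1 - η)) := by nlinarith
        _ = (x τ * (1 - η)) * Real.exp (2 * η) := by ring
        _ ≤ x u * Real.exp (2 * η) := by gcongr
    calc x t ≤ x u * Real.exp (2 * η) := h4
      _ ≤ (x a * Real.exp (2 * ∫ ξ in a..u, lam ξ)) * Real.exp (2 * η) := by gcongr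
      _ = x a * Real.exp (2 * ∫ ξ in a..t, lam ξ) := by
        rw [← hadd u hum t htm, mul_assoc, ← Real.exp_add]; congr 2; rw [← hη]; ring

/-! ### Fourier coefficients of periodic holomorphic functions on a strip -/

/-- A nonvanishing holomorphic function on a convex open set has a holomorphic logarithm. -/
theorem exists_differentiableOn_exp_eq {U : Set ℂ} (hU : IsOpen U) (hc : Convex ℝ U)
    (hne : U.Nonempty) {h : ℂ → ℂ} (hh : DifferentiableOn ℂ h U) (h0 : ∀ z ∈ U, h z ≠ 0) :
    ∃ H : ℂ → ℂ, DifferentiableOn ℂ H U ∧ ∀ z ∈ U, Complex.exp (H z) = h z := by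
  have hsc : IsSimplyConnected U := by
    have := hc.contractibleSpace hne
    unfold IsSimplyConnected
    infer_instance
  obtain ⟨H, hHc, hH⟩ := Complex.exists_continuousOn_eqOn_exp_comp hsc hU hh.continuousOn
    (by rintro ⟨z, hz, hz0⟩; exact h0 z hz hz0)
  refine ⟨H, fun z hz => ?_, hH⟩
  have hUz := hU.mem_nhds hz
  have hev : Complex.exp ∘ H =ᶠ[𝓝 z] h := by
    filter_upwards [hUz] with w hw using hH hw
  exact (HasDerivAt.of_comp_left (hHc.continuousAt hUz) (Complex.hasDerivAt_exp (H z))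
    (hh.differentiableAt hUz).hasDerivAt (Complex.exp_ne_zero _)
    hev).differentiableAt.differentiableWithinAt

/-- Pointwise convergence of absolutely convergent Fourier series, for periodic functions on the
line. -/
theorem hasSum_fourier_of_continuous_periodic {g : ℝ → ℂ} (hg : Continuous g)
    (hper : Function.Periodic g (2 * Real.pi)) {c : ℤ → ℂ}
    (hc : ∀ n : ℤ, c n = (1 / (2 * Real.pi) : ℂ) *
      ∫ θ in (0 : ℝ)..2 * Real.pi, Complex.exp (-(n * θ * Complex.I)) * g θ)
    (hs : Summable fun n => ‖c n‖) (θ : ℝ) :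
    HasSum (fun n : ℤ => c n * Complex.exp (n * θ * Complex.I)) (g θ) := by
  have : Fact (0 < 2 * Real.pi) := ⟨Real.two_pi_pos⟩
  set F : C(AddCircle (2 * Real.pi), ℂ) := ⟨hper.lift, by
    exact hg.quotient_lift _⟩ with hF
  have hcoeff : fourierCoeff F = c := by
    funext n
    rw [fourierCoeff_eq_intervalIntegral F n 0, hc, zero_add]
    rw [Complex.real_smul]
    congr 1
    · push_cast; ring
    refine intervalIntegral.integral_congr fun x _ => ?_
    simp only [fourier_coe_apply, smul_eq_mul, hF]
    congr 1
    congr 1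
    have : (Real.pi : ℂ) ≠ 0 := by exact_mod_cast Real.pi_ne_zero
    push_cast
    field_simp
  have := has_pointwise_sum_fourier_series_of_summable (f := F) (by rw [hcoeff]; exact hs.of_norm)
    (θ : AddCircle (2 * Real.pi))
  rw [hcoeff] at this
  convert! this using 2 with n
  rw [fourier_coe_apply, smul_eq_mul]
  congr 2
  have : (Real.pi : ℂ) ≠ 0 := by exact_mod_cast Real.pi_ne_zero
  push_cast
  field_simp

/-- The Fourier coefficients of the real part of a function bounded above by `B` are dominated by
the distance of its mean from `B`. -/
theorem norm_fourierCoeff_add_conj_le {g : ℝ → ℂ} (hg : Continuous g) {a : ℤ → ℂ}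
    (ha : ∀ n : ℤ, a n = (1 / (2 * Real.pi) : ℂ) *
      ∫ θ in (0 : ℝ)..2 * Real.pi, Complex.exp (-(n * θ * Complex.I)) * g θ)
    {B : ℝ} (hB : ∀ θ, (g θ).re ≤ B) {n : ℤ} (hn : n ≠ 0) :
    ‖a n + starRingEnd ℂ (a (-n))‖ ≤ 2 * (B - (a 0).re) := by
  have hpi := Real.pi_pos
  have hpi' : (Real.pi : ℂ) ≠ 0 := by exact_mod_cast Real.pi_ne_zero
  have hI : ∀ n : ℤ, Continuous fun θ : ℝ => Complex.exp (-(n * θ * Complex.I)) := by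
    intro n; fun_prop
  have h1 : starRingEnd ℂ (a (-n)) = (1 / (2 * Real.pi) : ℂ) *
      ∫ θ in (0 : ℝ)..2 * Real.pi, Complex.exp (-(n * θ * Complex.I)) * starRingEnd ℂ (g θ) := by
    rw [ha, map_mul]
    congr 1
    · rw [map_div₀, map_mul, Complex.conj_ofReal, map_one, Complex.conj_ofNat]
    have := (Complex.conjCLE : ℂ →L[ℝ] ℂ).intervalIntegral_comp_comm
      (((hI (-n)).mul hg).intervalIntegrable (μ := volume) 0 (2 * Real.pi))
    simp only [ContinuousLinearEquiv.coe_coe, Complex.conjCLE_apply, Pi.mul_apply] at this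
    rw [← this]
    refine intervalIntegral.integral_congr fun θ _ => ?_
    simp only [map_mul, ← Complex.exp_conj]
    congr 2
    simp
  have h2 : ∫ θ in (0 : ℝ)..2 * Real.pi, Complex.exp (-(n * θ * Complex.I)) = 0 := by
    have hc : (-(n * Complex.I) : ℂ) ≠ 0 := by simpa using hn
    have := integral_exp_mul_complex (a := 0) (b := 2 * Real.pi) hc
    have h3 : ∀ θ : ℝ, Complex.exp (-(n * θ * Complex.I)) = Complex.exp (-(n * Complex.I) * θ) := by
      intro θ; congr 1; ring
    simp only [h3, this]
    have h4 : Complex.exp (-(n * Complex.I) * ((2 * Real.pi : ℝ) : ℂ)) = 1 := by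
      rw [Complex.exp_eq_one_iff]
      exact ⟨-n, by push_cast; ring⟩
    rw [h4]; simp
  have h3 : a n + starRingEnd ℂ (a (-n)) = (1 / (2 * Real.pi) : ℂ) *
      ∫ θ in (0 : ℝ)..2 * Real.pi, Complex.exp (-(n * θ * Complex.I)) *
        ((2 * ((g θ).re - B) : ℝ) : ℂ) := by
    rw [h1, ha, ← mul_add, ← intervalIntegral.integral_add]
    · congr 1
      have : ∀ θ : ℝ, Complex.exp (-(n * θ * Complex.I)) * ((2 * ((g θ).re - B) : ℝ) : ℂ) =
          (Complex.exp (-(n * θ * Complex.I)) * g θ + Complex.exp (-(n * θ * Complex.I)) *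
            starRingEnd ℂ (g θ)) - Complex.exp (-(n * θ * Complex.I)) * (2 * B) := by
        intro θ
        rw [← mul_add, Complex.add_conj]; push_cast; ring
      simp only [this]
      rw [intervalIntegral.integral_sub, intervalIntegral.integral_mul_const, h2]
      · simp
      · exact Continuous.intervalIntegrable (by fun_prop) _ _
      · exact Continuous.intervalIntegrable (by fun_prop) _ _
    · exact Continuous.intervalIntegrable (by fun_prop) _ _
    · exact Continuous.intervalIntegrable (by fun_prop) _ _
  have h4 : (a 0).re = 1 / (2 * Real.pi) * ∫ θ in (0 : ℝ)..2 * Real.pi, (g θ).re := by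
    rw [ha]
    have := Complex.reCLM.intervalIntegral_comp_comm
      (hg.intervalIntegrable (μ := volume) 0 (2 * Real.pi))
    simp only [Complex.reCLM_apply] at this
    rw [this]
    have h5 : (1 / (2 * Real.pi) : ℂ) = ((1 / (2 * Real.pi) : ℝ) : ℂ) := by push_cast; ring
    rw [h5, Complex.re_ofReal_mul]
    simp
  rw [h3, norm_mul]
  have h5 : ‖(1 / (2 * Real.pi) : ℂ)‖ = 1 / (2 * Real.pi) := by
    rw [norm_div, norm_mul]; simp [abs_of_pos hpi]
  rw [h5]
  have h6 : ‖∫ θ in (0 : ℝ)..2 * Real.pi, Complex.exp (-(n * θ * Complex.I)) *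
        ((2 * ((g θ).re - B) : ℝ) : ℂ)‖ ≤ ∫ θ in (0 : ℝ)..2 * Real.pi, 2 * (B - (g θ).re) := by
    refine intervalIntegral.norm_integral_le_of_norm_le (by positivity)
      (Eventually.of_forall fun θ _ => ?_) ?_
    · rw [norm_mul, Complex.norm_exp, Complex.norm_real, Real.norm_eq_abs, abs_of_nonpos (by linarith [hB θ])]
      simp
      linarith
    · exact Continuous.intervalIntegrable (by fun_prop) _ _
  calc _ ≤ 1 / (2 * Real.pi) * ∫ θ in (0 : ℝ)..2 * Real.pi, 2 * (B - (g θ).re) := by gcongr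
    _ = 2 * (B - (a 0).re) := by
      rw [intervalIntegral.integral_const_mul, intervalIntegral.integral_sub, h4]
      · simp only [intervalIntegral.integral_const, sub_zero, smul_eq_mul]
        field_simp
      · exact intervalIntegrable_const
      · exact Continuous.intervalIntegrable (by fun_prop) _ _

/-- The preimage of the annulus of inner radius `r` under the exponential: a vertical strip, or
the left half-plane when `r = 0`. -/
def logStrip (r : ℝ) : Set ℂ := {ζ | r < Real.exp ζ.re ∧ ζ.re < 0}

theorem exp_mem_annulus_iff {r : ℝ} {ζ : ℂ} : Complex.exp ζ ∈ annulus r ↔ ζ ∈ logStrip r := by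
  simp [annulus, logStrip, Complex.norm_exp]

theorem isOpen_logStrip (r : ℝ) : IsOpen (logStrip r) :=
  (isOpen_lt (g := fun ζ : ℂ => Real.exp ζ.re) continuous_const (by fun_prop)).inter
    (isOpen_lt (f := fun ζ : ℂ => ζ.re) (by fun_prop) continuous_const)

theorem convex_logStrip (r : ℝ) : Convex ℝ (logStrip r) := by
  have h1 : Convex ℝ {x : ℝ | r < Real.exp x ∧ x < 0} := by
    refine Set.OrdConnected.convex ⟨fun x hx y hy z hz => ⟨?_, ?_⟩⟩
    · exact hx.1.trans_le (Real.exp_le_exp.2 hz.1)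
    · exact hz.2.trans_lt hy.2
  exact h1.linear_preimage Complex.reLm

theorem ofReal_add_mem_logStrip {r x : ℝ} (hx : r < Real.exp x) (hx0 : x < 0) (θ : ℝ) :
    (x + θ * Complex.I : ℂ) ∈ logStrip r := by
  simp [logStrip, hx, hx0]

/-- The coefficients of the expansion of a `2πi`-periodic function `H` in powers of `exp ζ`, computed
on the line `Re ζ = x`. -/
noncomputable def stripCoeff (H : ℂ → ℂ) (n : ℤ) (x : ℝ) : ℂ :=
  (1 / (2 * Real.pi) : ℂ) * ∫ θ in (0 : ℝ)..2 * Real.pi,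
    Complex.exp (-(n * (x + θ * Complex.I))) * H (x + θ * Complex.I)

theorem stripCoeff_mul_exp (H : ℂ → ℂ) (n : ℤ) (x : ℝ) :
    stripCoeff H n x * Complex.exp (n * x) = (1 / (2 * Real.pi) : ℂ) *
      ∫ θ in (0 : ℝ)..2 * Real.pi, Complex.exp (-(n * θ * Complex.I)) * H (x + θ * Complex.I) := by
  rw [stripCoeff, mul_assoc, ← intervalIntegral.integral_mul_const]
  congr 1
  refine intervalIntegral.integral_congr fun θ _ => ?_
  show _ * _ * _ = _
  rw [mul_right_comm, ← Complex.exp_add]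
  congr 2; ring

/-- By Cauchy's theorem the Laurent coefficients do not depend on the line of integration. -/
theorem stripCoeff_eq {r : ℝ} {H : ℂ → ℂ} (hH : DifferentiableOn ℂ H (logStrip r))
    (hper : ∀ ζ ∈ logStrip r, H (ζ + 2 * Real.pi * Complex.I) = H ζ) (n : ℤ) {x y : ℝ}
    (hx : r < Real.exp x) (hx0 : x < 0) (hy : r < Real.exp y) (hy0 : y < 0) :
    stripCoeff H n x = stripCoeff H n y := by
  set F : ℂ → ℂ := fun ζ => Complex.exp (-(n * ζ)) * H ζ with hF
  have hFd : DifferentiableOn ℂ F (logStrip r) :=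
    (DifferentiableOn.cexp (by fun_prop)).mul hH
  have hsub : uIcc x y ×ℂ uIcc 0 (2 * Real.pi) ⊆ logStrip r := by
    intro ζ hζ
    have h1 : ζ.re ∈ uIcc x y := hζ.1
    constructor
    · have : min x y ≤ ζ.re := h1.1
      refine lt_of_lt_of_le ?_ (Real.exp_le_exp.2 this)
      rcases min_choice x y with h | h <;> rw [h] <;> assumption
    · exact h1.2.trans_lt (max_lt hx0 hy0)
  have h1 := Complex.integral_boundary_rect_eq_zero_of_differentiableOn F (x : ℂ)
    (y + (2 * Real.pi : ℝ) * Complex.I) (hFd.mono (by simpa only [Complex.ofReal_re, Complex.ofReal_im, Complex.add_re, Complex.add_im, Complex.mul_re,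
      Complex.mul_im, Complex.I_re, Complex.I_im, mul_zero, mul_one, zero_add, add_zero, sub_zero,
      zero_mul] using hsub))
  simp only [Complex.ofReal_re, Complex.ofReal_im, Complex.add_re, Complex.add_im, Complex.mul_re,
    Complex.mul_im, Complex.I_re, Complex.I_im, mul_zero, mul_one, zero_add, add_zero, sub_zero,
    Complex.ofReal_zero, zero_mul, smul_eq_mul] at h1
  have h2 : ∫ t in x..y, F (t : ℂ) = ∫ t in x..y, F (t + (2 * Real.pi : ℝ) * Complex.I) := by
    refine intervalIntegral.integral_congr fun t ht => ?_
    have hmem : (t : ℂ) ∈ logStrip r := hsub ⟨by simpa using ht, by simp⟩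
    simp only [hF]
    have h3 := hper _ hmem
    push_cast
    rw [h3]
    congr 1
    rw [Complex.exp_eq_exp_iff_exists_int]
    exact ⟨n, by ring⟩
  rw [h2, sub_self, zero_add, sub_eq_zero] at h1
  have h3 := mul_left_cancel₀ Complex.I_ne_zero h1
  rw [stripCoeff, stripCoeff]
  congr 1
  exact h3.symm

theorem continuous_stripLine {r : ℝ} {H : ℂ → ℂ} (hH : DifferentiableOn ℂ H (logStrip r))
    {x : ℝ} (hx : r < Real.exp x) (hx0 : x < 0) :
    Continuous fun θ : ℝ => H (x + θ * Complex.I) :=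
  hH.continuousOn.comp_continuous (by fun_prop) fun θ => ofReal_add_mem_logStrip hx hx0 θ

theorem norm_stripCoeff_add_conj_le {r : ℝ} {H : ℂ → ℂ} (hH : DifferentiableOn ℂ H (logStrip r))
    {x : ℝ} (hx : r < Real.exp x) (hx0 : x < 0) {B : ℝ}
    (hB : ∀ θ : ℝ, (H (x + θ * Complex.I)).re ≤ B) {n : ℤ} (hn : n ≠ 0) :
    ‖stripCoeff H n x * Complex.exp (n * x) +
      starRingEnd ℂ (stripCoeff H (-n) x) * Complex.exp (-(n * x))‖ ≤
      2 * (B - (stripCoeff H 0 x).re) := by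
  have h := norm_fourierCoeff_add_conj_le (continuous_stripLine hH hx hx0)
    (a := fun n => stripCoeff H n x * Complex.exp (n * x))
    (fun n => stripCoeff_mul_exp H n x) hB hn
  have h1 : starRingEnd ℂ (stripCoeff H (-n) x * Complex.exp ((-n : ℤ) * x)) =
      starRingEnd ℂ (stripCoeff H (-n) x) * Complex.exp (-(n * x)) := by
    rw [map_mul, ← Complex.exp_conj]
    congr 2
    simp
  simp only [h1] at h
  simpa using h

/-- The Laurent expansion of a periodic holomorphic function with summable coefficients. -/
theorem hasSum_stripCoeff {r : ℝ} {H : ℂ → ℂ} (hH : DifferentiableOn ℂ H (logStrip r))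
    (hper : ∀ ζ ∈ logStrip r, H (ζ + 2 * Real.pi * Complex.I) = H ζ) {x : ℝ}
    (hx : r < Real.exp x) (hx0 : x < 0)
    (hs : Summable fun n : ℤ => ‖stripCoeff H n x * Complex.exp (n * x)‖) (θ : ℝ) :
    HasSum (fun n : ℤ => stripCoeff H n x * Complex.exp (n * (x + θ * Complex.I)))
      (H (x + θ * Complex.I)) := by
  have h := hasSum_fourier_of_continuous_periodic (continuous_stripLine hH hx hx0)
    (fun θ => by
      have := hper _ (ofReal_add_mem_logStrip hx hx0 θ)
      refine Eq.trans ?_ this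
      show H _ = H _
      congr 1; push_cast; ring)
    (fun n => stripCoeff_mul_exp H n x) hs θ
  convert! h using 2 with n
  rw [mul_assoc, ← Complex.exp_add]
  congr 2; ring

/-! ### Laurent coefficients of maps between annuli -/

/-- Bounds for the Laurent coefficients of a logarithm of `f(z)/z`, where `f` is a map between
annuli. The hypotheses are the consequences of `|f| < 1` on the outer and of `|f| > r₂` on the
inner boundary, and the boundary circles are reached by passing to the limit. -/
theorem laurent_coeff_bounds {c : ℤ → ℂ} {r₁ r₂ : ℝ} (h0 : 0 ≤ r₁) (h1 : r₁ < 1)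
    (hr2 : 0 < r₁ → 0 < r₂)
    (hout : ∀ x, r₁ < Real.exp x → x < 0 → ∀ n : ℤ, n ≠ 0 →
      ‖c n * Complex.exp (n * x) + starRingEnd ℂ (c (-n)) * Complex.exp (-(n * x))‖ ≤
        2 * (-x - (c 0).re))
    (hin : 0 < r₁ → ∀ x, r₁ < Real.exp x → x < 0 → ∀ n : ℤ, n ≠ 0 →
      ‖c n * Complex.exp (n * x) + starRingEnd ℂ (c (-n)) * Complex.exp (-(n * x))‖ ≤
        2 * ((c 0).re - (Real.log r₂ - x))) :
    (c 0).re ≤ 0 ∧ ∀ n : ℕ,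
      ‖c (-((n : ℤ) + 1))‖ ≤ 2 * Real.log (r₁ / r₂) / (1 - r₁) * r₁ ^ (n + 1) ∧
      ‖c ((n : ℤ) + 1)‖ ≤ 2 * (-(c 0).re) + ‖c (-((n : ℤ) + 1))‖ := by
  have hout0 : ∀ n : ℤ, n ≠ 0 → ‖c n + starRingEnd ℂ (c (-n))‖ ≤ 2 * (-(c 0).re) := by
    intro n hn
    have hev : ∀ᶠ x : ℝ in 𝓝[<] (0 : ℝ),
        ‖c n * Complex.exp (n * x) + starRingEnd ℂ (c (-n)) * Complex.exp (-(n * x))‖ ≤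
        2 * (-x - (c 0).re) := by
      have he : ∀ᶠ x in 𝓝[<] (0 : ℝ), r₁ < Real.exp x := by
        refine (Real.continuous_exp.tendsto 0).eventually_const_lt (by simpa using h1) |>.filter_mono
          nhdsWithin_le_nhds
      filter_upwards [he, self_mem_nhdsWithin] with x hx hx0
      exact hout x hx hx0 n hn
    have hl : Tendsto (fun x : ℝ => ‖c n * Complex.exp (n * x) +
        starRingEnd ℂ (c (-n)) * Complex.exp (-(n * x))‖) (𝓝[<] 0)
        (𝓝 ‖c n + starRingEnd ℂ (c (-n))‖) := by
      have : Continuous fun x : ℝ => ‖c n * Complex.exp (n * x) +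
        starRingEnd ℂ (c (-n)) * Complex.exp (-(n * x))‖ := by fun_prop
      have := this.tendsto 0
      simp only [Complex.ofReal_zero, mul_zero, neg_zero, Complex.exp_zero, mul_one] at this
      exact this.mono_left nhdsWithin_le_nhds
    have hr : Tendsto (fun x : ℝ => 2 * (-x - (c 0).re)) (𝓝[<] 0) (𝓝 (2 * (-(c 0).re))) := by
      have : Continuous fun x : ℝ => 2 * (-x - (c 0).re) := by fun_prop
      have := this.tendsto 0
      simp only [neg_zero, zero_sub] at this
      exact this.mono_left nhdsWithin_le_nhds
    exact le_of_tendsto_of_tendsto hl hr hev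
  have hm : (c 0).re ≤ 0 := by
    have := (norm_nonneg _).trans (hout0 1 one_ne_zero)
    linarith
  refine ⟨hm, fun n => ?_⟩
  have hn : ((n : ℤ) + 1) ≠ 0 := by omega
  have ho := hout0 _ hn
  constructor
  · rcases h0.eq_or_lt with h00 | hpos
    · -- at a puncture the principal part vanishes
      rw [← h00]
      have hb : ∀ x : ℝ, x < 0 → ‖c (-((n : ℤ) + 1))‖ ≤
          ‖c ((n : ℤ) + 1)‖ * Real.exp (2 * x) + 2 * (-x - (c 0).re) * Real.exp x := by
        intro x hx
        have h := hout x (by rw [← h00]; exact Real.exp_pos x) hx _ hn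
        set E := Complex.exp (((n : ℤ) + 1 : ℤ) * x) with hE
        have hE' : Complex.exp (-(((n : ℤ) + 1 : ℤ) * x)) * E = 1 := by
          rw [hE, ← Complex.exp_add]; simp
        have hEn : ‖E‖ ≤ Real.exp x := by
          rw [hE, Complex.norm_exp]
          apply Real.exp_le_exp.2
          have : ((((n : ℤ) + 1 : ℤ) : ℂ) * x).re = (n + 1) * x := by
            simp
          rw [this]
          have : (0 : ℝ) ≤ n := Nat.cast_nonneg n
          nlinarith
        have h3 : starRingEnd ℂ (c (-((n : ℤ) + 1))) =
            (c ((n : ℤ) + 1) * E + starRingEnd ℂ (c (-((n : ℤ) + 1))) *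
              Complex.exp (-(((n : ℤ) + 1 : ℤ) * x))) * E - c ((n : ℤ) + 1) * (E * E) := by
          linear_combination (-(starRingEnd ℂ (c (-((n : ℤ) + 1))))) * hE'
        rw [← RCLike.norm_conj (c (-((n : ℤ) + 1))), h3]
        refine (norm_sub_le _ _).trans ?_
        rw [norm_mul, norm_mul, norm_mul, add_comm]
        have hx2 : Real.exp (2 * x) = Real.exp x * Real.exp x := by rw [← Real.exp_add]; ring_nf
        rw [hx2]
        have hnn : 0 ≤ 2 * (-x - (c 0).re) := (norm_nonneg _).trans h
        gcongr
      have hlim : Tendsto (fun x : ℝ => ‖c ((n : ℤ) + 1)‖ * Real.exp (2 * x) +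
          2 * (-x - (c 0).re) * Real.exp x) atBot (𝓝 0) := by
        have e1 : Tendsto (fun x : ℝ => Real.exp (2 * x)) atBot (𝓝 0) :=
          Real.tendsto_exp_atBot.comp (tendsto_id.const_mul_atBot (by norm_num : (0 : ℝ) < 2))
        have e2 : Tendsto (fun x : ℝ => x * Real.exp x) atBot (𝓝 0) := by
          have := (Real.tendsto_pow_mul_exp_neg_atTop_nhds_zero 1).comp tendsto_neg_atBot_atTop
          have h2 := this.neg
          simp only [neg_zero] at h2
          refine h2.congr fun x => ?_
          simp
        have := (e1.const_mul ‖c ((n : ℤ) + 1)‖).add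
          ((e2.const_mul (-2)).add (Real.tendsto_exp_atBot.const_mul (-2 * (c 0).re)))
        simp only [mul_zero, add_zero] at this
        refine this.congr fun x => ?_
        ring
      have := ge_of_tendsto hlim (by filter_upwards [eventually_lt_atBot 0] with x hx using hb x hx)
      simpa using this
    · have hr2' := hr2 hpos
      have hx1 : Real.exp (Real.log r₁) = r₁ := Real.exp_log hpos
      have hlog : Real.log r₁ < 0 := Real.log_neg hpos h1
      have hev : ∀ᶠ x : ℝ in 𝓝[>] (Real.log r₁),
          ‖c ((n : ℤ) + 1) * Complex.exp (((n : ℤ) + 1 : ℤ) * x) +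
            starRingEnd ℂ (c (-((n : ℤ) + 1))) * Complex.exp (-(((n : ℤ) + 1 : ℤ) * x))‖ ≤
          2 * ((c 0).re - (Real.log r₂ - x)) := by
        have he : ∀ᶠ x in 𝓝[>] (Real.log r₁), x < 0 :=
          (eventually_lt_nhds hlog).filter_mono nhdsWithin_le_nhds
        filter_upwards [he, self_mem_nhdsWithin] with x hx hx0
        refine hin hpos x ?_ hx _ hn
        rw [← hx1]; exact Real.exp_lt_exp.2 hx0
      have hE : Complex.exp (((n : ℤ) + 1 : ℤ) * (Real.log r₁ : ℝ)) = ((r₁ ^ (n + 1) : ℝ) : ℂ) := by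
        have : (((n : ℤ) + 1 : ℤ) : ℂ) * (Real.log r₁ : ℝ) = (((n + 1 : ℕ) : ℝ) * Real.log r₁ : ℝ) := by
          push_cast; ring
        rw [this, ← Complex.ofReal_exp, Real.exp_nat_mul, hx1]
      have hlim : ‖c ((n : ℤ) + 1) * Complex.exp (((n : ℤ) + 1 : ℤ) * (Real.log r₁ : ℝ)) +
            starRingEnd ℂ (c (-((n : ℤ) + 1))) *
              Complex.exp (-(((n : ℤ) + 1 : ℤ) * (Real.log r₁ : ℝ)))‖ ≤
          2 * ((c 0).re - (Real.log r₂ - Real.log r₁)) := by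
        refine le_of_tendsto_of_tendsto (b := 𝓝[>] (Real.log r₁)) ?_ ?_ hev
        · have : Continuous fun x : ℝ => ‖c ((n : ℤ) + 1) * Complex.exp (((n : ℤ) + 1 : ℤ) * x) +
            starRingEnd ℂ (c (-((n : ℤ) + 1))) * Complex.exp (-(((n : ℤ) + 1 : ℤ) * x))‖ := by
            fun_prop
          exact (this.tendsto _).mono_left nhdsWithin_le_nhds
        · have : Continuous fun x : ℝ => 2 * ((c 0).re - (Real.log r₂ - x)) := by fun_prop
          exact (this.tendsto _).mono_left nhdsWithin_le_nhds
      rw [Complex.exp_neg, hE] at hlim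
      set p := r₁ ^ (n + 1) with hp
      have hp0 : 0 < p := by positivity
      have hp1 : p ≤ r₁ := by
        rw [hp, pow_succ]
        exact mul_le_of_le_one_left h0 (pow_le_one₀ h0 h1.le)
      set L := Real.log (r₁ / r₂) with hL
      have hL' : L = Real.log r₁ - Real.log r₂ := Real.log_div hpos.ne' hr2'.ne'
      set a := c ((n : ℤ) + 1)
      set b := c (-((n : ℤ) + 1))
      have h3 : starRingEnd ℂ b * ((1 - p ^ 2 : ℝ) : ℂ) =
          (a * p + starRingEnd ℂ b * (p : ℂ)⁻¹) * p - (a + starRingEnd ℂ b) * ((p ^ 2 : ℝ) : ℂ) := by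
        have : (p : ℂ) ≠ 0 := by exact_mod_cast hp0.ne'
        push_cast
        field_simp
        ring
      have hp2 : 0 < 1 - p ^ 2 := by nlinarith
      have h4 : ‖b‖ * (1 - p ^ 2) ≤ 2 * ((c 0).re - (Real.log r₂ - Real.log r₁)) * p +
          2 * (-(c 0).re) * p ^ 2 := by
        calc ‖b‖ * (1 - p ^ 2) = ‖starRingEnd ℂ b * ((1 - p ^ 2 : ℝ) : ℂ)‖ := by
              rw [norm_mul, RCLike.norm_conj, Complex.norm_real, Real.norm_of_nonneg hp2.le]
          _ ≤ _ := by
              rw [h3]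
              refine (norm_sub_le _ _).trans ?_
              rw [norm_mul, norm_mul _ (((p ^ 2 : ℝ) : ℂ)), Complex.norm_real, Complex.norm_real,
                Real.norm_of_nonneg hp0.le, Real.norm_of_nonneg (sq_nonneg p)]
              gcongr
      have h5 : ‖b‖ * (1 - r₁) ≤ 2 * L * p := by
        have hb := norm_nonneg b
        have : 1 - r₁ ≤ 1 - p ^ 2 := by nlinarith
        have h6 : ‖b‖ * (1 - r₁) ≤ ‖b‖ * (1 - p ^ 2) := by gcongr
        have h7 : p ^ 2 ≤ p := by nlinarith
        nlinarith
      rw [div_mul_eq_mul_div, le_div_iff₀ (by linarith)]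
      exact h5
  · have h3 : c ((n : ℤ) + 1) = (c ((n : ℤ) + 1) + starRingEnd ℂ (c (-((n : ℤ) + 1)))) -
        starRingEnd ℂ (c (-((n : ℤ) + 1))) := by ring
    calc ‖c ((n : ℤ) + 1)‖ = ‖(c ((n : ℤ) + 1) + starRingEnd ℂ (c (-((n : ℤ) + 1)))) -
        starRingEnd ℂ (c (-((n : ℤ) + 1)))‖ := by rw [← h3]
      _ ≤ _ := (norm_sub_le _ _).trans (by rw [RCLike.norm_conj]; gcongr)

theorem norm_exp_intCast_mul {n : ℤ} {ζ : ℂ} :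
    ‖Complex.exp (n * ζ)‖ = Real.exp ζ.re ^ n := by
  rw [Complex.exp_int_mul, norm_zpow, Complex.norm_exp]

/-- Evaluation of a Laurent series whose coefficients obey the bounds for maps between annuli. The
weights `χ` kill the first `N` positive frequencies. -/
theorem norm_laurent_sub_le {c χ : ℤ → ℂ} {m A r₁ ρ : ℝ} {N : ℕ} {ζ S : ℂ}
    (hm : 0 ≤ m) (hA : 0 ≤ A) (h0 : 0 ≤ r₁) (hr : r₁ < ρ) (hρ : ρ < 1) (hζ : Real.exp ζ.re = ρ)
    (hpos : ∀ n : ℕ, ‖c ((n : ℤ) + 1)‖ ≤ 2 * m + A * r₁ ^ (n + 1))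
    (hneg : ∀ n : ℕ, ‖c (-((n : ℤ) + 1))‖ ≤ A * r₁ ^ (n + 1))
    (hχ : ∀ n, ‖χ n‖ ≤ 1) (hχ0 : χ 0 = 1) (hχN : ∀ n : ℕ, n < N → χ ((n : ℤ) + 1) = 0)
    (hS : HasSum (fun n : ℤ => χ n * (c n * Complex.exp (n * ζ))) S) :
    ‖S - c 0‖ ≤ 2 * m * (ρ ^ (N + 1) / (1 - ρ)) + A * r₁ * (1 / (1 - ρ) + 1 / (ρ - r₁)) := by
  have hρ0 : 0 < ρ := h0.trans_lt hr
  have h1 := (hasSum_nat_add_iff' 1).2 hS.nat_add_neg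
  simp only [Finset.range_one, Finset.sum_singleton, Nat.cast_zero, neg_zero, hχ0, Int.cast_zero,
    zero_mul, Complex.exp_zero, mul_one, one_mul] at h1
  have e1 : S + c 0 - (c 0 + c 0) = S - c 0 := by ring
  rw [e1] at h1
  set q := r₁ / ρ with hq
  have hq0 : 0 ≤ q := by positivity
  have hq1 : q < 1 := (div_lt_one hρ0).2 hr
  set f : ℕ → ℝ := fun n => if n < N then 0 else 2 * m * ρ ^ (n + 1) with hf
  have hfs : HasSum f (2 * m * (ρ ^ (N + 1) / (1 - ρ))) := by
    rw [← hasSum_nat_add_iff' N]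
    have e2 : ∑ i ∈ Finset.range N, f i = 0 := by
      refine Finset.sum_eq_zero fun i hi => ?_
      simp only [hf]; rw [if_pos (Finset.mem_range.1 hi)]
    rw [e2, sub_zero]
    have := (hasSum_geometric_of_lt_one hρ0.le hρ).mul_left (2 * m * ρ ^ (N + 1))
    convert! this using 1
    · funext n
      simp only [hf]; rw [if_neg (by omega)]
      ring
    · rw [div_eq_mul_inv]; ring
  have hg1 := (hasSum_geometric_of_lt_one hρ0.le hρ).mul_left (A * r₁)
  have hg2 := (hasSum_geometric_of_lt_one hq0 hq1).mul_left (A * q)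
  have hg := (hfs.add hg1).add hg2
  have hbound : ∀ n : ℕ, ‖χ ((n + 1 : ℕ) : ℤ) * (c ((n + 1 : ℕ) : ℤ) *
        Complex.exp (((n + 1 : ℕ) : ℤ) * ζ)) + χ (-((n + 1 : ℕ) : ℤ)) * (c (-((n + 1 : ℕ) : ℤ)) *
        Complex.exp ((-((n + 1 : ℕ) : ℤ) : ℤ) * ζ))‖ ≤ f n + A * r₁ * ρ ^ n + A * q * q ^ n := by
    intro n
    refine (norm_add_le _ _).trans (add_le_add ?_ ?_)
    · rw [norm_mul, norm_mul, norm_exp_intCast_mul, hζ, zpow_natCast]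
      push_cast
      by_cases hn : n < N
      · rw [hχN n hn]; simp only [norm_zero, zero_mul]
        have : 0 ≤ f n := by simp only [hf]; rw [if_pos hn]
        positivity
      · have e3 : f n = 2 * m * ρ ^ (n + 1) := by simp only [hf]; rw [if_neg hn]
        rw [e3]
        have e4 : r₁ ^ (n + 1) ≤ r₁ := by
          rw [pow_succ]; exact mul_le_of_le_one_left h0 (pow_le_one₀ h0 (hr.trans hρ).le)
        have e5 : ρ ^ (n + 1) ≤ ρ ^ n := by
          rw [pow_succ]; exact mul_le_of_le_one_right (by positivity) hρ.le
        calc ‖χ ((n : ℤ) + 1)‖ * (‖c ((n : ℤ) + 1)‖ * ρ ^ (n + 1))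
            ≤ 1 * ((2 * m + A * r₁ ^ (n + 1)) * ρ ^ (n + 1)) := by
              gcongr
              · exact hχ _
              · exact hpos n
          _ = 2 * m * ρ ^ (n + 1) + A * r₁ ^ (n + 1) * ρ ^ (n + 1) := by ring
          _ ≤ _ := by gcongr
    · rw [norm_mul, norm_mul, norm_exp_intCast_mul, hζ, zpow_neg, zpow_natCast]
      push_cast
      calc ‖χ (-((n : ℤ) + 1))‖ * (‖c (-((n : ℤ) + 1))‖ * (ρ ^ (n + 1))⁻¹)
          ≤ 1 * (A * r₁ ^ (n + 1) * (ρ ^ (n + 1))⁻¹) := by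
            gcongr
            · exact hχ _
            · exact hneg n
        _ = A * q * q ^ n := by rw [hq, div_pow]; field_simp; ring
  have h2 := h1.norm_le_of_bounded hg hbound
  refine h2.trans (le_of_eq ?_)
  have e6 : q * (1 - q)⁻¹ = r₁ * (1 / (ρ - r₁)) := by
    rw [hq]
    have : ρ - r₁ ≠ 0 := by linarith
    have : 1 - r₁ / ρ ≠ 0 := by linarith
    field_simp
  rw [mul_assoc A q, e6, one_div (1 - ρ)]
  ring

/-! ### The displacement of a map between annuli -/

theorem isOpen_annulus (ρ : ℝ) : IsOpen (annulus ρ) :=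
  (isOpen_lt (g := fun z : ℂ => ‖z‖) continuous_const (by fun_prop)).inter
    (isOpen_lt (f := fun z : ℂ => ‖z‖) (by fun_prop) continuous_const)

/-- A map between annuli that is close to the identity on a circle has a logarithm of `f(z)/z` in
the coordinate `z = exp ζ`, which is periodic and given by the principal branch over the circle. -/
theorem exists_periodic_log {r₁ r₂ ρ₁ : ℝ} (h0 : 0 ≤ r₁) (hρ : r₁ < ρ₁) (hρ1 : ρ₁ < 1)
    (hr2 : 0 ≤ r₂) {f : ℂ → ℂ} (hf : DifferentiableOn ℂ f (annulus r₁))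
    (hmaps : MapsTo f (annulus r₁) (annulus r₂))
    (hclose : ∀ z, ‖z‖ = ρ₁ → ‖f z - z‖ ≤ ρ₁ / 2) :
    ∃ H : ℂ → ℂ, DifferentiableOn ℂ H (logStrip r₁) ∧
      (∀ ζ ∈ logStrip r₁, Complex.exp (H ζ) * Complex.exp ζ = f (Complex.exp ζ)) ∧
      (∀ ζ ∈ logStrip r₁, H (ζ + 2 * Real.pi * Complex.I) = H ζ) ∧
      ∀ θ : ℝ, H (Real.log ρ₁ + θ * Complex.I) =
        Complex.log (f (Complex.exp (Real.log ρ₁ + θ * Complex.I)) /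
          Complex.exp (Real.log ρ₁ + θ * Complex.I)) := by
  have hρ0 : 0 < ρ₁ := h0.trans_lt hρ
  have hexp : Real.exp (Real.log ρ₁) = ρ₁ := Real.exp_log hρ0
  have hx : r₁ < Real.exp (Real.log ρ₁) := by rwa [hexp]
  have hx0 : Real.log ρ₁ < 0 := Real.log_neg hρ0 hρ1
  have hline := fun θ : ℝ => ofReal_add_mem_logStrip hx hx0 θ
  set h : ℂ → ℂ := fun ζ => f (Complex.exp ζ) / Complex.exp ζ with hh
  have hhd : DifferentiableOn ℂ h (logStrip r₁) :=
    (hf.comp Complex.differentiable_exp.differentiableOn fun ζ hζ => exp_mem_annulus_iff.2 hζ).div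
      Complex.differentiable_exp.differentiableOn fun ζ _ => Complex.exp_ne_zero ζ
  have hh0 : ∀ ζ ∈ logStrip r₁, h ζ ≠ 0 := by
    intro ζ hζ
    refine div_ne_zero ?_ (Complex.exp_ne_zero ζ)
    have := (hmaps (exp_mem_annulus_iff.2 hζ)).1
    intro h
    rw [h, norm_zero] at this
    linarith
  obtain ⟨H₀, hH₀d, hH₀⟩ := exists_differentiableOn_exp_eq (isOpen_logStrip r₁) (convex_logStrip r₁)
    ⟨_, hline 0⟩ hhd hh0
  have hhper : ∀ ζ, h (ζ + 2 * Real.pi * Complex.I) = h ζ := by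
    intro ζ; simp only [hh]; rw [Complex.exp_periodic]
  -- over the circle `h` takes values in a disk where the principal logarithm is holomorphic
  have hslit : ∀ θ : ℝ, h (Real.log ρ₁ + θ * Complex.I) ∈ Complex.slitPlane := by
    intro θ
    have hn : ‖Complex.exp (Real.log ρ₁ + θ * Complex.I)‖ = ρ₁ := by
      rw [Complex.norm_exp]; simp [hexp]
    have h1 : ‖h (Real.log ρ₁ + θ * Complex.I) - 1‖ ≤ 1 / 2 := by
      have h2 := hclose _ hn
      simp only [hh]
      rw [div_sub_one (Complex.exp_ne_zero _), norm_div, hn, div_le_iff₀ hρ0]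
      linarith
    refine Complex.mem_slitPlane_of_norm_lt_one (z := h (Real.log ρ₁ + θ * Complex.I) - 1)
      (by linarith) |> fun h3 => ?_
    simpa using h3
  set d : ℝ → ℂ := fun θ => H₀ (Real.log ρ₁ + θ * Complex.I) -
    Complex.log (h (Real.log ρ₁ + θ * Complex.I)) with hd
  have hdd : Differentiable ℝ d := by
    intro θ
    have hi : HasDerivAt (fun θ : ℝ => (Real.log ρ₁ + θ * Complex.I : ℂ)) Complex.I θ := by
      simpa using ((Complex.ofRealCLM.hasDerivAt (x := θ)).mul_const Complex.I).const_add
        (Real.log ρ₁ : ℂ)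
    have hn := (isOpen_logStrip r₁).mem_nhds (hline θ)
    have h1 := (hH₀d.differentiableAt hn).hasDerivAt
    have h2 := ((hhd.differentiableAt hn).hasDerivAt).clog (hslit θ)
    exact ((h1.sub h2).scomp θ hi).differentiableAt
  have hdc : ∀ θ, d θ = d 0 := by
    intro θ
    refine is_const_of_deriv_eq_zero hdd (fun θ => ?_) θ 0
    have h1 : (fun θ => Complex.exp (d θ)) = fun _ => 1 := by
      funext θ
      simp only [hd]
      rw [Complex.exp_sub, hH₀ _ (hline θ), Complex.exp_log (hh0 _ (hline θ)),
        div_self (hh0 _ (hline θ))]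
    have h2 := (hdd θ).hasDerivAt.cexp
    rw [h1] at h2
    have h3 := h2.unique (hasDerivAt_const θ (1 : ℂ))
    exact (mul_eq_zero.1 h3).resolve_left (Complex.exp_ne_zero _)
  have hd0 : Complex.exp (d 0) = 1 := by
    simp only [hd]
    rw [Complex.exp_sub, hH₀ _ (hline 0), Complex.exp_log (hh0 _ (hline 0)),
      div_self (hh0 _ (hline 0))]
  refine ⟨fun ζ => H₀ ζ - d 0, hH₀d.sub_const _, fun ζ hζ => ?_, fun ζ hζ => ?_, fun θ => ?_⟩
  · rw [Complex.exp_sub, hd0, div_one, hH₀ ζ hζ]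
    simp only [hh]
    exact div_mul_cancel₀ _ (Complex.exp_ne_zero _)
  · have hshift : ∀ ζ ∈ logStrip r₁, ζ + 2 * Real.pi * Complex.I ∈ logStrip r₁ := by
      intro ζ hζ
      have : (ζ + 2 * Real.pi * Complex.I).re = ζ.re := by simp
      simpa [logStrip, this] using hζ
    have hDd : DifferentiableOn ℂ (fun ζ => H₀ (ζ + 2 * Real.pi * Complex.I) - H₀ ζ) (logStrip r₁) :=
      (hH₀d.comp (by fun_prop) hshift).sub hH₀d
    have hconst := (isOpen_logStrip r₁).is_const_of_deriv_eq_zero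
      (convex_logStrip r₁).isPreconnected hDd ?_ hζ (hline 0)
    · have h1 := hdc (2 * Real.pi)
      simp only [hd] at h1
      have h2 := hhper (Real.log ρ₁ + (0 : ℝ) * Complex.I)
      have e1 : (Real.log ρ₁ + (0 : ℝ) * Complex.I + 2 * Real.pi * Complex.I : ℂ) =
        Real.log ρ₁ + (2 * Real.pi : ℝ) * Complex.I := by push_cast; ring
      rw [e1] at h2
      rw [h2] at h1
      rw [e1] at hconst
      have h3 := sub_left_inj.1 h1
      rw [h3, sub_self] at hconst
      simp only
      rw [sub_eq_zero.1 hconst]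
    · intro ζ hζ
      have hn := (isOpen_logStrip r₁).mem_nhds hζ
      have h2 := (hDd.differentiableAt hn).hasDerivAt.cexp
      have h1 : (fun ζ => Complex.exp (H₀ (ζ + 2 * Real.pi * Complex.I) - H₀ ζ)) =ᶠ[𝓝 ζ]
          fun _ => 1 := by
        filter_upwards [hn] with ξ hξ
        rw [Complex.exp_sub, hH₀ _ (hshift ξ hξ), hH₀ _ hξ, hhper, div_self (hh0 _ hξ)]
      have h3 := (h2.congr_of_eventuallyEq h1.symm).unique (hasDerivAt_const ζ (1 : ℂ))
      exact (mul_eq_zero.1 h3).resolve_left (Complex.exp_ne_zero _)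
  · have := hdc θ
    rw [← this]
    simp only [hd]
    ring

/-- Averages of `n`-th powers over the `N`-th roots of unity. -/
noncomputable def rootAverage (N : ℕ) (n : ℤ) : ℂ :=
  (1 / N : ℂ) * ∑ j ∈ Finset.range N, Complex.exp (n * ((2 * Real.pi * j / N : ℝ) * Complex.I))

theorem rootAverage_zero {N : ℕ} (hN : N ≠ 0) : rootAverage N 0 = 1 := by
  have : (N : ℂ) ≠ 0 := by exact_mod_cast hN
  simp [rootAverage, this]

theorem norm_rootAverage_le {N : ℕ} (hN : N ≠ 0) (n : ℤ) : ‖rootAverage N n‖ ≤ 1 := by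
  have h1 : (0 : ℝ) < N := by exact_mod_cast Nat.pos_of_ne_zero hN
  rw [rootAverage, norm_mul]
  have h2 : ‖∑ j ∈ Finset.range N, Complex.exp (n * ((2 * Real.pi * j / N : ℝ) * Complex.I))‖ ≤
      ∑ j ∈ Finset.range N, (1 : ℝ) := by
    refine norm_sum_le_of_le _ fun j _ => le_of_eq ?_
    rw [norm_exp_intCast_mul]; simp
  have h3 : ‖(1 / N : ℂ)‖ = 1 / N := by simp
  rw [h3]
  calc _ ≤ 1 / (N : ℝ) * ∑ j ∈ Finset.range N, (1 : ℝ) := by gcongr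
    _ = 1 := by simp; field_simp

theorem rootAverage_eq_zero {N n : ℕ} (hn : n + 1 < N) : rootAverage N ((n : ℤ) + 1) = 0 := by
  have hN : N ≠ 0 := by omega
  have hN' : (N : ℂ) ≠ 0 := by exact_mod_cast hN
  have hζ := Complex.isPrimitiveRoot_exp N hN
  set ζ := Complex.exp (2 * Real.pi * Complex.I / N) with hζdef
  have h1 : ∀ j : ℕ, Complex.exp ((((n : ℤ) + 1 : ℤ) : ℂ) * ((2 * Real.pi * j / N : ℝ) * Complex.I)) =
      (ζ ^ (n + 1)) ^ j := by
    intro j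
    rw [hζdef, ← Complex.exp_nat_mul, ← Complex.exp_nat_mul]
    congr 1
    push_cast
    ring
  rw [rootAverage]
  simp only [h1]
  have h2 : ζ ^ (n + 1) ≠ 1 := hζ.pow_ne_one_of_pos_of_lt (by omega) hn
  rw [geom_sum_eq h2, ← pow_mul, mul_comm (n + 1), pow_mul, hζ.pow_eq_one]
  simp

/-- The `N` equidistributed points on the circle `|z| = ρ`. -/
noncomputable def circlePoint (ρ : ℝ) (N j : ℕ) : ℂ :=
  Complex.exp (Real.log ρ + (2 * Real.pi * j / N : ℝ) * Complex.I)

theorem norm_circlePoint {ρ : ℝ} (hρ : 0 < ρ) (N j : ℕ) : ‖circlePoint ρ N j‖ = ρ := by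
  rw [circlePoint, Complex.norm_exp]; simp [Real.exp_log hρ]

/-- The logarithm of `f(z)/z` for a map `f` between annuli close to the identity on a circle, with
its Laurent expansion: up to the mean `c 0`, whose real part is nonpositive, all coefficients are
controlled by the moduli of the annuli. -/
theorem exists_laurent_log {R₀ r₁ r₂ ρ₁ : ℝ} (h0 : 0 ≤ r₁) (hr1 : r₁ ≤ R₀) (hRρ : R₀ < ρ₁)
    (hρ1 : ρ₁ < 1) (hr2 : 0 ≤ r₂) (h21 : r₂ ≤ r₁) (hr2pos : 0 < r₁ → 0 < r₂) {f : ℂ → ℂ}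
    (hf : DifferentiableOn ℂ f (annulus r₁)) (hmaps : MapsTo f (annulus r₁) (annulus r₂))
    (hclose : ∀ z, ‖z‖ = ρ₁ → ‖f z - z‖ ≤ ρ₁ / 2) :
    ∃ (H : ℂ → ℂ) (c : ℤ → ℂ) (A : ℝ),
      (∀ ζ ∈ logStrip r₁, Complex.exp (H ζ) * Complex.exp ζ = f (Complex.exp ζ)) ∧
      (∀ θ : ℝ, H (Real.log ρ₁ + θ * Complex.I) =
        Complex.log (f (Complex.exp (Real.log ρ₁ + θ * Complex.I)) /
          Complex.exp (Real.log ρ₁ + θ * Complex.I))) ∧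
      (c 0).re ≤ 0 ∧ 0 ≤ A ∧ 0 ≤ Real.log (r₁ / r₂) ∧
      A * r₁ ≤ 2 / (1 - R₀) * (r₁ * Real.log (r₁ / r₂)) ∧
      (∀ n : ℕ, ‖c (-((n : ℤ) + 1))‖ ≤ A * r₁ ^ (n + 1)) ∧
      (∀ n : ℕ, ‖c ((n : ℤ) + 1)‖ ≤ 2 * -(c 0).re + A * r₁ ^ (n + 1)) ∧
      ∀ x : ℝ, r₁ < Real.exp x → x < 0 → ∀ θ : ℝ,
        HasSum (fun n : ℤ => c n * Complex.exp (n * (x + θ * Complex.I)))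
          (H (x + θ * Complex.I)) := by
  have hρ0 : 0 < ρ₁ := by linarith
  have hR01 : 0 < 1 - R₀ := by linarith
  have hr1lt : r₁ < 1 := by linarith
  set a : ℝ := 2 / (1 - R₀) with ha
  obtain ⟨H, hHd, hHexp, hHper, hHlog⟩ := exists_periodic_log h0 (hr1.trans_lt hRρ) hρ1 hr2 hf hmaps
    hclose
  set x₁ := Real.log ρ₁ with hx₁
  have hexp1 : Real.exp x₁ = ρ₁ := Real.exp_log hρ0
  have hx1 : r₁ < Real.exp x₁ := by rw [hexp1]; linarith
  have hx10 : x₁ < 0 := Real.log_neg hρ0 hρ1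
  set c : ℤ → ℂ := fun n => stripCoeff H n x₁ with hc
  have hcx : ∀ n x, r₁ < Real.exp x → x < 0 → stripCoeff H n x = c n := fun n x hx hx0 =>
    stripCoeff_eq hHd hHper n hx hx0 hx1 hx10
  have hnorm : ∀ ζ ∈ logStrip r₁, Real.exp ((H ζ).re + ζ.re) = ‖f (Complex.exp ζ)‖ := by
    intro ζ hζ
    rw [← hHexp ζ hζ, norm_mul, Complex.norm_exp, Complex.norm_exp, Real.exp_add]
  have hout : ∀ ζ ∈ logStrip r₁, (H ζ).re ≤ -ζ.re := by
    intro ζ hζ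
    have h1 := (hmaps (exp_mem_annulus_iff.2 hζ)).2
    rw [← hnorm ζ hζ, Real.exp_lt_one_iff] at h1
    linarith
  have hin : 0 < r₁ → ∀ ζ ∈ logStrip r₁, Real.log r₂ - ζ.re ≤ (H ζ).re := by
    intro hp ζ hζ
    have h1 := (hmaps (exp_mem_annulus_iff.2 hζ)).1
    rw [← hnorm ζ hζ, ← Real.log_lt_iff_lt_exp (hr2pos hp)] at h1
    linarith
  obtain ⟨hm, hcoef⟩ := laurent_coeff_bounds (c := c) h0 hr1lt hr2pos
    (fun x hx hx0 n hn => by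
      have := norm_stripCoeff_add_conj_le hHd hx hx0 (B := -x) (fun θ => by
        have := hout _ (ofReal_add_mem_logStrip hx hx0 θ)
        simpa using this) hn
      rwa [hcx _ x hx hx0, hcx _ x hx hx0, hcx _ x hx hx0] at this)
    (fun hp x hx hx0 n hn => by
      have := norm_stripCoeff_add_conj_le hHd.neg hx hx0 (B := -(Real.log r₂ - x)) (fun θ => by
        have := hin hp _ (ofReal_add_mem_logStrip hx hx0 θ)
        simp at this ⊢
        linarith) hn
      have hneg : ∀ n, stripCoeff (-H) n x = -c n := by
        intro n
        rw [← hcx n x hx hx0]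
        simp [stripCoeff]
      rw [hneg, hneg, hneg] at this
      rw [← norm_neg]
      refine le_trans (le_of_eq ?_) (this.trans (le_of_eq ?_))
      · congr 1
        rw [map_neg]; ring
      · rw [Complex.neg_re]; ring)
  set m := -(c 0).re with hmdef
  have hm0 : 0 ≤ m := by simpa [hmdef] using hm
  set L := Real.log (r₁ / r₂) with hL
  have hL0 : 0 ≤ L := by
    rcases h0.eq_or_lt with h | h
    · rw [hL, ← h]; simp
    · exact Real.log_nonneg ((one_le_div (hr2pos h)).2 h21)
  set A := 2 * L / (1 - r₁) with hA
  have hA0 : 0 ≤ A := div_nonneg (by positivity) (by linarith)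
  have hAr : A * r₁ ≤ a * (r₁ * L) := by
    have h1 : (1 - r₁)⁻¹ ≤ (1 - R₀)⁻¹ := inv_anti₀ hR01 (by linarith)
    calc A * r₁ = 2 * (r₁ * L) * (1 - r₁)⁻¹ := by rw [hA, div_eq_mul_inv]; ring
      _ ≤ 2 * (r₁ * L) * (1 - R₀)⁻¹ := by gcongr
      _ = a * (r₁ * L) := by rw [ha, div_eq_mul_inv]; ring
  have hneg : ∀ n : ℕ, ‖c (-((n : ℤ) + 1))‖ ≤ A * r₁ ^ (n + 1) := fun n => (hcoef n).1
  have hpos : ∀ n : ℕ, ‖c ((n : ℤ) + 1)‖ ≤ 2 * m + A * r₁ ^ (n + 1) := fun n => by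
    have := (hcoef n).2
    linarith [hneg n]
  -- the Laurent expansion of `H`
  have hsum : ∀ x : ℝ, r₁ < Real.exp x → x < 0 → ∀ θ : ℝ,
      HasSum (fun n : ℤ => c n * Complex.exp (n * (x + θ * Complex.I)))
        (H (x + θ * Complex.I)) := by
    intro x hx hx0 θ
    have h1 := hasSum_stripCoeff hHd hHper hx hx0 ?_ θ
    · simpa only [hcx _ x hx hx0] using h1
    · simp only [hcx _ x hx hx0]
      set ρ := Real.exp x with hρ
      have hρlt : ρ < 1 := Real.exp_lt_one_iff.2 hx0
      have hρpos : 0 < ρ := Real.exp_pos x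
      refine Summable.of_nat_of_neg_add_one ?_ ?_
      · rw [← summable_nat_add_iff 1]
        refine Summable.of_nonneg_of_le (fun n => norm_nonneg _) (fun n => ?_)
          ((summable_geometric_of_lt_one hρpos.le hρlt).mul_left ((2 * m + A) * ρ))
        rw [norm_mul, norm_exp_intCast_mul, Complex.ofReal_re, ← hρ, zpow_natCast]
        push_cast
        have h2 : r₁ ^ (n + 1) ≤ 1 := pow_le_one₀ h0 hr1lt.le
        calc _ ≤ (2 * m + A * r₁ ^ (n + 1)) * ρ ^ (n + 1) := by gcongr; exact hpos n
          _ ≤ (2 * m + A * 1) * ρ ^ (n + 1) := by gcongr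
          _ = _ := by ring
      · have hq1 : r₁ / ρ < 1 := (div_lt_one hρpos).2 hx
        refine Summable.of_nonneg_of_le (fun n => norm_nonneg _) (fun n => ?_)
          ((summable_geometric_of_lt_one (by positivity) hq1).mul_left (A * (r₁ / ρ)))
        rw [norm_mul, norm_exp_intCast_mul, Complex.ofReal_re, ← hρ]
        have : (-((n : ℤ) + 1)) = -(((n + 1 : ℕ)) : ℤ) := by push_cast; ring
        rw [this, zpow_neg, zpow_natCast, ← this]
        calc _ ≤ (A * r₁ ^ (n + 1)) * (ρ ^ (n + 1))⁻¹ := by gcongr; exact hneg n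
          _ = _ := by rw [mul_assoc, mul_assoc, ← pow_succ', div_pow]; rfl
  exact ⟨H, c, A, hHexp, hHlog, hm, hA0, hL0, hAr, hneg, hpos, hsum⟩

set_option maxHeartbeats 400000 in
/-- The displacement of a holomorphic map between two annuli is controlled, on compact sets, by its
displacement at finitely many points of a circle and by the change of the inner radius. The
constant does not depend on the annuli as long as the inner radius stays away from the circle. -/
theorem exists_displacement_bound {R₀ ρ₁ : ℝ} (hR0 : 0 ≤ R₀) (hRρ : R₀ < ρ₁) (hρ1 : ρ₁ < 1) :
    ∃ N : ℕ, ∀ R ε : ℝ, R < 1 → 0 < ε → ∃ C : ℝ, 0 ≤ C ∧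
      ∀ (r₁ r₂ κ : ℝ) (f : ℂ → ℂ), 0 ≤ r₁ → r₁ ≤ R₀ → 0 ≤ r₂ → r₂ ≤ r₁ → (0 < r₁ → 0 < r₂) →
        DifferentiableOn ℂ f (annulus r₁) → MapsTo f (annulus r₁) (annulus r₂) →
        (∀ z, ‖z‖ = ρ₁ → ‖f z - z‖ ≤ ρ₁ / 2) →
        (∀ j < N, ‖f (circlePoint ρ₁ N j) - circlePoint ρ₁ N j‖ ≤ κ) →
        ∀ z, r₁ + ε ≤ ‖z‖ → ‖z‖ ≤ R → ‖f z - z‖ ≤ C * (κ + r₁ * Real.log (r₁ / r₂)) := by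
  have hρ0 : 0 < ρ₁ := hR0.trans_lt hRρ
  -- with this many points the averaged positive frequencies contribute less than half the mean
  obtain ⟨M, hM⟩ : ∃ M : ℕ, ρ₁ ^ M < (1 - ρ₁) / 4 :=
    exists_pow_lt_of_lt_one (by linarith) hρ1
  have hMρ : ρ₁ ^ (M + 1) / (1 - ρ₁) ≤ 1 / 4 := by
    rw [div_le_iff₀ (by linarith)]
    have : ρ₁ ^ (M + 1) ≤ ρ₁ ^ M := by
      rw [pow_succ]; exact mul_le_of_le_one_right (by positivity) hρ1.le
    linarith
  refine ⟨M + 1, fun R ε hR hε => ?_⟩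
  set a : ℝ := 2 / (1 - R₀) with ha
  set K₁ : ℝ := 1 / (1 - ρ₁) + 1 / (ρ₁ - R₀) with hK₁
  set B : ℝ := 4 / ρ₁ + 2 * a * K₁ with hB
  have hR01 : 0 < 1 - R₀ := by linarith
  have ha0 : 0 ≤ a := by positivity
  have hd1 : 0 < 1 - ρ₁ := by linarith
  have hd2 : 0 < ρ₁ - R₀ := by linarith
  have hd3 : 0 < 1 - R := by linarith
  have hK₁0 : 0 ≤ K₁ := by positivity
  have hB0 : 0 ≤ B := by positivity
  refine ⟨2 * (B * (1 + 2 / (1 - R)) + a * (1 / (1 - R) + 1 / ε)), by positivity, ?_⟩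
  intro r₁ r₂ κ f h0 hr1 hr2 h21 hr2pos hf hmaps hclose hκ z hz1 hz2
  have hr1lt : r₁ < 1 := by linarith
  obtain ⟨H, c, A, hHexp, hHlog, hm, hA0, hL0, hAr, hneg, hpos, hsum⟩ :=
    exists_laurent_log h0 hr1 hRρ hρ1 hr2 h21 hr2pos hf hmaps hclose
  set x₁ := Real.log ρ₁ with hx₁
  have hexp1 : Real.exp x₁ = ρ₁ := Real.exp_log hρ0
  have hx1 : r₁ < Real.exp x₁ := by rw [hexp1]; linarith
  have hx10 : x₁ < 0 := Real.log_neg hρ0 hρ1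
  set m := -(c 0).re with hmdef
  have hm0 : 0 ≤ m := by simpa [hmdef] using hm
  set L := Real.log (r₁ / r₂) with hL
  -- averaging over the points of the circle isolates the constant coefficient
  set N := M + 1 with hN
  have hN0 : N ≠ 0 := by omega
  have hNc : (N : ℂ) ≠ 0 := by exact_mod_cast hN0
  set S : ℂ := (1 / N : ℂ) * ∑ j ∈ Finset.range N,
    H (x₁ + (2 * Real.pi * j / N : ℝ) * Complex.I) with hS
  have hSsum : HasSum (fun n : ℤ => rootAverage N n * (c n * Complex.exp (n * x₁))) S := by
    have h1 := (hasSum_sum (s := Finset.range N) fun j _ =>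
      hsum x₁ hx1 hx10 (2 * Real.pi * j / N)).mul_left (1 / N : ℂ)
    convert! h1 using 1
    funext n
    rw [rootAverage, mul_assoc, Finset.sum_mul]
    congr 1
    refine Finset.sum_congr rfl fun j _ => ?_
    rw [mul_add, Complex.exp_add]; ring
  have hSb := norm_laurent_sub_le (ζ := (x₁ : ℂ)) (N := M) hm0 hA0 h0 (hr1.trans_lt hRρ) hρ1
    (by simpa using hexp1) hpos hneg (norm_rootAverage_le hN0) (rootAverage_zero hN0)
    (fun n hn => rootAverage_eq_zero (by omega)) hSsum
  have hκ0 : 0 ≤ κ := (norm_nonneg _).trans (hκ 0 (by omega))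
  have hSn : ‖S‖ ≤ 2 * κ / ρ₁ := by
    have h1 : ∀ j ∈ Finset.range N,
        ‖H (x₁ + (2 * Real.pi * j / N : ℝ) * Complex.I)‖ ≤ 2 * κ / ρ₁ := by
      intro j hj
      have h2 := hκ j (Finset.mem_range.1 hj)
      have hn := norm_circlePoint hρ0 N j
      have h4 := hclose _ hn
      have hne : circlePoint ρ₁ N j ≠ 0 := by rw [← norm_pos_iff, hn]; exact hρ0
      have h3 : H (x₁ + (2 * Real.pi * j / N : ℝ) * Complex.I) =
          Complex.log (1 + (f (circlePoint ρ₁ N j) - circlePoint ρ₁ N j) / circlePoint ρ₁ N j) := by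
        rw [hHlog]
        congr 1
        rw [sub_div, div_self hne]
        simp [circlePoint, hx₁]
      have h5 : ‖(f (circlePoint ρ₁ N j) - circlePoint ρ₁ N j) / circlePoint ρ₁ N j‖ ≤ 1 / 2 := by
        rw [norm_div, hn, div_le_iff₀ hρ0]; linarith
      rw [h3]
      refine (Complex.norm_log_one_add_half_le_self h5).trans ?_
      rw [norm_div, hn, mul_div_assoc]
      gcongr
      norm_num
    have hN' : (0 : ℝ) < N := by positivity
    rw [hS, norm_mul]
    have h3 : ‖(1 / N : ℂ)‖ = 1 / N := by simp
    rw [h3]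
    calc _ ≤ 1 / (N : ℝ) * ∑ j ∈ Finset.range N, (2 * κ / ρ₁) := by
          gcongr; exact norm_sum_le_of_le _ h1
      _ = 2 * κ / ρ₁ := by
          rw [Finset.sum_const, Finset.card_range, nsmul_eq_mul]; field_simp
  have hmc : m ≤ ‖c 0‖ := by
    have := Complex.abs_re_le_norm (c 0)
    rw [abs_of_nonpos hm] at this
    exact this
  have hρr : 1 / (ρ₁ - r₁) ≤ 1 / (ρ₁ - R₀) := one_div_le_one_div_of_le hd2 (by linarith)
  have hrL : 0 ≤ r₁ * L := by positivity
  set D := κ + r₁ * L with hD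
  have hD0 : 0 ≤ D := by positivity
  have hc0 : ‖c 0‖ ≤ B * D := by
    have h1 : ‖c 0‖ ≤ ‖S‖ + ‖S - c 0‖ := by
      have := norm_sub_le S (S - c 0)
      simpa using this
    have h2 : 2 * m * (ρ₁ ^ (M + 1) / (1 - ρ₁)) ≤ ‖c 0‖ / 2 := by nlinarith
    have h3 : A * r₁ * (1 / (1 - ρ₁) + 1 / (ρ₁ - r₁)) ≤ a * (r₁ * L) * K₁ := by
      rw [hK₁]
      have : 0 ≤ A * r₁ := by positivity
      have h5 : 0 < ρ₁ - r₁ := by linarith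
      gcongr
    have h4 : B * D = 2 * (2 * κ / ρ₁) + 2 * (a * (r₁ * L) * K₁) + (4 / ρ₁) * (r₁ * L) +
        2 * a * K₁ * κ := by rw [hB, hD]; ring
    have h5 : 0 ≤ (4 / ρ₁) * (r₁ * L) + 2 * a * K₁ * κ := by positivity
    linarith
  -- evaluation at `z`
  have hz0 : 0 < ‖z‖ := by linarith
  have hzne : z ≠ 0 := norm_pos_iff.1 hz0
  set x := Real.log ‖z‖ with hx
  have hexpx : Real.exp x = ‖z‖ := Real.exp_log hz0
  have hrx : r₁ < Real.exp x := by rw [hexpx]; linarith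
  have hxneg : x < 0 := Real.log_neg hz0 (by linarith)
  have hζ : (x + (Complex.arg z : ℝ) * Complex.I : ℂ) = Complex.log z := by
    rw [Complex.log]
  have hHz : ‖H (Complex.log z) - c 0‖ ≤
      2 * m * (‖z‖ ^ (0 + 1) / (1 - ‖z‖)) + A * r₁ * (1 / (1 - ‖z‖) + 1 / (‖z‖ - r₁)) := by
    have h1 := hsum x hrx hxneg (Complex.arg z)
    rw [hζ] at h1
    refine norm_laurent_sub_le (χ := fun _ => 1) (N := 0) (ζ := Complex.log z) hm0 hA0 h0 (by linarith)
      (by linarith) (by rw [Complex.log_re]; exact hexpx) hpos hneg (fun _ => by simp) rfl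
      (fun n hn => absurd hn (by omega)) ?_
    simpa using h1
  have hH : ‖H (Complex.log z)‖ ≤ (B * (1 + 2 / (1 - R)) + a * (1 / (1 - R) + 1 / ε)) * D := by
    have h1 : ‖H (Complex.log z)‖ ≤ ‖c 0‖ + ‖H (Complex.log z) - c 0‖ := by
      have := norm_add_le (c 0) (H (Complex.log z) - c 0)
      simpa using this
    have h2 : ‖z‖ ^ (0 + 1) / (1 - ‖z‖) ≤ 1 / (1 - R) := by
      rw [zero_add, pow_one]
      gcongr
      linarith
    have h3 : 1 / (1 - ‖z‖) ≤ 1 / (1 - R) := one_div_le_one_div_of_le hd3 (by linarith)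
    have h4 : 1 / (‖z‖ - r₁) ≤ 1 / ε := one_div_le_one_div_of_le hε (by linarith)
    have h5 : 2 * m * (‖z‖ ^ (0 + 1) / (1 - ‖z‖)) ≤ 2 * (B * D) * (1 / (1 - R)) := by
      have : 0 ≤ ‖z‖ ^ (0 + 1) / (1 - ‖z‖) := div_nonneg (by positivity) (by linarith)
      gcongr
      exact hmc.trans hc0
    have h6 : A * r₁ * (1 / (1 - ‖z‖) + 1 / (‖z‖ - r₁)) ≤ a * D * (1 / (1 - R) + 1 / ε) := by
      have e1 : 0 ≤ 1 / (1 - ‖z‖) := div_nonneg zero_le_one (by linarith)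
      have e2 : 0 ≤ 1 / (‖z‖ - r₁) := div_nonneg zero_le_one (by linarith)
      have e3 : A * r₁ ≤ a * D := hAr.trans (by gcongr; rw [hD]; linarith)
      gcongr
    calc _ ≤ B * D + (2 * (B * D) * (1 / (1 - R)) + a * D * (1 / (1 - R) + 1 / ε)) := by linarith
      _ = _ := by ring
  have hfz : f z = z * Complex.exp (H (Complex.log z)) := by
    have hmem : Complex.log z ∈ logStrip r₁ := by
      rw [← hζ]; exact ofReal_add_mem_logStrip hrx hxneg _
    have := hHexp _ hmem
    rw [Complex.exp_log hzne] at this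
    rw [← this, mul_comm]
  have hfin : ‖f z - z‖ ≤ 2 * ‖H (Complex.log z)‖ := by
    by_cases h1 : ‖H (Complex.log z)‖ ≤ 1
    · have h2 := Complex.norm_exp_sub_one_le h1
      have h3 : f z - z = z * (Complex.exp (H (Complex.log z)) - 1) := by rw [hfz]; ring
      rw [h3, norm_mul]
      have : ‖z‖ ≤ 1 := by linarith
      have hn := norm_nonneg (Complex.exp (H (Complex.log z)) - 1)
      nlinarith
    · have h2 := (hmaps (x := z) ⟨by linarith, by linarith⟩).2
      have := norm_sub_le (f z) z
      push Not at h1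
      linarith
  calc ‖f z - z‖ ≤ 2 * ‖H (Complex.log z)‖ := hfin
    _ ≤ 2 * ((B * (1 + 2 / (1 - R)) + a * (1 / (1 - R) + 1 / ε)) * D) := by gcongr
    _ = _ := by ring

/-! ### Canonical domain systems -/

theorem omega_nonneg {ρ : ℝ} (h : ρ ∈ Ico (0 : ℝ) 1) : 0 ≤ omega ρ := by
  rw [omega]
  split_ifs with h0
  · exact le_rfl
  · exact div_nonneg_of_nonpos (by linarith [Real.pi_pos]) (Real.log_nonpos h.1 h.2.le)

/-- The inner radius is recovered from `omega` by a smooth function, flat at the puncture. -/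
theorem expNegInvGlue_omega {ρ : ℝ} (h : ρ ∈ Ico (0 : ℝ) 1) :
    expNegInvGlue (omega ρ / Real.pi) = ρ := by
  rw [omega]
  split_ifs with h0
  · simp [h0]
  · have hpos : 0 < ρ := lt_of_le_of_ne h.1 (Ne.symm h0)
    have hlog : Real.log ρ < 0 := Real.log_neg hpos h.2
    have hpi := Real.pi_pos
    have e : -Real.pi / Real.log ρ / Real.pi = (-Real.log ρ)⁻¹ := by
      have := hlog.ne
      field_simp
    have hp : 0 < (-Real.log ρ)⁻¹ := inv_pos.2 (by linarith)
    rw [e, expNegInvGlue, if_neg (not_le.2 hp), inv_inv, neg_neg, Real.exp_log hpos]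

namespace IsCanonicalDomainSystem

variable {d : ℝ≥0∞} {r : ℝ → ℝ}

theorem eq_glue (hr : IsCanonicalDomainSystem d r) {t : ℝ} (ht : 0 ≤ t) :
    r t = expNegInvGlue (omega (r t) / Real.pi) := (expNegInvGlue_omega (hr.mem_Ico t ht)).symm

theorem antitoneOn (hr : IsCanonicalDomainSystem d r) : AntitoneOn r (Ici 0) := by
  intro s hs t ht hst
  rw [hr.eq_glue hs, hr.eq_glue ht]
  have hmono : Monotone expNegInvGlue := by
    refine fun x y hxy => ?_
    rcases le_or_gt x 0 with hx | hx
    · rw [expNegInvGlue.zero_of_nonpos hx]; exact expNegInvGlue.nonneg y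
    · have hy : 0 < y := hx.trans_le hxy
      rw [expNegInvGlue, expNegInvGlue, if_neg (not_le.2 hx), if_neg (not_le.2 hy)]
      exact Real.exp_le_exp.2 (neg_le_neg (inv_anti₀ hx hxy))
  apply hmono
  have := hr.antitone hs ht hst
  have hpi := Real.pi_pos
  simp only at this
  gcongr

theorem continuousOn_omega (hr : IsCanonicalDomainSystem d r) :
    ContinuousOn (fun t => omega (r t)) (Ici 0) := by
  intro t ht
  have ht' : (0 : ℝ) ≤ t := ht
  have h1 := (hr.isACd 0 (t + 1) (by linarith) Icc_subset_Ici_self).1.continuousOn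
  rw [uIcc_of_le (by linarith)] at h1
  refine (h1 t ⟨ht', by linarith⟩).mono_of_mem_nhdsWithin ?_
  rw [← Ici_inter_Iic]
  exact inter_mem self_mem_nhdsWithin (mem_nhdsWithin_of_mem_nhds (Iic_mem_nhds (by linarith)))

theorem continuousOn (hr : IsCanonicalDomainSystem d r) : ContinuousOn r (Ici 0) := by
  have h : ContinuousOn (fun t => expNegInvGlue (omega (r t) / Real.pi)) (Ici 0) :=
    (expNegInvGlue.contDiff (n := 0)).continuous.comp_continuousOn
      (hr.continuousOn_omega.div_const _)
  exact h.congr fun t ht => hr.eq_glue ht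

theorem annulus_subset (hr : IsCanonicalDomainSystem d r) {s t : ℝ} (hs : 0 ≤ s) (hst : s ≤ t) :
    annulus (r s) ⊆ annulus (r t) := fun _ hz =>
  ⟨(hr.antitoneOn hs (hs.trans hst) hst).trans_lt hz.1, hz.2⟩

/-- The inner radius decreases at an `L^d` rate, being a smooth function of `omega`. -/
theorem exists_sub_le_integral (hr : IsCanonicalDomainSystem d r) {T : ℝ} (hT : 0 ≤ T) :
    ∃ l : ℝ → ℝ, (∀ t, 0 ≤ l t) ∧ MemLp l d (volume.restrict (Icc 0 T)) ∧
      (1 ≤ d → ∀ u t, 0 ≤ u → u ≤ t → t ≤ T → r u - r t ≤ ∫ x in u..t, l x) := by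
  set f : ℝ → ℝ := fun t => omega (r t) with hf
  have hpi := Real.pi_pos
  obtain ⟨hac, hmem⟩ := hr.isACd 0 T hT Icc_subset_Ici_self
  obtain ⟨C, hC⟩ : ∃ C : ℝ, 0 ≤ C ∧ ∀ x ∈ Icc 0 (f 0 / Real.pi), ∀ y ∈ Icc 0 (f 0 / Real.pi),
      |expNegInvGlue x - expNegInvGlue y| ≤ C * |x - y| := by
    have hcd : ContDiff ℝ 1 expNegInvGlue := expNegInvGlue.contDiff
    obtain ⟨C, hC⟩ := isCompact_Icc.exists_bound_of_continuousOn
      (s := Icc 0 (f 0 / Real.pi)) (f := deriv expNegInvGlue)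
      (hcd.continuous_deriv le_rfl).continuousOn
    refine ⟨max C 0, le_max_right _ _, fun x hx y hy => ?_⟩
    refine (convex_Icc 0 (f 0 / Real.pi)).norm_image_sub_le_of_norm_deriv_le (f := expNegInvGlue)
      (fun z _ => (hcd.differentiable one_ne_zero).differentiableAt)
      (fun z hz => (hC z hz).trans (le_max_left _ _)) hy hx
  refine ⟨fun t => C / Real.pi * ‖derivWithin f (Ici 0) t‖, fun t => ?_, hmem.norm.const_mul _, ?_⟩
  · have := hC.1; positivity
  intro hd u t hu hut htT
  have hft : f t ≤ f u := hr.antitone hu (hu.trans hut) hut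
  have h1 : r u - r t ≤ C / Real.pi * (f u - f t) := by
    rw [hr.eq_glue hu, hr.eq_glue (hu.trans hut)]
    have hmemI : ∀ v, 0 ≤ v → omega (r v) / Real.pi ∈ Icc 0 (f 0 / Real.pi) := by
      intro v hv
      refine ⟨div_nonneg (omega_nonneg (hr.mem_Ico v hv)) hpi.le, ?_⟩
      have := hr.antitone (mem_Ici.2 le_rfl) hv hv
      simp only at this
      simp only [hf]
      gcongr
    have h2 := hC.2 _ (hmemI u hu) _ (hmemI t (hu.trans hut))
    refine (le_abs_self _).trans (h2.trans (le_of_eq ?_))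
    have : 0 ≤ omega (r u) / Real.pi - omega (r t) / Real.pi := by
      rw [← sub_div]; exact div_nonneg (sub_nonneg.2 hft) hpi.le
    rw [abs_of_nonneg this]
    simp only [hf]
    ring
  have hacut : AbsolutelyContinuousOnInterval f u t := hac.mono (by
    rw [uIcc_of_le hut, uIcc_of_le hT]; exact Icc_subset_Icc hu htT)
  have h2 := hacut.integral_deriv_eq_sub
  have hint : IntervalIntegrable (fun x => ‖derivWithin f (Ici 0) x‖) volume u t := by
    have h3 : IntegrableOn (fun x => ‖derivWithin f (Ici 0) x‖) (Icc 0 T) :=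
      hmem.norm.integrable hd
    rw [intervalIntegrable_iff_integrableOn_Icc_of_le hut]
    exact h3.mono_set (Icc_subset_Icc hu htT)
  have h3 : f u - f t ≤ ∫ x in u..t, ‖derivWithin f (Ici 0) x‖ := by
    have h4 : f u - f t = ∫ x in u..t, -deriv f x := by
      rw [intervalIntegral.integral_neg, h2]; ring
    rw [h4]
    refine intervalIntegral.integral_mono_ae_restrict hut hacut.intervalIntegrable_deriv.neg hint ?_
    rw [EventuallyLE, ae_restrict_iff' measurableSet_Icc]
    have hne : ∀ᵐ x : ℝ, x ≠ u := by simp [ae_iff, measure_singleton]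
    filter_upwards [hne] with x hx hxm
    have hx0 : 0 < x := hu.trans_lt (lt_of_le_of_ne hxm.1 (Ne.symm hx))
    rw [derivWithin_of_mem_nhds (Ici_mem_nhds hx0)]
    exact (neg_le_abs _)
  rw [intervalIntegral.integral_const_mul]
  refine h1.trans ?_
  have := hC.1
  gcongr

end IsCanonicalDomainSystem

/-! ### Locally bounded families of holomorphic functions -/

/-- Cauchy's estimate: a holomorphic function bounded by `M` on a disk of radius `2δ` is Lipschitz
on the disk of radius `δ`. -/
theorem norm_sub_le_of_norm_le_closedBall {g : ℂ → ℂ} {c : ℂ} {δ M : ℝ} (hδ : 0 < δ) {U : Set ℂ}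
    (hU : IsOpen U) (hg : DifferentiableOn ℂ g U) (hsub : Metric.closedBall c (2 * δ) ⊆ U)
    (hM : ∀ z ∈ Metric.closedBall c (2 * δ), ‖g z‖ ≤ M) {x y : ℂ} (hx : x ∈ Metric.closedBall c δ)
    (hy : y ∈ Metric.closedBall c δ) : ‖g x - g y‖ ≤ M / δ * ‖x - y‖ := by
  have hb : ∀ p ∈ Metric.closedBall c δ, Metric.closedBall p δ ⊆ Metric.closedBall c (2 * δ) := by
    intro p hp
    refine Metric.closedBall_subset_closedBall' ?_
    have := Metric.mem_closedBall.1 hp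
    linarith
  refine (convex_closedBall c δ).norm_image_sub_le_of_norm_deriv_le (fun p hp => ?_)
    (fun p hp => ?_) hy hx
  · exact hg.differentiableAt (hU.mem_nhds (hsub (hb p hp (Metric.mem_closedBall_self hδ.le))))
  · refine Complex.norm_deriv_le_of_forall_mem_sphere_norm_le hδ ?_ fun z hz =>
      hM z (hb p hp (Metric.sphere_subset_closedBall hz))
    refine DifferentiableOn.diffContOnCl ?_
    rw [closure_ball p hδ.ne']
    exact hg.mono ((hb p hp).trans hsub)

/-- A Vitali type theorem: a locally bounded family of holomorphic functions that converges on a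
dense subset converges locally uniformly. -/
theorem exists_tendstoLocallyUniformlyOn_of_dense {ι : Type*} {F : Filter ι} [F.NeBot]
    {q : ι → ℂ → ℂ} {U : Set ℂ} (hU : IsOpen U) (hq : ∀ᶠ i in F, DifferentiableOn ℂ (q i) U)
    (hb : ∀ K ⊆ U, IsCompact K → ∃ M : ℝ, ∀ᶠ i in F, ∀ z ∈ K, ‖q i z‖ ≤ M)
    {S : Set ℂ} (hS : U ⊆ closure S) (hconv : ∀ z ∈ S, z ∈ U → ∃ l, Tendsto (fun i => q i z) F (𝓝 l)) :
    ∃ g : ℂ → ℂ, DifferentiableOn ℂ g U ∧ TendstoLocallyUniformlyOn q g F U := by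
  have hlip : ∀ x ∈ U, ∃ δ > 0, ∃ C : ℝ, 0 ≤ C ∧ Metric.closedBall x δ ⊆ U ∧
      ∀ᶠ i in F, ∀ y ∈ Metric.closedBall x δ, ∀ z ∈ Metric.closedBall x δ,
        ‖q i y - q i z‖ ≤ C * ‖y - z‖ := by
    intro x hx
    obtain ⟨δ, hδ, hsub⟩ := Metric.nhds_basis_closedBall.mem_iff.1 (hU.mem_nhds hx)
    have hδ2 : 2 * (δ / 2) = δ := by ring
    obtain ⟨M, hM⟩ := hb _ hsub (isCompact_closedBall x δ)
    refine ⟨δ / 2, by positivity, max (M / (δ / 2)) 0, le_max_right _ _,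
      (Metric.closedBall_subset_closedBall (by linarith)).trans hsub, ?_⟩
    filter_upwards [hM, hq] with i hi hqi y hy z hz
    refine (norm_sub_le_of_norm_le_closedBall (by positivity) hU hqi (by rwa [hδ2])
      (by rw [hδ2]; exact hi) hy hz).trans ?_
    gcongr
    exact le_max_left _ _
  have hlim : ∀ x ∈ U, ∃ l, Tendsto (fun i => q i x) F (𝓝 l) := by
    intro x hx
    obtain ⟨δ, hδ, C, hC, hsub, hev⟩ := hlip x hx
    rw [← cauchy_map_iff_exists_tendsto, Metric.cauchy_iff]
    refine ⟨inferInstance, fun ε hε => ?_⟩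
    obtain ⟨s, hsS, hs⟩ := Metric.mem_closure_iff.1 (hS hx) (min δ (ε / (4 * (C + 1))))
      (by positivity)
    have hsd : s ∈ Metric.closedBall x δ := by
      rw [Metric.mem_closedBall, dist_comm]; exact (hs.trans_le (min_le_left _ _)).le
    obtain ⟨l, hl⟩ := hconv s hsS (hsub hsd)
    have h1 : ∀ᶠ i in F, ‖q i s - l‖ < ε / 4 := by
      have := (Metric.tendsto_nhds.1 hl) (ε / 4) (by positivity)
      simpa [dist_eq_norm] using this
    have hsx : C * ‖x - s‖ ≤ ε / 4 := by
      have h2 : ‖x - s‖ ≤ ε / (4 * (C + 1)) := by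
        rw [← dist_eq_norm]; exact (hs.trans_le (min_le_right _ _)).le
      calc C * ‖x - s‖ ≤ (C + 1) * (ε / (4 * (C + 1))) := by gcongr; linarith
        _ = ε / 4 := by field_simp
    refine ⟨Metric.ball l (ε / 2), ?_, fun y hy z hz => ?_⟩
    · rw [mem_map]
      filter_upwards [h1, hev] with i hi hi2
      have h3 := hi2 x (Metric.mem_closedBall_self hδ.le) s hsd
      rw [mem_preimage, Metric.mem_ball, dist_eq_norm]
      have := norm_sub_le_norm_sub_add_norm_sub (q i x) (q i s) l
      linarith
    · have := dist_triangle_right y z l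
      rw [Metric.mem_ball] at hy hz
      linarith
  choose! g hg using hlim
  have hloc : TendstoLocallyUniformlyOn q g F U := by
    rw [Metric.tendstoLocallyUniformlyOn_iff]
    intro ε hε x hx
    obtain ⟨δ, hδ, C, hC, hsub, hev⟩ := hlip x hx
    have hgl : ∀ y ∈ Metric.closedBall x δ, ‖g y - g x‖ ≤ C * ‖y - x‖ := by
      intro y hy
      refine le_of_tendsto ((hg y (hsub hy)).sub (hg x hx)).norm ?_
      filter_upwards [hev] with i hi
      exact hi y hy x (Metric.mem_closedBall_self hδ.le)
    set η := min δ (ε / (4 * (C + 1))) with hη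
    have hη0 : 0 < η := by positivity
    refine ⟨Metric.ball x η, mem_nhdsWithin_of_mem_nhds (Metric.ball_mem_nhds x hη0), ?_⟩
    have h1 : ∀ᶠ i in F, ‖q i x - g x‖ < ε / 4 := by
      have := (Metric.tendsto_nhds.1 (hg x hx)) (ε / 4) (by positivity)
      simpa [dist_eq_norm] using this
    filter_upwards [h1, hev] with i hi hi2 y hy
    have hyd : y ∈ Metric.closedBall x δ := by
      rw [Metric.mem_closedBall]
      exact ((Metric.mem_ball.1 hy).trans_le (min_le_left _ _)).le
    have hyx : C * ‖y - x‖ ≤ ε / 4 := by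
      have h2 : ‖y - x‖ ≤ ε / (4 * (C + 1)) := by
        rw [← dist_eq_norm]; exact ((Metric.mem_ball.1 hy).trans_le (min_le_right _ _)).le
      calc C * ‖y - x‖ ≤ (C + 1) * (ε / (4 * (C + 1))) := by gcongr; linarith
        _ = ε / 4 := by field_simp
    have h3 := hi2 x (Metric.mem_closedBall_self hδ.le) y hyd
    rw [norm_sub_rev x y] at h3
    have h4 := hgl y hyd
    rw [dist_eq_norm]
    have h5 : g y - q i y = (g y - g x) - (q i x - g x) + (q i x - q i y) := by ring
    rw [h5]
    have h6 := norm_add_le ((g y - g x) - (q i x - g x)) (q i x - q i y)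
    have h7 := norm_sub_le (g y - g x) (q i x - g x)
    linarith
  exact ⟨g, hloc.differentiableOn hq hU, hloc⟩

/-! ### Carathéodory solutions: uniqueness and dependence on initial data -/

section

variable {d : ℝ≥0∞} {r : ℝ → ℝ} {G : ℂ → ℝ → ℂ}

/-- A compact piece of a graph in `𝒟` has a tubular neighbourhood in `𝒟`. -/
theorem exists_tube_subset (hr : IsCanonicalDomainSystem d r) {w : ℝ → ℂ} {a b : ℝ} (ha : 0 ≤ a)
    (hab : a ≤ b) (hw : ContinuousOn w (Icc a b)) (hgr : ∀ t ∈ Icc a b, w t ∈ annulus (r t)) :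
    ∃ ε > 0, ∀ t ∈ Icc a b, Metric.closedBall (w t) ε ⊆ annulus (r t) := by
  have hrc : ContinuousOn r (Icc a b) := hr.continuousOn.mono fun t ht => ha.trans ht.1
  obtain ⟨t₁, ht₁, h₁⟩ := isCompact_Icc.exists_isMinOn (nonempty_Icc.2 hab)
    (f := fun t => min (1 - ‖w t‖) (‖w t‖ - r t))
    (ContinuousOn.inf (continuousOn_const.sub hw.norm) (hw.norm.sub hrc))
  have hpos : 0 < min (1 - ‖w t₁‖) (‖w t₁‖ - r t₁) := by
    have := hgr t₁ ht₁
    exact lt_min (by linarith [this.2]) (by linarith [this.1])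
  refine ⟨min (1 - ‖w t₁‖) (‖w t₁‖ - r t₁) / 2, by positivity, fun t ht z hz => ?_⟩
  have h2 : min (1 - ‖w t₁‖) (‖w t₁‖ - r t₁) ≤ min (1 - ‖w t‖) (‖w t‖ - r t) := h₁ ht
  have h3 := h2.trans (min_le_left _ _)
  have h4 := h2.trans (min_le_right _ _)
  rw [Metric.mem_closedBall, dist_eq_norm] at hz
  have h5 := norm_sub_norm_le z (w t)
  have h6 := norm_sub_norm_le (w t) z
  rw [norm_sub_rev] at h6
  exact ⟨by linarith, by linarith⟩

/-- The closed tube of radius `ε` around the graph of `w` over `[a,b]`, parametrized by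
`[a,b] × closedBall 0 ε`, which makes its compactness evident. -/
def tube (w : ℝ → ℂ) (a b ε : ℝ) : Set (ℂ × ℝ) :=
  (fun p : ℝ × ℂ => (w p.1 + p.2, p.1)) '' (Icc a b ×ˢ Metric.closedBall 0 ε)

theorem isCompact_tube {w : ℝ → ℂ} {a b : ℝ} (hw : ContinuousOn w (Icc a b)) (ε : ℝ) :
    IsCompact (tube w a b ε) := by
  refine (isCompact_Icc.prod (isCompact_closedBall 0 ε)).image_of_continuousOn ?_
  refine ContinuousOn.prodMk (ContinuousOn.add ?_ continuousOn_snd) continuousOn_fst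
  exact hw.comp continuousOn_fst fun p hp => hp.1

theorem mem_tube {w : ℝ → ℂ} {a b ε : ℝ} {z : ℂ} {t : ℝ} (ht : t ∈ Icc a b)
    (hz : z ∈ Metric.closedBall (w t) ε) : (z, t) ∈ tube w a b ε := by
  refine ⟨(t, z - w t), ⟨ht, ?_⟩, by simp⟩
  simpa [dist_eq_norm] using hz

theorem tube_subset {w : ℝ → ℂ} {a b ε : ℝ} (ha : 0 ≤ a)
    (h : ∀ t ∈ Icc a b, Metric.closedBall (w t) ε ⊆ annulus (r t)) :
    tube w a b ε ⊆ spaceTime r := by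
  rintro _ ⟨⟨t, v⟩, ⟨ht, hv⟩, rfl⟩
  refine ⟨ha.trans ht.1, h t ht ?_⟩
  simpa [dist_eq_norm] using hv

theorem snd_image_tube {w : ℝ → ℂ} {a b ε : ℝ} (hε : 0 ≤ ε) :
    Prod.snd '' tube w a b ε = Icc a b := by
  ext t
  constructor
  · rintro ⟨_, ⟨⟨t, v⟩, ⟨ht, hv⟩, rfl⟩, rfl⟩
    exact ht
  · intro ht
    exact ⟨(w t, t), mem_tube ht (Metric.mem_closedBall_self hε), rfl⟩

theorem IsWeakHolVectorField.differentiableOn_annulus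
    (hG : IsWeakHolVectorField d (spaceTime r) G) {t : ℝ} (ht : 0 ≤ t) :
    DifferentiableOn ℂ (fun z => G z t) (annulus (r t)) :=
  (hG.holo t).mono fun _ hz => ⟨ht, hz⟩

/-- First and second order Cauchy estimates, phrased for the divided differences of `g`. -/
theorem dslope_estimates {g : ℂ → ℂ} {c : ℂ} {δ M : ℝ} (hδ : 0 < δ) {U : Set ℂ}
    (hU : IsOpen U) (hg : DifferentiableOn ℂ g U) (hsub : Metric.closedBall c (4 * δ) ⊆ U)
    (hM : ∀ z ∈ Metric.closedBall c (4 * δ), ‖g z‖ ≤ M) {p : ℂ} (hp : p ∈ Metric.closedBall c δ) :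
    (∀ x ∈ Metric.closedBall c δ, ‖dslope g p x‖ ≤ M / (2 * δ)) ∧
    ∀ x ∈ Metric.closedBall c δ, ∀ y ∈ Metric.closedBall c δ,
      ‖dslope g p x - dslope g p y‖ ≤ M / (2 * δ) / δ * ‖x - y‖ := by
  have hM0 : 0 ≤ M := (norm_nonneg _).trans (hM c (Metric.mem_closedBall_self (by positivity)))
  have h22 : 2 * (2 * δ) = 4 * δ := by ring
  have hsub1 : Metric.closedBall c δ ⊆ Metric.closedBall c (2 * δ) :=
    Metric.closedBall_subset_closedBall (by linarith)
  have hsub2 : Metric.closedBall c (2 * δ) ⊆ U :=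
    (Metric.closedBall_subset_closedBall (by linarith)).trans hsub
  have hlip : ∀ x ∈ Metric.closedBall c (2 * δ), ‖g x - g p‖ ≤ M / (2 * δ) * ‖x - p‖ := fun x hx =>
    norm_sub_le_of_norm_le_closedBall (by positivity) hU hg (by rwa [h22]) (by rwa [h22]) hx (hsub1 hp)
  have hb : ∀ x ∈ Metric.closedBall c (2 * δ), ‖dslope g p x‖ ≤ M / (2 * δ) := by
    intro x hx
    by_cases hxp : x = p
    · rw [hxp, dslope_same]
      refine norm_deriv_le_of_lip' (by positivity) ?_
      have hnear : Metric.closedBall c (2 * δ) ∈ 𝓝 p :=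
        mem_of_superset (Metric.ball_mem_nhds p hδ) (Metric.ball_subset_closedBall.trans
          (Metric.closedBall_subset_closedBall' (by have := Metric.mem_closedBall.1 hp; linarith)))
      filter_upwards [hnear] with y hy using hlip y hy
    · rw [dslope_of_ne _ hxp, slope_def_module, norm_smul, norm_inv, inv_mul_le_iff₀
        (norm_pos_iff.2 (sub_ne_zero.2 hxp))]
      rw [mul_comm]
      exact hlip x hx
  refine ⟨fun x hx => hb x (hsub1 hx), fun x hx y hy => ?_⟩
  have hd : DifferentiableOn ℂ (dslope g p) U :=
    (Complex.differentiableOn_dslope (hU.mem_nhds (hsub2 (hsub1 hp)))).2 hg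
  exact norm_sub_le_of_norm_le_closedBall hδ hU hd hsub2 hb hx hy

/-- Around a curve in `𝒟` a weak holomorphic vector field and its divided differences are bounded
and Lipschitz with a common integrable coefficient. -/
theorem IsWeakHolVectorField.exists_lipschitz_tube (hd : 1 ≤ d) (hr : IsCanonicalDomainSystem d r)
    (hG : IsWeakHolVectorField d (spaceTime r) G) {w : ℝ → ℂ} {a b : ℝ} (ha : 0 ≤ a)
    (hab : a ≤ b) (hw : ContinuousOn w (Icc a b)) (hgr : ∀ t ∈ Icc a b, w t ∈ annulus (r t)) :
    ∃ ε > 0, ∃ lam : ℝ → ℝ, (∀ t ∈ Icc a b, 0 ≤ lam t) ∧ IntervalIntegrable lam volume a b ∧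
      (∀ t ∈ Icc a b, Metric.closedBall (w t) ε ⊆ annulus (r t)) ∧
      (∀ t ∈ Icc a b, ∀ p ∈ Metric.closedBall (w t) ε, ‖G p t‖ ≤ lam t) ∧
      ∀ t ∈ Icc a b, ∀ p ∈ Metric.closedBall (w t) ε,
        (∀ x ∈ Metric.closedBall (w t) ε, ‖dslope (fun z => G z t) p x‖ ≤ lam t) ∧
        ∀ x ∈ Metric.closedBall (w t) ε, ∀ y ∈ Metric.closedBall (w t) ε,
          ‖dslope (fun z => G z t) p x - dslope (fun z => G z t) p y‖ ≤ lam t * ‖x - y‖ := by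
  obtain ⟨ε, hε, hsub⟩ := exists_tube_subset hr ha hab hw hgr
  obtain ⟨k, hk0, hkm, hk⟩ := hG.bound _ (isCompact_tube hw ε) (tube_subset ha hsub)
  rw [snd_image_tube hε.le] at hk0 hkm
  have hkint : IntervalIntegrable k volume a b := by
    rw [intervalIntegrable_iff_integrableOn_Icc_of_le hab]
    exact hkm.integrable hd
  set δ := ε / 4 with hδ
  have hδ0 : 0 < δ := by positivity
  have h4 : 4 * δ = ε := by rw [hδ]; ring
  have hδε : ∀ z : ℂ, Metric.closedBall z δ ⊆ Metric.closedBall z ε := fun z =>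
    Metric.closedBall_subset_closedBall (by linarith)
  refine ⟨δ, hδ0, fun t => (1 + 1 / (2 * δ) + 1 / (2 * δ) / δ) * k t, fun t ht => ?_,
    hkint.const_mul _, fun t ht => (hδε _).trans (hsub t ht), fun t ht p hp => ?_,
    fun t ht p hp => ?_⟩
  · have := hk0 t ht; positivity
  · have h1 := hk _ (mem_tube ht (hδε _ hp))
    have h0 := hk0 t ht
    simp only at h1
    have : 0 ≤ (1 / (2 * δ) + 1 / (2 * δ) / δ) * k t := by positivity
    linarith
  · have h0 := hk0 t ht
    have hest := dslope_estimates hδ0 (isOpen_annulus (r t))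
      (hG.differentiableOn_annulus (ha.trans ht.1)) (by rw [h4]; exact hsub t ht) (M := k t)
      (by rw [h4]; exact fun z hz => hk _ (mem_tube ht hz)) hp
    have e1 : 0 ≤ 1 / (2 * δ) * k t := by positivity
    have e2 : 0 ≤ 1 / (2 * δ) / δ * k t := by positivity
    have e3 : k t / (2 * δ) = 1 / (2 * δ) * k t := by ring
    have e4 : k t / (2 * δ) / δ = 1 / (2 * δ) / δ * k t := by ring
    rw [e3] at hest
    refine ⟨fun x hx => (hest.1 x hx).trans (by linarith), fun x hx y hy => (hest.2 x hx y hy).trans ?_⟩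
    rw [← e3, e4]
    gcongr
    linarith

/-- `w` solves the differential equation on the compact interval `[a,b]`, with graph in `𝒟`. -/
structure SolvesOn (r : ℝ → ℝ) (G : ℂ → ℝ → ℂ) (a b : ℝ) (w : ℝ → ℂ) : Prop where
  absCont : AbsolutelyContinuousOnInterval w a b
  graph : ∀ t ∈ Icc a b, w t ∈ annulus (r t)
  ode : ∀ᵐ t, t ∈ Ioo a b → HasDerivAt w (G (w t) t) t

namespace SolvesOn

variable {a b a' b' : ℝ} {w w₁ w₂ : ℝ → ℂ}

theorem mono (h : SolvesOn r G a b w) (ha : a ≤ a') (hab : a' ≤ b') (hb : b' ≤ b) :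
    SolvesOn r G a' b' w where
  absCont := h.absCont.mono (by
    rw [uIcc_of_le hab, uIcc_of_le (ha.trans (hab.trans hb))]; exact Icc_subset_Icc ha hb)
  graph t ht := h.graph t ⟨ha.trans ht.1, ht.2.trans hb⟩
  ode := by
    filter_upwards [h.ode] with t ht htm
    exact ht ⟨ha.trans_lt htm.1, htm.2.trans_le hb⟩

theorem continuousOn (h : SolvesOn r G a b w) (hab : a ≤ b) : ContinuousOn w (Icc a b) := by
  have := h.absCont.continuousOn
  rwa [uIcc_of_le hab] at this

theorem norm_sub_le (h : SolvesOn r G a b w) (hab : a ≤ b) {k : ℝ → ℝ}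
    (hk : IntervalIntegrable k volume a b) (hb : ∀ t ∈ Icc a b, ‖G (w t) t‖ ≤ k t) :
    ‖w b - w a‖ ≤ ∫ t in a..b, k t := by
  refine norm_sub_le_integral_of_ae_hasDerivAt hab h.absCont hk ?_
  filter_upwards [h.ode] with t ht htm
  exact ⟨_, ht htm, hb t (Ioo_subset_Icc_self htm)⟩

theorem norm_sub_sub_le (h₁ : SolvesOn r G a b w₁) (h₂ : SolvesOn r G a b w₂) (hab : a ≤ b)
    {k : ℝ → ℝ} (hk : IntervalIntegrable k volume a b)
    (hb : ∀ t ∈ Icc a b, ‖G (w₁ t) t - G (w₂ t) t‖ ≤ k t) :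
    ‖(w₁ b - w₂ b) - (w₁ a - w₂ a)‖ ≤ ∫ t in a..b, k t := by
  refine norm_sub_le_integral_of_ae_hasDerivAt (w := fun t => w₁ t - w₂ t) hab
    (h₁.absCont.sub h₂.absCont) hk ?_
  filter_upwards [h₁.ode, h₂.ode] with t ht₁ ht₂ htm
  exact ⟨_, (ht₁ htm).sub (ht₂ htm), hb t (Ioo_subset_Icc_self htm)⟩

end SolvesOn

theorem norm_sub_le_of_dslope {g : ℂ → ℂ} {p x : ℂ} {M : ℝ} (h : ‖dslope g p x‖ ≤ M) :
    ‖g x - g p‖ ≤ M * ‖x - p‖ := by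
  rw [← sub_smul_dslope, norm_smul, mul_comm]
  gcongr

/-- A solution starting close to a reference solution stays close to it. -/
theorem SolvesOn.norm_sub_le_exp {a b ε : ℝ} {w₀ w : ℝ → ℂ} {lam : ℝ → ℝ} (hab : a ≤ b)
    (hlam0 : ∀ t ∈ Icc a b, 0 ≤ lam t) (hlam : IntervalIntegrable lam volume a b)
    (hL : ∀ t ∈ Icc a b, ∀ p ∈ Metric.closedBall (w₀ t) ε,
      ∀ x ∈ Metric.closedBall (w₀ t) ε, ‖dslope (fun z => G z t) p x‖ ≤ lam t)
    (h₀ : SolvesOn r G a b w₀) (h : SolvesOn r G a b w)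
    (hstart : ‖w a - w₀ a‖ * Real.exp (2 * ∫ ξ in a..b, lam ξ) < ε) :
    ∀ t ∈ Icc a b, ‖w t - w₀ t‖ ≤ ‖w a - w₀ a‖ * Real.exp (2 * ∫ ξ in a..t, lam ξ) := by
  have hε : 0 ≤ ε := le_trans (by positivity) hstart.le
  refine gronwall_tube (x := fun t => ‖w t - w₀ t‖) hab
    ((h.continuousOn hab).sub (h₀.continuousOn hab)).norm (fun _ _ => norm_nonneg _) hlam hlam0 ?_
    hstart
  intro t ht t' ht' htt M hM hx
  have hm : ∀ τ ∈ Icc t t', τ ∈ Icc a b := fun τ hτ => ⟨ht.1.trans hτ.1, hτ.2.trans ht'.2⟩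
  have hM0 : 0 ≤ M := (norm_nonneg _).trans (hx t (left_mem_Icc.2 htt))
  have h1 := (h.mono ht.1 htt ht'.2).norm_sub_sub_le (h₀.mono ht.1 htt ht'.2) htt
    (k := fun τ => M * lam τ) ((intervalIntegrable_of_mem_Icc hab hlam ht ht').const_mul M)
    (fun τ hτ => by
      have h2 : ‖w τ - w₀ τ‖ ≤ M := hx τ hτ
      have h3 := hL τ (hm τ hτ) (w₀ τ) (Metric.mem_closedBall_self hε) (w τ)
        (by rw [Metric.mem_closedBall, dist_eq_norm]; linarith)
      have h4 := norm_sub_le_of_dslope h3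
      have h5 := hlam0 τ (hm τ hτ)
      nlinarith)
  rw [intervalIntegral.integral_const_mul] at h1
  have h2 := norm_sub_norm_le (w t' - w₀ t') (w t - w₀ t)
  linarith

theorem SolvesOn.eqOn_forward (hd : 1 ≤ d) (hr : IsCanonicalDomainSystem d r)
    (hG : IsWeakHolVectorField d (spaceTime r) G) {a b : ℝ} {w₁ w₂ : ℝ → ℂ} (ha : 0 ≤ a)
    (hab : a ≤ b) (h₁ : SolvesOn r G a b w₁) (h₂ : SolvesOn r G a b w₂) (heq : w₁ a = w₂ a) :
    EqOn w₁ w₂ (Icc a b) := by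
  obtain ⟨ε, hε, lam, hlam0, hlam, -, -, hL⟩ :=
    hG.exists_lipschitz_tube hd hr ha hab (h₂.continuousOn hab) h₂.graph
  intro t ht
  have h := SolvesOn.norm_sub_le_exp hab hlam0 hlam (fun t ht p hp => (hL t ht p hp).1) h₂ h₁
    (by rw [heq]; simpa using hε) t ht
  rw [heq, sub_self, norm_zero, zero_mul] at h
  exact sub_eq_zero.1 (norm_le_zero_iff.1 h)

theorem SolvesOn.eqOn_backward (hd : 1 ≤ d) (hr : IsCanonicalDomainSystem d r)
    (hG : IsWeakHolVectorField d (spaceTime r) G) {a b : ℝ} {w₁ w₂ : ℝ → ℂ} (ha : 0 ≤ a)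
    (hab : a ≤ b) (h₁ : SolvesOn r G a b w₁) (h₂ : SolvesOn r G a b w₂) (heq : w₁ b = w₂ b) :
    EqOn w₁ w₂ (Icc a b) := by
  obtain ⟨ε, hε, lam, hlam0, hlam, -, -, hL⟩ :=
    hG.exists_lipschitz_tube hd hr ha hab (h₂.continuousOn hab) h₂.graph
  -- the inequality for the distance is reversed in time
  have hrev : ∀ t ∈ Icc a b, a + b - t ∈ Icc a b := fun t ht => ⟨by linarith [ht.2], by linarith [ht.1]⟩
  have hlam' : IntervalIntegrable (fun t => lam (a + b - t)) volume a b := by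
    have := (hlam.comp_sub_left (a + b)).symm
    simpa using this
  have hx : ContinuousOn (fun t => ‖w₁ (a + b - t) - w₂ (a + b - t)‖) (Icc a b) :=
    (((h₁.continuousOn hab).sub (h₂.continuousOn hab)).norm).comp (by fun_prop) hrev
  have key := gronwall_tube (x := fun t => ‖w₁ (a + b - t) - w₂ (a + b - t)‖)
    (lam := fun t => lam (a + b - t)) (ε := ε) hab hx (fun _ _ => norm_nonneg _) hlam'
    (fun t ht => hlam0 _ (hrev t ht)) ?_ (by
      simp only [add_sub_cancel_left, heq, sub_self, norm_zero, zero_mul]; exact hε)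
  · intro t ht
    have h := key _ (hrev t ht)
    have e : a + b - (a + b - t) = t := by ring
    simp only [e, add_sub_cancel_left, heq, sub_self, norm_zero, zero_mul] at h
    exact sub_eq_zero.1 (norm_le_zero_iff.1 h)
  · intro t ht t' ht' htt M hM hxM
    have hle : a + b - t' ≤ a + b - t := by linarith
    have hm : ∀ τ ∈ Icc (a + b - t') (a + b - t), τ ∈ Icc a b := fun τ hτ =>
      ⟨(hrev t' ht').1.trans hτ.1, hτ.2.trans (hrev t ht).2⟩
    have hxM' : ∀ τ ∈ Icc (a + b - t') (a + b - t), ‖w₁ τ - w₂ τ‖ ≤ M := by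
      intro τ hτ
      have := hxM (a + b - τ) ⟨by linarith [hτ.2], by linarith [hτ.1]⟩
      simpa using this
    have hM0 : 0 ≤ M := (norm_nonneg _).trans (hxM' _ (left_mem_Icc.2 hle))
    have h1 := (h₁.mono (hrev t' ht').1 hle (hrev t ht).2).norm_sub_sub_le
      (h₂.mono (hrev t' ht').1 hle (hrev t ht).2) hle (k := fun τ => M * lam τ)
      ((intervalIntegrable_of_mem_Icc hab hlam (hrev t' ht') (hrev t ht)).const_mul M)
      (fun τ hτ => by
        have h2 := hxM' τ hτ
        have h3 := (hL τ (hm τ hτ) (w₂ τ) (Metric.mem_closedBall_self hε.le)).1 (w₁ τ)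
          (by rw [Metric.mem_closedBall, dist_eq_norm]; linarith)
        have h4 := norm_sub_le_of_dslope h3
        have h5 := hlam0 τ (hm τ hτ)
        nlinarith)
    rw [intervalIntegral.integral_const_mul] at h1
    rw [intervalIntegral.integral_comp_sub_left]
    have h2 := norm_sub_norm_le (w₁ (a + b - t') - w₂ (a + b - t')) (w₁ (a + b - t) - w₂ (a + b - t))
    rw [norm_sub_rev (w₁ (a + b - t') - w₂ (a + b - t'))] at h2
    linarith

end

section

variable {d : ℝ≥0∞} {r : ℝ → ℝ} {G : ℂ → ℝ → ℂ}

/-! ### Non-extendable solutions -/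

theorem SolvesOn.congr {a b : ℝ} {w w' : ℝ → ℂ} (hab : a ≤ b) (h : SolvesOn r G a b w)
    (heq : EqOn w' w (Icc a b)) : SolvesOn r G a b w' where
  absCont := by
    refine absolutelyContinuousOnInterval_of_dist_le (C := 1) h.absCont fun x hx y hy => ?_
    rw [uIcc_of_le hab] at hx hy
    rw [heq hx, heq hy, one_mul]
  graph t ht := by rw [heq ht]; exact h.graph t ht
  ode := by
    filter_upwards [h.ode] with t ht htm
    rw [heq (Ioo_subset_Icc_self htm)]
    refine (ht htm).congr_of_eventuallyEq ?_
    filter_upwards [Icc_mem_nhds htm.1 htm.2] with x hx using heq hx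

/-- Solutions on adjacent intervals can be glued. -/
theorem SolvesOn.trans (hd : 1 ≤ d) (hr : IsCanonicalDomainSystem d r)
    (hG : IsWeakHolVectorField d (spaceTime r) G) {a s b : ℝ} {w : ℝ → ℂ} (ha : 0 ≤ a) (has : a ≤ s)
    (hsb : s ≤ b) (h₁ : SolvesOn r G a s w) (h₂ : SolvesOn r G s b w) : SolvesOn r G a b w := by
  have hgr : ∀ t ∈ Icc a b, w t ∈ annulus (r t) := by
    intro t ht
    rcases le_total t s with h | h
    · exact h₁.graph t ⟨ht.1, h⟩
    · exact h₂.graph t ⟨h, ht.2⟩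
  have hc : ContinuousOn w (Icc a b) := by
    rw [← Icc_union_Icc_eq_Icc has hsb]
    exact (h₁.continuousOn has).union_of_isClosed (h₂.continuousOn hsb) isClosed_Icc isClosed_Icc
  have hab := has.trans hsb
  obtain ⟨ε, hε, lam, hlam0, hlam, -, hb, -⟩ := hG.exists_lipschitz_tube hd hr ha hab hc hgr
  have hb' : ∀ t ∈ Icc a b, ‖G (w t) t‖ ≤ lam t := fun t ht =>
    hb t ht _ (Metric.mem_closedBall_self hε.le)
  refine ⟨absolutelyContinuousOnInterval_of_norm_sub_le_integral hab hlam fun u t hu hut ht => ?_,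
    hgr, ?_⟩
  · have hum : u ∈ Icc a b := ⟨hu, hut.trans ht⟩
    have htm : t ∈ Icc a b := ⟨hu.trans hut, ht⟩
    have hsm : s ∈ Icc a b := ⟨has, hsb⟩
    have hI := fun {x y : ℝ} (hx : x ∈ Icc a b) (hy : y ∈ Icc a b) =>
      intervalIntegrable_of_mem_Icc hab hlam hx hy
    rw [norm_sub_rev]
    rcases le_total t s with h | h
    · exact (h₁.mono hu hut h).norm_sub_le hut (hI hum htm) fun τ hτ =>
        hb' τ ⟨hu.trans hτ.1, hτ.2.trans ht⟩
    rcases le_total s u with h' | h'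
    · exact (h₂.mono h' hut ht).norm_sub_le hut (hI hum htm) fun τ hτ =>
        hb' τ ⟨hu.trans hτ.1, hτ.2.trans ht⟩
    have e1 := (h₁.mono hu h' le_rfl).norm_sub_le h' (hI hum hsm) fun τ hτ =>
        hb' τ ⟨hu.trans hτ.1, hτ.2.trans hsb⟩
    have e2 := (h₂.mono le_rfl h ht).norm_sub_le h (hI hsm htm) fun τ hτ =>
        hb' τ ⟨has.trans hτ.1, hτ.2.trans ht⟩
    rw [← intervalIntegral.integral_add_adjacent_intervals (hI hum hsm) (hI hsm htm)]
    have := norm_sub_le_norm_sub_add_norm_sub (w t) (w s) (w u)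
    linarith
  · have hne : ∀ᵐ t : ℝ, t ≠ s := by simp [ae_iff, measure_singleton]
    filter_upwards [h₁.ode, h₂.ode, hne] with t ht₁ ht₂ hts htm
    rcases lt_or_gt_of_ne hts with h | h
    · exact ht₁ ⟨htm.1, h⟩
    · exact ht₂ ⟨h, htm.2⟩

theorem IsSolution.solvesOn {s : ℝ} {z : ℂ} {J : Set ℝ} {w : ℝ → ℂ}
    (h : IsSolution (spaceTime r) G s z J w) {a b : ℝ} (ha : a ∈ J) (hb : b ∈ J) :
    SolvesOn r G a b w where
  absCont := h.absCont a ha b hb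
  graph t ht := (h.graph t (h.ordConnected.out ha hb ht)).2
  ode := by
    have h1 := h.ode
    rw [ae_restrict_iff' h.ordConnected.measurableSet] at h1
    filter_upwards [h1] with t ht htm
    have hsub := h.ordConnected.out ha hb
    exact (ht (hsub (Ioo_subset_Icc_self htm))).hasDerivAt
      (mem_of_superset (Icc_mem_nhds htm.1 htm.2) hsub)

theorem isSolution_of_solvesOn {s : ℝ} {z : ℂ} {J : Set ℝ} {w : ℝ → ℂ} (hJ : J.OrdConnected)
    (hs : s ∈ J) (hz : w s = z) (hJ0 : J ⊆ Ici 0)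
    (h : ∀ a ∈ J, ∀ b ∈ J, a ≤ b → SolvesOn r G a b w) :
    IsSolution (spaceTime r) G s z J w where
  ordConnected := hJ
  mem := hs
  init := hz
  graph t ht := ⟨hJ0 ht, (h t ht t ht le_rfl).graph t ⟨le_rfl, le_rfl⟩⟩
  absCont a ha b hb := by
    rcases le_total a b with hab | hab
    · exact (h a ha b hb hab).absCont
    · exact (h b hb a ha hab).absCont.symm
  ode := by
    rw [ae_restrict_iff' hJ.measurableSet]
    have h1 : ∀ᵐ t : ℝ, ∀ p q : ℚ, (p : ℝ) ∈ J → (q : ℝ) ∈ J → t ∈ Ioo (p : ℝ) q →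
        HasDerivAt w (G (w t) t) t := by
      rw [ae_all_iff]; intro p
      rw [ae_all_iff]; intro q
      by_cases hp : (p : ℝ) ∈ J ∧ (q : ℝ) ∈ J ∧ (p : ℝ) ≤ q
      · filter_upwards [(h p hp.1 q hp.2.1 hp.2.2).ode] with t ht _ _ htm using ht htm
      · refine Eventually.of_forall fun t hp' hq' ht => absurd ⟨hp', hq', ?_⟩ hp
        exact (ht.1.trans ht.2).le
    -- only the endpoints of `J` are not interior to a rational subinterval
    have h2 : ∀ᵐ t : ℝ, ¬ IsLeast J t := by
      rw [ae_iff]; simp only [not_not]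
      exact Set.Subsingleton.measure_zero (fun x hx y hy => hx.unique hy) _
    have h3 : ∀ᵐ t : ℝ, ¬ IsGreatest J t := by
      rw [ae_iff]; simp only [not_not]
      exact Set.Subsingleton.measure_zero (fun x hx y hy => hx.unique hy) _
    filter_upwards [h1, h2, h3] with t ht hl hg htJ
    have h4 : ∃ a ∈ J, a < t := by
      by_contra! hcon
      exact hl ⟨htJ, hcon⟩
    have h5 : ∃ b ∈ J, t < b := by
      by_contra! hcon
      exact hg ⟨htJ, hcon⟩
    obtain ⟨a, ha, hat⟩ := h4
    obtain ⟨b, hb, htb⟩ := h5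
    obtain ⟨p, hp1, hp2⟩ := exists_rat_btwn hat
    obtain ⟨q, hq1, hq2⟩ := exists_rat_btwn htb
    exact (ht p q (hJ.out ha htJ ⟨hp1.le, hp2.le⟩) (hJ.out htJ hb ⟨hq1.le, hq2.le⟩)
      ⟨hp2, hq1⟩).hasDerivWithinAt

/-- Two solutions of the same initial value problem agree where both are defined. -/
theorem IsSolution.eq_of_mem (hd : 1 ≤ d) (hr : IsCanonicalDomainSystem d r)
    (hG : IsWeakHolVectorField d (spaceTime r) G) {s : ℝ} {z : ℂ} {J₁ J₂ : Set ℝ} {w₁ w₂ : ℝ → ℂ}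
    (h₁ : IsSolution (spaceTime r) G s z J₁ w₁) (h₂ : IsSolution (spaceTime r) G s z J₂ w₂)
    {t : ℝ} (ht₁ : t ∈ J₁) (ht₂ : t ∈ J₂) : w₁ t = w₂ t := by
  have heq : w₁ s = w₂ s := by rw [h₁.init, h₂.init]
  rcases le_total s t with h | h
  · exact (h₁.solvesOn h₁.mem ht₁).eqOn_forward hd hr hG (h₁.graph s h₁.mem).1 h
      (h₂.solvesOn h₂.mem ht₂) heq ⟨h, le_rfl⟩
  · exact (h₁.solvesOn ht₁ h₁.mem).eqOn_backward hd hr hG (h₁.graph t ht₁).1 h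
      (h₂.solvesOn ht₂ h₂.mem) heq ⟨le_rfl, h⟩

/-- The union of all solutions of an initial value problem is its non-extendable solution. -/
theorem exists_nonextendable (hd : 1 ≤ d) (hr : IsCanonicalDomainSystem d r)
    (hG : IsWeakHolVectorField d (spaceTime r) G) (hsc : IsSemicomplete (spaceTime r) G)
    {s : ℝ} {z : ℂ} (hz : (z, s) ∈ spaceTime r) :
    ∃ (J : Set ℝ) (w : ℝ → ℂ), IsNonextendableSolution (spaceTime r) G s z J w ∧ Ici s ⊆ J := by
  classical
  set J : Set ℝ := {t | ∃ (J' : Set ℝ) (w' : ℝ → ℂ), IsSolution (spaceTime r) G s z J' w' ∧ t ∈ J'}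
    with hJ
  have hex : ∀ t, ∃ v : ℂ, ∀ (J' : Set ℝ) (w' : ℝ → ℂ), IsSolution (spaceTime r) G s z J' w' →
      t ∈ J' → w' t = v := by
    intro t
    by_cases ht : t ∈ J
    · obtain ⟨J', w', h', ht'⟩ := ht
      exact ⟨w' t, fun J'' w'' h'' ht'' => h''.eq_of_mem hd hr hG h' ht'' ht'⟩
    · exact ⟨0, fun J' w' h' ht' => absurd ⟨J', w', h', ht'⟩ ht⟩
  choose w hw using hex
  obtain ⟨w₀, hw₀⟩ := hsc z s hz
  have hsub : Ici s ⊆ J := fun t ht => ⟨_, _, hw₀, ht⟩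
  have hsJ : s ∈ J := hsub self_mem_Ici
  have hJ0 : J ⊆ Ici 0 := by
    rintro t ⟨J', w', h', ht'⟩
    exact (h'.graph t ht').1
  have hright : ∀ b ∈ J, ∀ a, s ≤ a → a ≤ b → a ∈ J ∧ SolvesOn r G a b w := by
    rintro b ⟨J', w', h', hb'⟩ a hsa hab
    have hsubJ : ∀ t ∈ Icc a b, t ∈ J' := fun t ht =>
      h'.ordConnected.out h'.mem hb' ⟨hsa.trans ht.1, ht.2⟩
    have ha' := hsubJ a ⟨le_rfl, hab⟩
    exact ⟨⟨J', w', h', ha'⟩, (h'.solvesOn ha' hb').congr hab fun t ht =>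
      (hw t _ _ h' (hsubJ t ht)).symm⟩
  have hleft : ∀ a ∈ J, ∀ b, b ≤ s → a ≤ b → b ∈ J ∧ SolvesOn r G a b w := by
    rintro a ⟨J', w', h', ha'⟩ b hbs hab
    have hsubJ : ∀ t ∈ Icc a b, t ∈ J' := fun t ht =>
      h'.ordConnected.out ha' h'.mem ⟨ht.1, ht.2.trans hbs⟩
    have hb' := hsubJ b ⟨hab, le_rfl⟩
    exact ⟨⟨J', w', h', hb'⟩, (h'.solvesOn ha' hb').congr hab fun t ht =>
      (hw t _ _ h' (hsubJ t ht)).symm⟩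
  refine ⟨J, w, ⟨isSolution_of_solvesOn ⟨fun a ha b hb t ht => ?_⟩ hsJ ?_ hJ0 ?_, ?_⟩, hsub⟩
  · rcases le_total s t with h | h
    · exact (hright b hb t h ht.2).1
    · exact (hleft a ha t h ht.1).1
  · rw [← hw s _ _ hw₀ self_mem_Ici, hw₀.init]
  · intro a ha b hb hab
    rcases le_total s a with h | h
    · exact (hright b hb a h hab).2
    rcases le_total b s with h' | h'
    · exact (hleft a ha b h' hab).2
    exact (hleft a ha s le_rfl h).2.trans hd hr hG (hJ0 ha) h h' (hright b hb s le_rfl h').2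
  · intro J' w' h'
    exact ⟨fun t ht => ⟨J', w', h', ht⟩, fun t ht => hw t J' w' h' ht⟩

/-! ### The semiflow of a semicomplete field -/

/-- A solution whose field is bounded near its initial value stays near it for a short time. -/
theorem SolvesOn.norm_sub_init_lt {a b ε η : ℝ} {w : ℝ → ℂ} {z : ℂ} {lam : ℝ → ℝ} (hab : a ≤ b)
    (hlam0 : ∀ t ∈ Icc a b, 0 ≤ lam t) (hlam : IntervalIntegrable lam volume a b)
    (hL : ∀ t ∈ Icc a b, ∀ p ∈ Metric.closedBall z ε, ‖G p t‖ ≤ lam t)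
    (h : SolvesOn r G a b w) (hz : w a = z) (hη : 0 < η) (hηε : η ≤ ε)
    (hsmall : ∫ ξ in a..b, lam ξ ≤ η / 8) : ∀ t ∈ Icc a b, ‖w t - z‖ < η := by
  -- adding the constant `c` turns the bound for the field into a linear growth condition
  set c := η / 4 with hc
  have hc0 : 0 < c := by positivity
  have hcexp : c * Real.exp 1 < η := by
    have := Real.exp_one_lt_d9
    rw [hc]; nlinarith
  have hint : ∀ t ∈ Icc a b, 2 * ∫ ξ in a..t, lam ξ / c ≤ 1 := by
    intro t ht
    rw [intervalIntegral.integral_div]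
    have h1 : ∫ ξ in a..t, lam ξ ≤ ∫ ξ in a..b, lam ξ := by
      refine intervalIntegral.integral_mono_interval le_rfl ht.1 ht.2 ?_ hlam
      rw [EventuallyLE, ae_restrict_iff' measurableSet_Ioc]
      exact Eventually.of_forall fun t ht => hlam0 t (Ioc_subset_Icc_self ht)
    have h2 : (∫ ξ in a..t, lam ξ) / c ≤ 1 / 2 := by
      rw [div_le_iff₀ hc0, hc]; linarith
    linarith
  have key := gronwall_tube (x := fun t => ‖w t - z‖ + c) (lam := fun t => lam t / c) (ε := ε) hab
    (((h.continuousOn hab).sub continuousOn_const).norm.add continuousOn_const)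
    (fun t _ => by positivity) (hlam.div_const c) (fun t ht => div_nonneg (hlam0 t ht) hc0.le) ?_ ?_
  · intro t ht
    have h1 := key t ht
    simp only [hz, sub_self, norm_zero, zero_add] at h1
    have h2 : c * Real.exp (2 * ∫ ξ in a..t, lam ξ / c) ≤ c * Real.exp 1 := by
      gcongr
      exact hint t ht
    linarith
  · intro t ht t' ht' htt M hM hx
    have h1 := (h.mono ht.1 htt ht'.2).norm_sub_le htt
      (intervalIntegrable_of_mem_Icc hab hlam ht ht') (fun τ hτ =>
        hL τ ⟨ht.1.trans hτ.1, hτ.2.trans ht'.2⟩ _ (by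
          have := hx τ hτ
          rw [Metric.mem_closedBall, dist_eq_norm]
          linarith))
    have hMc : 1 ≤ M / c := by
      have := hx t (left_mem_Icc.2 htt)
      have h0 := norm_nonneg (w t - z)
      rw [one_le_div hc0]; linarith
    have h2 := norm_sub_le_norm_sub_add_norm_sub (w t') (w t) z
    have h3 : 0 ≤ ∫ ξ in t..t', lam ξ := intervalIntegral.integral_nonneg htt fun τ hτ =>
      hlam0 τ ⟨ht.1.trans hτ.1, hτ.2.trans ht'.2⟩
    rw [intervalIntegral.integral_div]
    have h4 : M * ((∫ ξ in t..t', lam ξ) / c) = M / c * ∫ ξ in t..t', lam ξ := by ring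
    rw [h4]
    nlinarith
  · simp only [hz, sub_self, norm_zero, zero_add]
    have h2 : c * Real.exp (2 * ∫ ξ in a..b, lam ξ / c) ≤ c * Real.exp 1 := by
      gcongr
      exact hint b (right_mem_Icc.2 hab)
    linarith

/-- `W s z` is a solution on `[s,∞)` of the differential equation with the field `G`, started from
`z` at time `s`. -/
structure IsSemiflow (r : ℝ → ℝ) (G : ℂ → ℝ → ℂ) (W : ℝ → ℂ → ℝ → ℂ) : Prop where
  init : ∀ s, 0 ≤ s → ∀ z ∈ annulus (r s), W s z s = z
  solves : ∀ s, 0 ≤ s → ∀ z ∈ annulus (r s), ∀ t, s ≤ t → SolvesOn r G s t (W s z)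

namespace IsSemiflow

variable {W : ℝ → ℂ → ℝ → ℂ}

theorem comp (hd : 1 ≤ d) (hr : IsCanonicalDomainSystem d r)
    (hG : IsWeakHolVectorField d (spaceTime r) G) (hW : IsSemiflow r G W) {s u t : ℝ} (hs : 0 ≤ s)
    (hsu : s ≤ u) (hut : u ≤ t) {z : ℂ} (hz : z ∈ annulus (r s)) : W s z t = W u (W s z u) t := by
  have h1 := hW.solves s hs z hz t (hsu.trans hut)
  have hm : W s z u ∈ annulus (r u) := h1.graph u ⟨hsu, hut⟩
  have h2 := hW.solves u (hs.trans hsu) _ hm t hut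
  exact (h1.mono hsu hut le_rfl).eqOn_forward hd hr hG (hs.trans hsu) hut h2
    (hW.init u (hs.trans hsu) _ hm).symm ⟨hut, le_rfl⟩

/-- The trajectories of a point, started at times close to `s₀`, fill a relatively compact set. -/
theorem exists_compact_near (hd : 1 ≤ d) (hr : IsCanonicalDomainSystem d r)
    (hG : IsWeakHolVectorField d (spaceTime r) G) (hW : IsSemiflow r G W) {S T s₀ : ℝ} (hS : 0 ≤ S)
    {z : ℂ} (hz : z ∈ annulus (r S)) (hs₀ : s₀ ∈ Icc S T) :
    ∃ K ⊆ spaceTime r, IsCompact K ∧ ∀ᶠ s in 𝓝[Icc S T] s₀, ∀ ξ ∈ Icc s T, (W s z ξ, ξ) ∈ K := by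
  have hs₀0 : 0 ≤ s₀ := hS.trans hs₀.1
  have hzs : ∀ s, S ≤ s → z ∈ annulus (r s) := fun s hs => hr.annulus_subset hS hs hz
  have hw₀ := hW.solves s₀ hs₀0 z (hzs s₀ hs₀.1) T hs₀.2
  obtain ⟨ε₁, hε₁, lam₁, hlam₁0, hlam₁, hsub₁, hb₁, -⟩ := hG.exists_lipschitz_tube hd hr hS hs₀.1
    (w := fun _ => z) continuousOn_const (fun t ht => hzs t ht.1)
  obtain ⟨ε₂, hε₂, lam₂, hlam₂0, hlam₂, hsub₂, -, hL₂⟩ := hG.exists_lipschitz_tube hd hr hs₀0 hs₀.2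
    (hw₀.continuousOn hs₀.2) hw₀.graph
  set E := Real.exp (2 * ∫ ξ in s₀..T, lam₂ ξ) with hE
  have hE0 : 0 < E := Real.exp_pos _
  set η := min ε₁ (ε₂ / E / 2) with hη
  have hη0 : 0 < η := by positivity
  have hηE : η * E < ε₂ := by
    have : η ≤ ε₂ / E / 2 := min_le_right _ _
    calc η * E ≤ ε₂ / E / 2 * E := by gcongr
      _ = ε₂ / 2 := by field_simp
      _ < ε₂ := by linarith
  refine ⟨tube (fun _ => z) S s₀ ε₁ ∪ tube (W s₀ z) s₀ T ε₂,
    union_subset (tube_subset hS hsub₁) (tube_subset hs₀0 hsub₂),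
    (isCompact_tube continuousOn_const _).union (isCompact_tube (hw₀.continuousOn hs₀.2) _), ?_⟩
  -- comparison with the trajectory started at `s₀`, from a time `a ≥ s₀` on
  have hcompare : ∀ a ∈ Icc s₀ T, ∀ w, SolvesOn r G a T w → ‖w a - W s₀ z a‖ ≤ η →
      ∀ ξ ∈ Icc a T, (w ξ, ξ) ∈ tube (W s₀ z) s₀ T ε₂ := by
    intro a ha w hw hwa ξ hξ
    have hm : ∀ {t}, t ∈ Icc a T → t ∈ Icc s₀ T := fun ht => ⟨ha.1.trans ht.1, ht.2⟩
    have hint : ∀ t ∈ Icc a T, ∫ x in a..t, lam₂ x ≤ ∫ x in s₀..T, lam₂ x := by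
      intro t ht
      refine intervalIntegral.integral_mono_interval ha.1 ht.1 ht.2 ?_ hlam₂
      rw [EventuallyLE, ae_restrict_iff' measurableSet_Ioc]
      exact Eventually.of_forall fun t ht => hlam₂0 t (Ioc_subset_Icc_self ht)
    have hle : ∀ t ∈ Icc a T, ‖w a - W s₀ z a‖ * Real.exp (2 * ∫ x in a..t, lam₂ x) < ε₂ := by
      intro t ht
      refine lt_of_le_of_lt ?_ hηE
      rw [hE]
      gcongr
      exact hint t ht
    have h1 := SolvesOn.norm_sub_le_exp ha.2 (fun t ht => hlam₂0 t (hm ht))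
      (intervalIntegrable_of_mem_Icc hs₀.2 hlam₂ ha ⟨hs₀.2, le_rfl⟩)
      (fun t ht p hp => (hL₂ t (hm ht) p hp).1) (hw₀.mono ha.1 ha.2 le_rfl) hw
      (hle T ⟨ha.2, le_rfl⟩) ξ hξ
    refine mem_tube (hm hξ) ?_
    rw [Metric.mem_closedBall, dist_eq_norm]
    exact h1.trans (hle ξ hξ).le
  have hev1 : ∀ᶠ s in 𝓝[Icc S s₀] s₀, ∫ ξ in s..s₀, lam₁ ξ ≤ η / 8 := by
    have h1 : ContinuousWithinAt (fun s => ∫ ξ in s₀..s, lam₁ ξ) (Icc S s₀) s₀ :=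
      continuousOn_integral_Icc hs₀.1 hlam₁ ⟨hs₀.1, le_rfl⟩ s₀ ⟨hs₀.1, le_rfl⟩
    have h2 : Tendsto (fun s => -∫ ξ in s₀..s, lam₁ ξ) (𝓝[Icc S s₀] s₀) (𝓝 0) := by
      have := h1.tendsto.neg
      simpa using this
    filter_upwards [h2.eventually_lt_const (show (0 : ℝ) < η / 8 by positivity)] with s hs
    rw [intervalIntegral.integral_symm]
    exact hs.le
  have hev2 : ∀ᶠ s in 𝓝[Icc s₀ T] s₀, ‖z - W s₀ z s‖ ≤ η := by
    have h1 := (hw₀.continuousOn hs₀.2) s₀ ⟨le_rfl, hs₀.2⟩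
    have h2 : Tendsto (fun s => ‖z - W s₀ z s‖) (𝓝[Icc s₀ T] s₀) (𝓝 0) := by
      have := (tendsto_const_nhds (x := z)).sub h1.tendsto |>.norm
      rw [hW.init s₀ hs₀0 z (hzs s₀ hs₀.1)] at this
      simpa using this
    filter_upwards [h2.eventually_lt_const hη0] with s hs using hs.le
  rw [← Icc_union_Icc_eq_Icc hs₀.1 hs₀.2, nhdsWithin_union, eventually_sup]
  constructor
  · filter_upwards [hev1, self_mem_nhdsWithin] with s hs hsm ξ hξ
    have hs0 : 0 ≤ s := hS.trans hsm.1
    have hw := hW.solves s hs0 z (hzs s hsm.1) T (hsm.2.trans hs₀.2)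
    have hm : ∀ {t}, t ∈ Icc s s₀ → t ∈ Icc S s₀ := fun ht => ⟨hsm.1.trans ht.1, ht.2⟩
    have h1 := (hw.mono le_rfl hsm.2 hs₀.2).norm_sub_init_lt hsm.2 (fun t ht => hlam₁0 t (hm ht))
      (intervalIntegrable_of_mem_Icc hs₀.1 hlam₁ hsm ⟨hs₀.1, le_rfl⟩)
      (fun t ht p hp => hb₁ t (hm ht) p hp) (hW.init s hs0 z (hzs s hsm.1)) hη0 (min_le_left _ _) hs
    rcases le_total ξ s₀ with h | h
    · refine Or.inl (mem_tube ⟨hsm.1.trans hξ.1, h⟩ ?_)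
      rw [Metric.mem_closedBall, dist_eq_norm]
      exact (h1 ξ ⟨hξ.1, h⟩).le.trans (min_le_left _ _)
    · refine Or.inr (hcompare s₀ ⟨le_rfl, hs₀.2⟩ _ (hw.mono hsm.2 hs₀.2 le_rfl) ?_ ξ ⟨h, hξ.2⟩)
      rw [hW.init s₀ hs₀0 z (hzs s₀ hs₀.1)]
      exact (h1 s₀ ⟨hsm.2, le_rfl⟩).le
  · filter_upwards [hev2, self_mem_nhdsWithin] with s hs hsm ξ hξ
    have hs0 : 0 ≤ s := hs₀0.trans hsm.1
    have hzm := hzs s (hs₀.1.trans hsm.1)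
    refine Or.inr (hcompare s hsm _ (hW.solves s hs0 z hzm T hsm.2) ?_ ξ hξ)
    rw [hW.init s hs0 z hzm]
    exact hs

/-- The trajectories of a point over `[S,T]`, for all starting times in `[S,T]`, fill a relatively
compact subset of `𝒟`. -/
theorem exists_compact (hd : 1 ≤ d) (hr : IsCanonicalDomainSystem d r)
    (hG : IsWeakHolVectorField d (spaceTime r) G) (hW : IsSemiflow r G W) {S T : ℝ} (hS : 0 ≤ S)
    {z : ℂ} (hz : z ∈ annulus (r S)) :
    ∃ K ⊆ spaceTime r, IsCompact K ∧ ∀ s ∈ Icc S T, ∀ ξ ∈ Icc s T, (W s z ξ, ξ) ∈ K := by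
  refine isCompact_Icc.induction_on (s := Icc S T)
    (p := fun A => ∃ K ⊆ spaceTime r, IsCompact K ∧ ∀ s ∈ A, ∀ ξ ∈ Icc s T, (W s z ξ, ξ) ∈ K)
    ⟨∅, empty_subset _, isCompact_empty, fun s hs => absurd hs (notMem_empty s)⟩ ?_ ?_ ?_
  · rintro A B hAB ⟨K, hK, hKc, h⟩
    exact ⟨K, hK, hKc, fun s hs => h s (hAB hs)⟩
  · rintro A B ⟨K, hK, hKc, h⟩ ⟨K', hK', hKc', h'⟩
    refine ⟨K ∪ K', union_subset hK hK', hKc.union hKc', ?_⟩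
    rintro s (hs | hs) ξ hξ
    · exact Or.inl (h s hs ξ hξ)
    · exact Or.inr (h' s hs ξ hξ)
  · intro s₀ hs₀
    obtain ⟨K, hK, hKc, h⟩ := hW.exists_compact_near hd hr hG hS hz hs₀
    exact ⟨_, h, K, hK, hKc, fun s hs => hs⟩

/-- The semiflow depends holomorphically on the initial value: its difference quotients satisfy an
approximate linear equation, so that they form a Cauchy family. -/
theorem differentiableAt (hd : 1 ≤ d) (hr : IsCanonicalDomainSystem d r)
    (hG : IsWeakHolVectorField d (spaceTime r) G) (hW : IsSemiflow r G W) {s t : ℝ} (hs : 0 ≤ s)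
    (hst : s ≤ t) {z₀ : ℂ} (hz₀ : z₀ ∈ annulus (r s)) :
    DifferentiableAt ℂ (fun z => W s z t) z₀ := by
  have hw₀ := hW.solves s hs z₀ hz₀ t hst
  obtain ⟨ε, hε, lam, hlam0, hlam, hsub, -, hL⟩ := hG.exists_lipschitz_tube hd hr hs hst
    (hw₀.continuousOn hst) hw₀.graph
  have hinit₀ := hW.init s hs z₀ hz₀
  set E := Real.exp (2 * ∫ ξ in s..t, lam ξ) with hE
  have hI0 : ∀ τ ∈ Icc s t, 0 ≤ ∫ ξ in s..τ, lam ξ := fun τ hτ =>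
    intervalIntegral.integral_nonneg hτ.1 fun ξ hξ => hlam0 ξ ⟨hξ.1, hξ.2.trans hτ.2⟩
  have hImono : ∀ τ ∈ Icc s t, ∫ ξ in s..τ, lam ξ ≤ ∫ ξ in s..t, lam ξ := by
    intro τ hτ
    refine intervalIntegral.integral_mono_interval le_rfl hτ.1 hτ.2 ?_ hlam
    rw [EventuallyLE, ae_restrict_iff' measurableSet_Ioc]
    exact Eventually.of_forall fun t ht => hlam0 t (Ioc_subset_Icc_self ht)
  have hE1 : 1 ≤ E := Real.one_le_exp (by have := hI0 t ⟨hst, le_rfl⟩; positivity)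
  have hE0 : 0 < E := by linarith
  -- the perturbed trajectories
  have hpert : ∀ h : ℂ, ‖h‖ * E < ε → SolvesOn r G s t (W s (z₀ + h)) ∧ W s (z₀ + h) s = z₀ + h ∧
      ∀ τ ∈ Icc s t, ‖W s (z₀ + h) τ - W s z₀ τ‖ ≤ ‖h‖ * E := by
    intro h hh
    have hhε : ‖h‖ ≤ ε := by nlinarith [norm_nonneg h]
    have hm : z₀ + h ∈ annulus (r s) := by
      refine hsub s ⟨le_rfl, hst⟩ ?_
      rw [hinit₀, Metric.mem_closedBall, dist_eq_norm]
      simpa using hhε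
    have hi := hW.init s hs _ hm
    have hsol := hW.solves s hs _ hm t hst
    refine ⟨hsol, hi, fun τ hτ => ?_⟩
    have e1 : W s (z₀ + h) s - W s z₀ s = h := by rw [hi, hinit₀]; ring
    have h1 := SolvesOn.norm_sub_le_exp hst hlam0 hlam (fun t ht p hp => (hL t ht p hp).1) hw₀ hsol
      (by rw [e1]; exact hh) τ hτ
    rw [e1] at h1
    refine h1.trans ?_
    rw [hE]
    gcongr
    exact hImono τ hτ
  have hcauchy : ∀ h h' : ℂ, h ≠ 0 → h' ≠ 0 → ‖h‖ * E < ε → ‖h'‖ * E < ε →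
      ‖h⁻¹ • (W s (z₀ + h) t - W s z₀ t) - h'⁻¹ • (W s (z₀ + h') t - W s z₀ t)‖ ≤
        E ^ 2 * (‖h‖ + ‖h'‖) * E := by
    intro h h' hh hh' hhε hhε'
    obtain ⟨hsol, hi, hb⟩ := hpert h hhε
    obtain ⟨hsol', hi', hb'⟩ := hpert h' hhε'
    -- `D` starts at `0` and grows at the rate `lam * (‖D‖ + c)`
    set c := E ^ 2 * (‖h‖ + ‖h'‖) with hc
    have hc0 : 0 ≤ c := by positivity
    set w₀ := W s z₀
    set w := W s (z₀ + h)
    set w' := W s (z₀ + h')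
    set D : ℝ → ℂ := fun τ => h⁻¹ • (w τ - w₀ τ) - h'⁻¹ • (w' τ - w₀ τ) with hD
    have hDac : AbsolutelyContinuousOnInterval D s t :=
      ((hsol.absCont.sub hw₀.absCont).const_smul h⁻¹).sub
        ((hsol'.absCont.sub hw₀.absCont).const_smul h'⁻¹)
    have hDs : D s = 0 := by
      simp only [hD, hi, hi', hinit₀, add_sub_cancel_left, smul_eq_mul]
      rw [inv_mul_cancel₀ hh, inv_mul_cancel₀ hh', sub_self]
    have hDc : ContinuousOn D (Icc s t) := by
      have := hDac.continuousOn
      rwa [uIcc_of_le hst] at this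
    have hDd : ∀ τ ∈ Icc s t, ‖h⁻¹ • (G (w τ) τ - G (w₀ τ) τ) - h'⁻¹ • (G (w' τ) τ - G (w₀ τ) τ)‖ ≤
        lam τ * (‖D τ‖ + c) := by
      intro τ hτ
      have hmem : ∀ {v : ℂ}, ‖v - w₀ τ‖ < ε → v ∈ Metric.closedBall (w₀ τ) ε := fun hv => by
        rw [Metric.mem_closedBall, dist_eq_norm]; exact hv.le
      have hwm := hmem ((hb τ hτ).trans_lt hhε)
      have hwm' := hmem ((hb' τ hτ).trans_lt hhε')
      obtain ⟨hd1, hd2⟩ := hL τ hτ (w₀ τ) (Metric.mem_closedBall_self hε.le)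
      set A := dslope (fun z => G z τ) (w₀ τ) (w τ)
      set A' := dslope (fun z => G z τ) (w₀ τ) (w' τ)
      have e1 : G (w τ) τ - G (w₀ τ) τ = (w τ - w₀ τ) * A := by
        have := sub_smul_dslope (fun z => G z τ) (w₀ τ) (w τ)
        simpa using this.symm
      have e2 : G (w' τ) τ - G (w₀ τ) τ = (w' τ - w₀ τ) * A' := by
        have := sub_smul_dslope (fun z => G z τ) (w₀ τ) (w' τ)
        simpa using this.symm
      have e3 : h⁻¹ • (G (w τ) τ - G (w₀ τ) τ) - h'⁻¹ • (G (w' τ) τ - G (w₀ τ) τ) =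
          D τ * A + (h'⁻¹ * (w' τ - w₀ τ)) * (A - A') := by
        rw [e1, e2]; simp only [hD, smul_eq_mul]; ring
      have e4 : ‖h'⁻¹ * (w' τ - w₀ τ)‖ ≤ E := by
        rw [norm_mul, norm_inv, inv_mul_le_iff₀ (norm_pos_iff.2 hh')]
        exact hb' τ hτ
      have e5 : ‖A - A'‖ ≤ lam τ * (E * (‖h‖ + ‖h'‖)) := by
        refine (hd2 _ hwm _ hwm').trans ?_
        have := hlam0 τ hτ
        gcongr
        have h1 := norm_sub_le_norm_sub_add_norm_sub (w τ) (w₀ τ) (w' τ)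
        rw [norm_sub_rev (w₀ τ)] at h1
        linarith [hb τ hτ, hb' τ hτ]
      have hl := hlam0 τ hτ
      rw [e3]
      calc _ ≤ ‖D τ‖ * ‖A‖ + ‖h'⁻¹ * (w' τ - w₀ τ)‖ * ‖A - A'‖ := by
            refine (norm_add_le _ _).trans ?_
            rw [norm_mul, norm_mul (h'⁻¹ * (w' τ - w₀ τ))]
        _ ≤ ‖D τ‖ * lam τ + E * (lam τ * (E * (‖h‖ + ‖h'‖))) := by
            gcongr
            exact hd1 _ hwm
        _ = lam τ * (‖D τ‖ + c) := by rw [hc]; ring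
    have key := gronwall_tube (x := fun τ => ‖D τ‖ + c) (lam := lam) (ε := c * E + 1) hst
      (hDc.norm.add continuousOn_const) (fun τ _ => by positivity) hlam hlam0 ?_ (by
        simp only [hDs, norm_zero, zero_add]; linarith) t ⟨hst, le_rfl⟩
    · simp only [hDs, norm_zero, zero_add] at key
      linarith
    · intro τ hτ τ' hτ' hττ M _ hx
      have hm : ∀ {ξ}, ξ ∈ Icc τ τ' → ξ ∈ Icc s t := fun hξ =>
        ⟨hτ.1.trans hξ.1, hξ.2.trans hτ'.2⟩
      have h1 := norm_sub_le_integral_of_ae_hasDerivAt (w := D) (k := fun ξ => M * lam ξ) hττ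
        (hDac.mono (by
          rw [uIcc_of_le hττ, uIcc_of_le hst]; exact Icc_subset_Icc hτ.1 hτ'.2))
        ((intervalIntegrable_of_mem_Icc hst hlam hτ hτ').const_mul M) (by
          filter_upwards [hw₀.ode, hsol.ode, hsol'.ode] with ξ h1 h2 h3 hξ
          have hξ' : ξ ∈ Ioo s t := ⟨hτ.1.trans_lt hξ.1, hξ.2.trans_le hτ'.2⟩
          refine ⟨_, (((h2 hξ').sub (h1 hξ')).const_smul h⁻¹).sub
            (((h3 hξ').sub (h1 hξ')).const_smul h'⁻¹), ?_⟩
          refine (hDd ξ (Ioo_subset_Icc_self hξ')).trans ?_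
          have h4 := hx ξ (Ioo_subset_Icc_self hξ)
          have h5 := hlam0 ξ (Ioo_subset_Icc_self hξ')
          rw [mul_comm]
          gcongr)
      rw [intervalIntegral.integral_const_mul] at h1
      have h2 := norm_sub_norm_le (D τ') (D τ)
      linarith
  have hlim : ∃ l, Tendsto (fun h : ℂ => h⁻¹ • (W s (z₀ + h) t - W s z₀ t)) (𝓝[≠] 0) (𝓝 l) := by
    rw [← cauchy_map_iff_exists_tendsto, Metric.cauchy_iff]
    refine ⟨inferInstance, fun δ hδ => ?_⟩
    set ρ := min (ε / (2 * E)) (δ / (4 * E ^ 3)) with hρ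
    have hρ0 : 0 < ρ := by positivity
    have hρε : ∀ h : ℂ, ‖h‖ < ρ → ‖h‖ * E < ε := by
      intro h hh
      have h1 : ‖h‖ < ε / (2 * E) := hh.trans_le (min_le_left _ _)
      rw [lt_div_iff₀ (by positivity)] at h1
      linarith
    refine ⟨(fun h : ℂ => h⁻¹ • (W s (z₀ + h) t - W s z₀ t)) '' (Metric.ball 0 ρ \ {0}),
      image_mem_map ?_, ?_⟩
    · rw [sdiff_eq, inter_comm]
      exact inter_mem_nhdsWithin _ (Metric.ball_mem_nhds 0 hρ0)
    · rintro _ ⟨h, ⟨hh, hh0⟩, rfl⟩ _ ⟨h', ⟨hh', hh0'⟩, rfl⟩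
      rw [mem_ball_zero_iff] at hh hh'
      rw [dist_eq_norm]
      refine (hcauchy h h' hh0 hh0' (hρε h hh) (hρε h' hh')).trans_lt ?_
      have h1 : ‖h‖ < δ / (4 * E ^ 3) := hh.trans_le (min_le_right _ _)
      have h2 : ‖h'‖ < δ / (4 * E ^ 3) := hh'.trans_le (min_le_right _ _)
      rw [lt_div_iff₀ (by positivity)] at h1 h2
      nlinarith
  obtain ⟨l, hl⟩ := hlim
  have : HasDerivAt (fun z => W s z t) l z₀ := hasDerivAt_iff_tendsto_slope_zero.2 hl
  exact this.differentiableAt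

/-- The semiflow of a weak holomorphic vector field is an evolution family. -/
theorem isEvolutionFamily (hd : 1 ≤ d) (hr : IsCanonicalDomainSystem d r)
    (hG : IsWeakHolVectorField d (spaceTime r) G) (hW : IsSemiflow r G W) :
    IsEvolutionFamily d r (fun s t z => W s z t) where
  holo s t hs hst z hz := (hW.differentiableAt hd hr hG hs hst hz).differentiableWithinAt
  mapsTo s t hs hst z hz := (hW.solves s hs z hz t hst).graph t ⟨hst, le_rfl⟩
  ef1 := hW.init
  ef2 s u t hs hsu hut z hz := hW.comp hd hr hG hs hsu hut hz
  ef3 S T hS hST z hz := by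
    obtain ⟨K, hK, hKc, hKW⟩ := hW.exists_compact (T := T) hd hr hG hS hz
    set K' : Set (ℂ × ℝ) := (K ∩ univ ×ˢ Icc S T) ∪ {z} ×ˢ Icc S T with hK'
    have hK'c : IsCompact K' :=
      (hKc.inter_right (isClosed_univ.prod isClosed_Icc)).union (isCompact_singleton.prod isCompact_Icc)
    have hK's : K' ⊆ spaceTime r := by
      refine union_subset (inter_subset_left.trans hK) ?_
      rintro ⟨p, t⟩ ⟨hp, ht⟩
      obtain rfl : p = z := hp
      exact ⟨hS.trans ht.1, hr.annulus_subset hS ht.1 hz⟩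
    have hsnd : Prod.snd '' K' = Icc S T := by
      ext t
      constructor
      · rintro ⟨p, hp | hp, rfl⟩
        · exact hp.2.2
        · exact hp.2
      · intro ht
        exact ⟨(z, t), Or.inr ⟨rfl, ht⟩, rfl⟩
    obtain ⟨k, hk0, hkm, hk⟩ := hG.bound K' hK'c hK's
    rw [hsnd] at hk0 hkm
    refine ⟨k, hk0, hkm, fun s u t hSs hsu hut htT => ?_⟩
    have hint : IntervalIntegrable k volume S T := by
      rw [intervalIntegrable_iff_integrableOn_Icc_of_le hST]
      exact hkm.integrable hd
    have hs0 := hS.trans hSs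
    have hsol := hW.solves s hs0 z (hr.annulus_subset hS hSs hz) t (hsu.trans hut)
    rw [norm_sub_rev]
    refine (hsol.mono hsu hut le_rfl).norm_sub_le hut (intervalIntegrable_of_mem_Icc hST hint
      ⟨hSs.trans hsu, hut.trans htT⟩ ⟨hSs.trans (hsu.trans hut), htT⟩) fun ξ hξ => ?_
    refine hk (W s z ξ, ξ) (Or.inl ⟨hKW s ⟨hSs, hsu.trans (hut.trans htT)⟩ ξ
      ⟨hsu.trans hξ.1, hξ.2.trans htT⟩, mem_univ _, ?_⟩)
    exact ⟨hSs.trans (hsu.trans hξ.1), hξ.2.trans htT⟩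

end IsSemiflow

/-- The non-extendable solutions of a semicomplete field form an evolution family. -/
theorem exists_nonextendable_evolutionFamily (hd : 1 ≤ d) (hr : IsCanonicalDomainSystem d r)
    (hG : IsWeakHolVectorField d (spaceTime r) G) (hsc : IsSemicomplete (spaceTime r) G) :
    ∃ (J : ℝ → ℂ → Set ℝ) (w : ℝ → ℂ → ℝ → ℂ),
      (∀ s z, (z, s) ∈ spaceTime r →
        IsNonextendableSolution (spaceTime r) G s z (J s z) (w s z) ∧ Ici s ⊆ J s z) ∧
      IsEvolutionFamily d r (fun s t z => w s z t) := by
  have hex : ∀ s z, ∃ (J : Set ℝ) (w : ℝ → ℂ), (z, s) ∈ spaceTime r →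
      IsNonextendableSolution (spaceTime r) G s z J w ∧ Ici s ⊆ J := by
    intro s z
    by_cases hz : (z, s) ∈ spaceTime r
    · obtain ⟨J, w, h⟩ := exists_nonextendable hd hr hG hsc hz
      exact ⟨J, w, fun _ => h⟩
    · exact ⟨∅, fun _ => 0, fun h => absurd h hz⟩
  choose J w hJw using hex
  have hflow : IsSemiflow r G w := by
    refine ⟨fun s hs z hz => (hJw s z ⟨hs, hz⟩).1.1.init, fun s hs z hz t hst => ?_⟩
    obtain ⟨h1, h2⟩ := hJw s z ⟨hs, hz⟩
    exact h1.1.solvesOn h1.1.mem (h2 hst)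
  exact ⟨J, w, hJw, hflow.isEvolutionFamily hd hr hG⟩

end

/-! ### Displacement of evolution families -/

theorem IsCanonicalDomainSystem.nonneg {d : ℝ≥0∞} {r : ℝ → ℝ} (hr : IsCanonicalDomainSystem d r)
    {t : ℝ} (ht : 0 ≤ t) : 0 ≤ r t := (hr.mem_Ico t ht).1

namespace IsEvolutionFamily

variable {d : ℝ≥0∞} {r : ℝ → ℝ} {φ : ℝ → ℝ → ℂ → ℂ}

theorem exists_increment_bound (hd : 1 ≤ d) (hφ : IsEvolutionFamily d r φ) {S T : ℝ} (hS : 0 ≤ S)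
    (hST : S ≤ T) {z : ℂ} (hz : z ∈ annulus (r S)) :
    ∃ k : ℝ → ℝ, IntervalIntegrable k volume S T ∧
      ∀ s u t, S ≤ s → s ≤ u → u ≤ t → t ≤ T → ‖φ s u z - φ s t z‖ ≤ ∫ ξ in u..t, k ξ := by
  obtain ⟨k, -, hk, h⟩ := hφ.ef3 S T hS hST z hz
  refine ⟨k, ?_, h⟩
  rw [intervalIntegrable_iff_integrableOn_Icc_of_le hST]
  exact hk.integrable hd

theorem absolutelyContinuousOnInterval (hd : 1 ≤ d) (hφ : IsEvolutionFamily d r φ) {s a b : ℝ}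
    (hs : 0 ≤ s) (hsa : s ≤ a) (hab : a ≤ b) {z : ℂ} (hz : z ∈ annulus (r s)) :
    AbsolutelyContinuousOnInterval (fun t => φ s t z) a b := by
  obtain ⟨k, hk, h⟩ := hφ.exists_increment_bound hd hs (hsa.trans hab) hz
  exact absolutelyContinuousOnInterval_of_norm_sub_le_integral hab
    (intervalIntegrable_of_mem_Icc (hsa.trans hab) hk ⟨hsa, hab⟩ ⟨hsa.trans hab, le_rfl⟩)
    fun u t hu hut ht => h s u t le_rfl (hsa.trans hu) hut ht

theorem continuousOn_time (hd : 1 ≤ d) (hφ : IsEvolutionFamily d r φ) {s : ℝ} (hs : 0 ≤ s) {z : ℂ}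
    (hz : z ∈ annulus (r s)) : ContinuousOn (fun t => φ s t z) (Ici s) := by
  intro t ht
  have h1 : s ≤ t + 1 := le_trans ht (by linarith)
  have h := (hφ.absolutelyContinuousOnInterval hd hs le_rfl h1 hz).continuousOn
  rw [uIcc_of_le h1] at h
  refine (h t ⟨ht, by linarith⟩).mono_of_mem_nhdsWithin ?_
  rw [← Ici_inter_Iic]
  exact inter_mem self_mem_nhdsWithin (mem_nhdsWithin_of_mem_nhds (Iic_mem_nhds (by linarith)))

/-- The maps of an evolution family are bounded by `1`, hence Lipschitz near each point, uniformly
in both time parameters. -/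
theorem norm_sub_le (hφ : IsEvolutionFamily d r φ) {s t δ : ℝ} (hs : 0 ≤ s) (hst : s ≤ t)
    (hδ : 0 < δ) {c : ℂ} (hc : Metric.closedBall c (2 * δ) ⊆ annulus (r s)) {x y : ℂ}
    (hx : x ∈ Metric.closedBall c δ) (hy : y ∈ Metric.closedBall c δ) :
    ‖φ s t x - φ s t y‖ ≤ 1 / δ * ‖x - y‖ :=
  norm_sub_le_of_norm_le_closedBall hδ (isOpen_annulus _) (hφ.holo s t hs hst) hc
    (fun _ hz => (hφ.mapsTo s t hs hst (hc hz)).2.le) hx hy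

theorem exists_closedBall_subset {ρ : ℝ} {z : ℂ} (hz : z ∈ annulus ρ) :
    ∃ δ > 0, Metric.closedBall z (2 * δ) ⊆ annulus ρ := by
  obtain ⟨δ, hδ, h⟩ := Metric.nhds_basis_closedBall.mem_iff.1 ((isOpen_annulus ρ).mem_nhds hz)
  exact ⟨δ / 2, by positivity, by rwa [mul_div_cancel₀ _ two_ne_zero]⟩

/-- Running the evolution family for a fixed duration `h` gives a continuous function of the
starting time. -/
theorem continuousOn_start (hd : 1 ≤ d) (hr : IsCanonicalDomainSystem d r)
    (hφ : IsEvolutionFamily d r φ) {S h : ℝ} (hS : 0 ≤ S) (hh : 0 ≤ h) {z : ℂ}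
    (hz : z ∈ annulus (r S)) : ContinuousOn (fun t => φ t (t + h) z) (Ici S) := by
  intro t₀ (ht₀ : S ≤ t₀)
  obtain ⟨δ, hδ, hball⟩ := exists_closedBall_subset hz
  have hST : S ≤ t₀ + h + 1 := by linarith
  obtain ⟨k, hk, hinc⟩ := hφ.exists_increment_bound hd hS hST hz
  set P : ℝ → ℝ := fun t => ∫ ξ in S..t, k ξ with hP
  have hPc : ContinuousOn P (Icc S (t₀ + h + 1)) :=
    continuousOn_integral_Icc hST hk ⟨le_rfl, hST⟩
  have hPsub : ∀ u t, S ≤ u → u ≤ t → t ≤ t₀ + h + 1 → ∫ ξ in u..t, k ξ = P t - P u := by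
    intro u t hu hut ht
    rw [hP, intervalIntegral.integral_interval_sub_left]
    · exact intervalIntegrable_of_mem_Icc hST hk ⟨le_rfl, hST⟩ ⟨hu.trans hut, ht⟩
    · exact intervalIntegrable_of_mem_Icc hST hk ⟨le_rfl, hST⟩ ⟨hu, hut.trans ht⟩
  have hcont : ∀ h' ∈ Icc 0 h, Tendsto (fun t => |P (t + h') - P (t₀ + h')|) (𝓝[Ici S] t₀) (𝓝 0) := by
    intro h' hh'
    have h1 : ContinuousWithinAt P (Icc S (t₀ + h + 1)) (t₀ + h') :=
      hPc _ ⟨by linarith [hh'.1], by linarith [hh'.2]⟩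
    have h2 : Tendsto (fun t : ℝ => t + h') (𝓝[Ici S] t₀) (𝓝[Icc S (t₀ + h + 1)] (t₀ + h')) := by
      refine tendsto_nhdsWithin_iff.2 ⟨(tendsto_id.add_const h').mono_left nhdsWithin_le_nhds, ?_⟩
      filter_upwards [self_mem_nhdsWithin, mem_nhdsWithin_of_mem_nhds
        (Iic_mem_nhds (show t₀ < t₀ + 1 by linarith))] with t (ht : S ≤ t) (ht' : t ≤ t₀ + 1)
      exact ⟨by linarith [hh'.1], by linarith [hh'.2]⟩
    have h3 := ((h1.tendsto.comp h2).sub_const (P (t₀ + h'))).abs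
    simpa using h3
  have hc0 : Tendsto (fun t => |P t - P t₀|) (𝓝[Ici S] t₀) (𝓝 0) := by
    simpa using hcont 0 ⟨le_rfl, hh⟩
  have hch := hcont h ⟨hh, le_rfl⟩
  have hlim : Tendsto (fun t => |P (t + h) - P (t₀ + h)| + 1 / δ * |P t - P t₀|) (𝓝[Ici S] t₀)
      (𝓝 0) := by simpa using hch.add (hc0.const_mul (1 / δ))
  rw [ContinuousWithinAt, tendsto_iff_norm_sub_tendsto_zero]
  refine squeeze_zero' (Eventually.of_forall fun _ => norm_nonneg _) ?_ hlim
  -- two starting times `a ≤ b`: `φ a (b + h) z = φ b (b + h) (φ a b z)` with `φ a b z` close to `z`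
  have key : ∀ a b, S ≤ a → a ≤ b → b ≤ t₀ + 1 → |P b - P a| ≤ δ →
      ‖φ a (a + h) z - φ b (b + h) z‖ ≤ |P (b + h) - P (a + h)| + 1 / δ * |P b - P a| := by
    intro a b ha hab hb hsmall
    have hb0 : 0 ≤ b := hS.trans (ha.trans hab)
    have hza := hr.annulus_subset hS ha hz
    have e1 : ‖φ a (a + h) z - φ a (b + h) z‖ ≤ |P (b + h) - P (a + h)| := by
      refine (hinc a (a + h) (b + h) ha (by linarith) (by linarith) (by linarith)).trans ?_
      rw [hPsub _ _ (by linarith) (by linarith) (by linarith)]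
      exact le_abs_self _
    have e2 : ‖φ a b z - z‖ ≤ |P b - P a| := by
      rw [norm_sub_rev]
      have := hinc a a b ha le_rfl hab (by linarith)
      rw [hφ.ef1 a (hS.trans ha) z hza, hPsub _ _ ha hab (by linarith)] at this
      exact this.trans (le_abs_self _)
    have e3 : ‖φ a (b + h) z - φ b (b + h) z‖ ≤ 1 / δ * |P b - P a| := by
      rw [hφ.ef2 a b (b + h) (hS.trans ha) hab (by linarith) z hza]
      refine (hφ.norm_sub_le hb0 (by linarith) hδ (hball.trans
        (hr.annulus_subset hS (ha.trans hab))) ?_ (Metric.mem_closedBall_self hδ.le)).trans ?_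
      · rw [Metric.mem_closedBall, dist_eq_norm]; exact e2.trans hsmall
      · gcongr
    exact (norm_sub_le_norm_sub_add_norm_sub _ _ _).trans (add_le_add e1 e3)
  have hsm : ∀ᶠ t in 𝓝[Ici S] t₀, |P t - P t₀| < δ := hc0.eventually (gt_mem_nhds hδ)
  filter_upwards [self_mem_nhdsWithin, mem_nhdsWithin_of_mem_nhds
    (Iic_mem_nhds (show t₀ < t₀ + 1 by linarith)), hsm] with t (ht : S ≤ t) (ht' : t ≤ t₀ + 1) hts
  rcases le_total t t₀ with hle | hle
  · rw [abs_sub_comm (P t), abs_sub_comm (P (t + h))]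
    rw [abs_sub_comm] at hts
    exact key t t₀ ht hle (by linarith) hts.le
  · rw [norm_sub_rev]
    exact key t₀ t ht₀ hle ht' hts.le

/-- `φ s t z` tends to `z` as `s` increases to `t`, provided that `z` lies in some earlier domain. -/
theorem tendsto_start_left (hd : 1 ≤ d) (hr : IsCanonicalDomainSystem d r)
    (hφ : IsEvolutionFamily d r φ) {S t : ℝ} (hS : 0 ≤ S) (hSt : S < t) {z : ℂ}
    (hz : z ∈ annulus (r S)) : Tendsto (fun s => φ s t z) (𝓝[<] t) (𝓝 z) := by
  obtain ⟨k, hk, hinc⟩ := hφ.exists_increment_bound hd hS hSt.le hz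
  have h1 : Tendsto (fun s => ∫ ξ in t..s, k ξ) (𝓝[Icc S t] t) (𝓝 (∫ ξ in t..t, k ξ)) :=
    continuousOn_integral_Icc hSt.le hk ⟨hSt.le, le_rfl⟩ t ⟨hSt.le, le_rfl⟩
  have hle : 𝓝[<] t ≤ 𝓝[Icc S t] t := by
    rw [← nhdsWithin_Ico_eq_nhdsLT hSt]
    exact nhdsWithin_mono _ Ico_subset_Icc_self
  have h2 := (h1.mono_left hle).neg
  rw [intervalIntegral.integral_same, neg_zero] at h2
  rw [tendsto_iff_norm_sub_tendsto_zero]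
  refine squeeze_zero' (Eventually.of_forall fun _ => norm_nonneg _) ?_ h2
  rw [← nhdsWithin_Ico_eq_nhdsLT hSt]
  filter_upwards [self_mem_nhdsWithin] with s hs
  have := hinc s s t hs.1 le_rfl hs.2.le le_rfl
  rw [hφ.ef1 s (hS.trans hs.1) z (hr.annulus_subset hS hs.1 hz)] at this
  rwa [norm_sub_rev, ← intervalIntegral.integral_symm]

/-- `φ s t` tends to the identity locally uniformly as `t` decreases to `s`. -/
theorem tendstoLocallyUniformlyOn_id (hd : 1 ≤ d) (hφ : IsEvolutionFamily d r φ) {s : ℝ}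
    (hs : 0 ≤ s) : TendstoLocallyUniformlyOn (fun t => φ s t) id (𝓝[>] s) (annulus (r s)) := by
  have hlim : ∀ z ∈ annulus (r s), Tendsto (fun t => φ s t z) (𝓝[>] s) (𝓝 z) := by
    intro z hz
    have h := (hφ.continuousOn_time hd hs hz s self_mem_Ici).tendsto
    rw [hφ.ef1 s hs z hz] at h
    exact h.mono_left (nhdsWithin_mono _ Ioi_subset_Ici_self)
  obtain ⟨g, -, hg⟩ := exists_tendstoLocallyUniformlyOn_of_dense (F := 𝓝[>] s)
    (q := fun t => φ s t) (isOpen_annulus (r s))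
    (by
      filter_upwards [self_mem_nhdsWithin] with t ht
      exact hφ.holo s t hs (le_of_lt ht))
    (fun K hK _ => ⟨1, by
      filter_upwards [self_mem_nhdsWithin] with t ht z hz
      exact (hφ.mapsTo s t hs (le_of_lt ht) (hK hz)).2.le⟩)
    (S := univ) (by simp) (fun z _ hz => ⟨z, hlim z hz⟩)
  refine hg.congr_right fun z hz => ?_
  exact tendsto_nhds_unique (hg.tendsto_at hz) (hlim z hz)

theorem continuousOn_uncurry (hd : 1 ≤ d) (hφ : IsEvolutionFamily d r φ) {s : ℝ} (hs : 0 ≤ s) :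
    ContinuousOn (fun p : ℂ × ℝ => φ s p.2 p.1) (annulus (r s) ×ˢ Ici s) := by
  rintro ⟨z, t⟩ ⟨hz, ht⟩
  obtain ⟨δ, hδ, hball⟩ := exists_closedBall_subset hz
  have hsub : Metric.closedBall z δ ⊆ annulus (r s) :=
    (Metric.closedBall_subset_closedBall (by linarith)).trans hball
  have h := continuousOn_prod_of_continuousOn_lipschitzOnWith (fun p : ℂ × ℝ => φ s p.2 p.1)
    (s := Metric.closedBall z δ) (t := Ici s) (1 / δ).toNNReal
    (fun a ha => hφ.continuousOn_time hd hs (hsub ha))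
    (fun b hb => LipschitzOnWith.of_dist_le_mul fun x hx y hy => by
      rw [dist_eq_norm, dist_eq_norm, Real.coe_toNNReal _ (by positivity)]
      exact hφ.norm_sub_le hs hb hδ hball hx hy)
  refine (h (z, t) ⟨Metric.mem_closedBall_self hδ.le, ht⟩).mono_of_mem_nhdsWithin ?_
  rw [nhdsWithin_prod_eq]
  exact prod_mem_prod (mem_nhdsWithin_of_mem_nhds (Metric.closedBall_mem_nhds z hδ))
    self_mem_nhdsWithin

end IsEvolutionFamily

/-- On a compact subset of `𝒟` the points stay uniformly away from the boundary of the annuli. -/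
theorem exists_uniform_annulus {d : ℝ≥0∞} {r : ℝ → ℝ} (hr : IsCanonicalDomainSystem d r)
    {α : Type*} [TopologicalSpace α] {K : Set α} (hK : IsCompact K) {f : α → ℂ} {τ : α → ℝ}
    (hf : ContinuousOn f K) (hτ : ContinuousOn τ K) (h : ∀ x ∈ K, (f x, τ x) ∈ spaceTime r) :
    ∃ R ε : ℝ, R < 1 ∧ 0 < ε ∧ ∀ x ∈ K, r (τ x) + ε ≤ ‖f x‖ ∧ ‖f x‖ ≤ R := by
  rcases K.eq_empty_or_nonempty with rfl | hne
  · exact ⟨0, 1, one_pos, one_pos, by simp⟩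
  obtain ⟨x₁, hx₁, h1⟩ := hK.exists_isMaxOn hne hf.norm
  obtain ⟨x₂, hx₂, h2⟩ := hK.exists_isMinOn hne
    (hf.norm.sub (hr.continuousOn.comp hτ fun x hx => (h x hx).1))
  refine ⟨‖f x₁‖, ‖f x₂‖ - r (τ x₂), (h x₁ hx₁).2.2, sub_pos.2 (h x₂ hx₂).2.1, fun x hx => ?_⟩
  have h3 : ‖f x₂‖ - r (τ x₂) ≤ ‖f x‖ - r (τ x) := h2 hx
  exact ⟨by linarith, h1 hx⟩

/-- `k` controls the displacement of the evolution family `φ` on `[0,T]`: on closed subannuli of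
`D_u` that are uniformly inside, `‖φ_{u,t}(z) - z‖` is dominated by `∫_u^t k`, for `t` close to
`u`. The constant depends on the subannulus but not on `u`, which makes `C * k` a bound for the
vector field. -/
structure IsControl (d : ℝ≥0∞) (r : ℝ → ℝ) (φ : ℝ → ℝ → ℂ → ℂ) (T : ℝ) (k : ℝ → ℝ) : Prop where
  nonneg : ∀ ξ ∈ Icc 0 T, 0 ≤ k ξ
  memLp : MemLp k d (volume.restrict (Icc 0 T))
  bound : ∀ R ε : ℝ, R < 1 → 0 < ε → ∃ C, 0 ≤ C ∧ ∀ u ∈ Ico 0 T, ∃ δ > 0, ∀ t, u ≤ t → t < u + δ →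
    t ≤ T → ∀ z, r u + ε ≤ ‖z‖ → ‖z‖ ≤ R → ‖φ u t z - z‖ ≤ C * ∫ ξ in u..t, k ξ

theorem IsControl.intervalIntegrable {d : ℝ≥0∞} {r : ℝ → ℝ} {φ : ℝ → ℝ → ℂ → ℂ} {T : ℝ}
    {k : ℝ → ℝ} (hd : 1 ≤ d) (hT : 0 ≤ T) (h : IsControl d r φ T k) :
    IntervalIntegrable k volume 0 T := by
  rw [intervalIntegrable_iff_integrableOn_Icc_of_le hT]
  exact h.memLp.integrable hd

theorem mul_log_div_le {a b : ℝ} (ha : 0 ≤ a) (hb : b ≤ a) (hab : 0 < a → a / 2 < b) :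
    a * Real.log (a / b) ≤ 2 * (a - b) := by
  rcases ha.eq_or_lt with rfl | ha
  · simp only [zero_mul]
    linarith
  have hb0 : 0 < b := (half_pos ha).trans (hab ha)
  have h1 : Real.log (a / b) ≤ a / b - 1 := Real.log_le_sub_one_of_pos (by positivity)
  have h2 : a / b - 1 = (a - b) / b := by field_simp
  calc a * Real.log (a / b) ≤ a * ((a - b) / b) := by rw [← h2]; gcongr
    _ = (a / b) * (a - b) := by ring
    _ ≤ 2 * (a - b) := by
      have : a / b ≤ 2 := by rw [div_le_iff₀ hb0]; linarith [hab ha]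
      exact mul_le_mul_of_nonneg_right this (by linarith)

/-- Every evolution family has a control on `[0,T]`: the sum of the coefficients of finitely many
trajectories, started from points of a circle at time `0`, and of the rate of change of the inner
radius. -/
theorem IsEvolutionFamily.exists_control {d : ℝ≥0∞} {r : ℝ → ℝ} {φ : ℝ → ℝ → ℂ → ℂ} (hd : 1 ≤ d)
    (hr : IsCanonicalDomainSystem d r) (hφ : IsEvolutionFamily d r φ) {T : ℝ} (hT : 0 ≤ T) :
    ∃ k, IsControl d r φ T k := by
  have hr0 := hr.mem_Ico 0 le_rfl
  set ρ := (r 0 + 1) / 2 with hρ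
  have hρ0 : r 0 < ρ := by linarith [hr0.2]
  have hρ1 : ρ < 1 := by linarith [hr0.2]
  have hρpos : 0 < ρ := hr0.1.trans_lt hρ0
  have hsphere : ∀ z : ℂ, ‖z‖ = ρ → ∀ t, 0 ≤ t → z ∈ annulus (r t) := fun z hz t ht =>
    hr.annulus_subset le_rfl ht ⟨by rw [hz]; exact hρ0, by rw [hz]; exact hρ1⟩
  obtain ⟨N, hN⟩ := exists_displacement_bound hr0.1 hρ0 hρ1
  have hp : ∀ j, ∃ k : ℝ → ℝ, (∀ ξ ∈ Icc 0 T, 0 ≤ k ξ) ∧ MemLp k d (volume.restrict (Icc 0 T)) ∧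
      ∀ s u t, 0 ≤ s → s ≤ u → u ≤ t → t ≤ T →
        ‖φ s u (circlePoint ρ N j) - φ s t (circlePoint ρ N j)‖ ≤ ∫ ξ in u..t, k ξ := fun j =>
    hφ.ef3 0 T le_rfl hT _ (hsphere _ (norm_circlePoint hρpos N j) 0 le_rfl)
  choose κ hκ0 hκm hκ using hp
  obtain ⟨l, hl0, hlm, hl⟩ := hr.exists_sub_le_integral hT
  have hl := hl hd
  have hint : ∀ k : ℝ → ℝ, MemLp k d (volume.restrict (Icc 0 T)) → ∀ u t, 0 ≤ u → u ≤ t → t ≤ T →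
      IntervalIntegrable k volume u t := by
    intro k hk u t hu hut ht
    refine intervalIntegrable_of_mem_Icc hT ?_ ⟨hu, hut.trans ht⟩ ⟨hu.trans hut, ht⟩
    rw [intervalIntegrable_iff_integrableOn_Icc_of_le hT]
    exact hk.integrable hd
  have hsm : MemLp (fun ξ => ∑ j ∈ Finset.range N, κ j ξ) d (volume.restrict (Icc 0 T)) :=
    memLp_finsetSum _ fun j _ => hκm j
  refine ⟨fun ξ => (∑ j ∈ Finset.range N, κ j ξ) + 2 * l ξ, ?_, ?_, ?_⟩
  · intro ξ hξ
    have := Finset.sum_nonneg fun j (_ : j ∈ Finset.range N) => hκ0 j ξ hξ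
    linarith [hl0 ξ]
  · exact hsm.add (hlm.const_mul 2)
  intro R ε hR hε
  obtain ⟨C, hC0, hC⟩ := hN R ε hR hε
  refine ⟨C, hC0, fun u hu => ?_⟩
  have hev1 : ∀ᶠ t in 𝓝[Ici u] u, r u - r t < ρ / 2 ∧ (0 < r u → r u / 2 < r t) := by
    have hc : Tendsto r (𝓝[Ici u] u) (𝓝 (r u)) :=
      (hr.continuousOn u hu.1).mono (Ici_subset_Ici.2 hu.1)
    refine (hc.eventually (lt_mem_nhds (show r u - ρ / 2 < r u by linarith))).mp ?_
    by_cases h0 : 0 < r u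
    · filter_upwards [hc.eventually (lt_mem_nhds (show r u / 2 < r u by linarith))] with t h1 h2
      exact ⟨by linarith, fun _ => h1⟩
    · exact Eventually.of_forall fun t h2 => ⟨by linarith, fun h => absurd h h0⟩
  have hev2 : ∀ᶠ t in 𝓝[>] u, ∀ z ∈ Metric.sphere (0 : ℂ) ρ, dist (id z) (φ u t z) < ρ / 2 := by
    have h1 := (tendstoLocallyUniformlyOn_iff_forall_isCompact (isOpen_annulus (r u))).1
      (hφ.tendstoLocallyUniformlyOn_id hd hu.1) (Metric.sphere (0 : ℂ) ρ)
      (fun z hz => hsphere z (by simpa using hz) u hu.1) (isCompact_sphere _ _)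
    exact Metric.tendstoUniformlyOn_iff.1 h1 _ (by positivity)
  have hev : ∀ᶠ t in 𝓝[Ici u] u, (r u - r t < ρ / 2 ∧ (0 < r u → r u / 2 < r t)) ∧
      ∀ z ∈ Metric.sphere (0 : ℂ) ρ, dist (id z) (φ u t z) < ρ / 2 := by
    refine hev1.and ?_
    rw [← Ioi_insert, nhdsWithin_insert, eventually_sup]
    refine ⟨?_, hev2⟩
    rw [eventually_pure]
    intro z hz
    rw [hφ.ef1 u hu.1 z (hsphere z (by simpa using hz) u hu.1)]
    simpa using hρpos
  obtain ⟨δ, hδ, hball⟩ := Metric.mem_nhdsWithin_iff.1 hev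
  refine ⟨δ, hδ, fun t hut htd htT z hz1 hz2 => ?_⟩
  obtain ⟨⟨-, hhalf⟩, hsph⟩ := hball (show t ∈ Metric.ball u δ ∩ Ici u from
    ⟨by rw [Metric.mem_ball, Real.dist_eq, abs_of_nonneg (by linarith)]; linarith, hut⟩)
  have ht0 := hu.1.trans hut
  have hanti : r t ≤ r u := hr.antitoneOn hu.1 ht0 hut
  -- at the chosen points the displacement is bounded by the integrals of their coefficients
  have hκu : ∀ j < N, ‖φ u t (circlePoint ρ N j) - circlePoint ρ N j‖
      ≤ ∑ j ∈ Finset.range N, ∫ ξ in u..t, κ j ξ := by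
    intro j hj
    have h1 := hκ j u u t hu.1 le_rfl hut htT
    rw [hφ.ef1 u hu.1 _ (hsphere _ (norm_circlePoint hρpos N j) u hu.1)] at h1
    rw [norm_sub_rev]
    refine h1.trans (Finset.single_le_sum (f := fun j => ∫ ξ in u..t, κ j ξ) (fun i _ => ?_)
      (Finset.mem_range.2 hj))
    exact intervalIntegral.integral_nonneg hut fun ξ hξ =>
      hκ0 i ξ ⟨hu.1.trans hξ.1, hξ.2.trans htT⟩
  have hmain := hC (r u) (r t) _ (φ u t) (hr.nonneg hu.1) (hr.antitoneOn self_mem_Ici hu.1 hu.1)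
    (hr.nonneg ht0) hanti (fun h => (half_pos h).trans (hhalf h)) (hφ.holo u t hu.1 hut)
    (hφ.mapsTo u t hu.1 hut) (fun z hz => by
      have := hsph z (by simpa using hz)
      rw [dist_comm, dist_eq_norm] at this
      exact this.le) hκu z hz1 hz2
  refine hmain.trans (mul_le_mul_of_nonneg_left ?_ hC0)
  rw [intervalIntegral.integral_add, intervalIntegral.integral_finsetSum,
    intervalIntegral.integral_const_mul]
  · have := mul_log_div_le (hr.nonneg hu.1) hanti hhalf
    have := hl u t hu.1 hut htT
    linarith
  · exact fun j _ => hint _ (hκm j) u t hu.1 hut htT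
  · exact hint _ hsm u t hu.1 hut htT
  · exact (hint _ hlm u t hu.1 hut htT).const_mul 2

namespace IsControl

variable {d : ℝ≥0∞} {r : ℝ → ℝ} {φ : ℝ → ℝ → ℂ → ℂ} {T : ℝ} {k : ℝ → ℝ}

/-- The local control integrates to a bound for the increments of the trajectories, uniformly on
compact sets of initial points. -/
theorem exists_increment_bound (hd : 1 ≤ d) (hr : IsCanonicalDomainSystem d r)
    (hφ : IsEvolutionFamily d r φ) (hk : IsControl d r φ T k) {s : ℝ} (hs : 0 ≤ s) (hsT : s ≤ T)
    {K : Set ℂ} (hK : IsCompact K) (hKs : K ⊆ annulus (r s)) :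
    ∃ C, 0 ≤ C ∧ ∀ z ∈ K, ∀ u ∈ Icc s T, ∀ t ∈ Icc s T,
      ‖φ s t z - φ s u z‖ ≤ C * |∫ ξ in u..t, k ξ| := by
  have hT := hs.trans hsT
  have hki := hk.intervalIntegrable hd hT
  have hcomp : IsCompact (K ×ˢ Icc s T) := hK.prod isCompact_Icc
  have hsub : K ×ˢ Icc s T ⊆ annulus (r s) ×ˢ Ici s := prod_mono hKs Icc_subset_Ici_self
  obtain ⟨R, ε, hR, hε, h⟩ := exists_uniform_annulus hr hcomp (f := fun p => φ s p.2 p.1)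
    (τ := Prod.snd) ((hφ.continuousOn_uncurry hd hs).mono hsub) continuousOn_snd
    (fun p hp => ⟨hs.trans hp.2.1, hφ.mapsTo s p.2 hs hp.2.1 (hKs hp.1)⟩)
  obtain ⟨C, hC0, hC⟩ := hk.bound R ε hR hε
  refine ⟨C, hC0, fun z hz => ?_⟩
  have key : ∀ u t, s ≤ u → u ≤ t → t ≤ T → ‖φ s u z - φ s t z‖ ≤ C * ∫ ξ in u..t, k ξ := by
    intro u t hsu hut htT
    rw [← intervalIntegral.integral_const_mul]
    have hsub' : Icc u t ⊆ Ici s := fun x hx => hsu.trans hx.1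
    refine norm_sub_le_integral_of_local_right (x := fun t => φ s t z)
      ((intervalIntegrable_of_mem_Icc hT hki ⟨hs.trans hsu, hut.trans htT⟩
        ⟨hs.trans (hsu.trans hut), htT⟩).const_mul C)
      ((hφ.continuousOn_time hd hs (hKs hz)).mono hsub') ?_ hut
    intro v hv
    have hsv := hsu.trans hv.1
    obtain ⟨δ, hδ, hb⟩ := hC v ⟨hs.trans hsv, hv.2.trans_le htT⟩
    refine ⟨δ, hδ, fun x hx hvx hxd => ?_⟩
    rw [intervalIntegral.integral_const_mul, norm_sub_rev,
      hφ.ef2 s v x hs hsv hvx z (hKs hz)]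
    have h1 := h (z, v) ⟨hz, hsv, hv.2.le.trans htT⟩
    exact hb x hvx hxd (hx.2.trans htT) _ h1.1 h1.2
  intro u hu t ht
  rcases le_total u t with hut | hut
  · rw [norm_sub_rev]
    exact (key u t hu.1 hut ht.2).trans (mul_le_mul_of_nonneg_left (le_abs_self _) hC0)
  · rw [intervalIntegral.integral_symm, abs_neg]
    exact (key t u ht.1 hut hu.2).trans (mul_le_mul_of_nonneg_left (le_abs_self _) hC0)

end IsControl

/-! ### The vector field of an evolution family -/

section

variable {d : ℝ≥0∞} {r : ℝ → ℝ} {φ : ℝ → ℝ → ℂ → ℂ}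

theorem IsEvolutionFamily.isLocallyACHol (hd : 1 ≤ d) (hr : IsCanonicalDomainSystem d r)
    (hφ : IsEvolutionFamily d r φ) {s : ℝ} (hs : 0 ≤ s) :
    IsLocallyACHol (annulus (r s)) (Ici s) (φ s) := by
  refine ⟨fun t ht => hφ.holo s t hs ht, fun α β hαβ hsub ε hε K hK hKs => ?_⟩
  have hsα : s ≤ α := hsub (left_mem_Icc.2 hαβ)
  have hsβ : s ≤ β := hsα.trans hαβ
  obtain ⟨k, hk⟩ := hφ.exists_control hd hr (hs.trans hsβ)
  obtain ⟨C, hC0, hC⟩ := hk.exists_increment_bound hd hr hφ hs hsβ hK hKs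
  have hki : IntervalIntegrable k volume α β :=
    intervalIntegrable_of_mem_Icc (hs.trans hsβ) (hk.intervalIntegrable hd (hs.trans hsβ))
      ⟨hs.trans hsα, hαβ⟩ ⟨hs.trans hsβ, le_rfl⟩
  have hac := (hki.absolutelyContinuousOnInterval_intervalIntegral (c := α) left_mem_uIcc).const_mul C
  obtain ⟨δ, hδ, h⟩ := (absolutelyContinuousOnInterval_iff _ _ _).1 hac ε hε
  refine ⟨δ, hδ, fun n a b hab hdisj hsum => ?_⟩
  -- extension of the finite family by degenerate intervals
  set I : ℕ → ℝ × ℝ := fun i => if hi : i < n then (a ⟨i, hi⟩, b ⟨i, hi⟩) else (α, α) with hI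
  have hIj : ∀ j : Fin n, I j = (a j, b j) := fun j => by simp [hI]
  have hmem : ((n, I) : ℕ × (ℕ → ℝ × ℝ)) ∈ AbsolutelyContinuousOnInterval.disjWithin α β := by
    constructor
    · intro i hi
      have hi := Finset.mem_range.1 hi
      rw [uIcc_of_le hαβ]
      have := hab ⟨i, hi⟩
      simp only [hI, hi, dif_pos]
      exact ⟨this.1, this.2.1⟩
    · intro i hi j hj hij
      have hi := Finset.mem_range.1 (Finset.mem_coe.1 hi)
      have hj := Finset.mem_range.1 (Finset.mem_coe.1 hj)
      have h1 := hdisj ⟨i, hi⟩ ⟨j, hj⟩ (by simpa using hij)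
      simp only [Function.onFun, hI, hi, hj, dif_pos]
      rw [uIoc_of_le (hab _).2.2, uIoc_of_le (hab _).2.2, Ioc_disjoint_Ioc]
      rwa [Ioo_disjoint_Ioo] at h1
  have h1 := h (n, I) hmem
  simp only [Finset.sum_range, hIj] at h1
  refine lt_of_le_of_lt (Finset.sum_le_sum fun j _ => ?_) (h1 ?_)
  · have hint : ∀ t ∈ Icc α β, IntervalIntegrable k volume α t := fun t ht =>
      intervalIntegrable_of_mem_Icc hαβ hki ⟨le_rfl, hαβ⟩ ht
    have hle : ∀ z ∈ K, ‖φ s (b j) z - φ s (a j) z‖ ≤ C * |∫ ξ in a j..b j, k ξ| := fun z hz =>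
      hC z hz _ ⟨hsα.trans (hab j).1.1, (hab j).1.2⟩ _ ⟨hsα.trans (hab j).2.1.1, (hab j).2.1.2⟩
    rw [dist_comm, Real.dist_eq, ← mul_sub, abs_mul, abs_of_nonneg hC0,
      intervalIntegral.integral_interval_sub_left (hint _ (hab j).2.1) (hint _ (hab j).1)]
    refine Real.sSup_le ?_ (by positivity)
    rintro _ ⟨z, hz, rfl⟩
    exact hle z hz
  · refine lt_of_le_of_lt (le_of_eq (Finset.sum_congr rfl fun j _ => ?_)) hsum
    rw [dist_comm, Real.dist_eq, abs_of_nonneg (sub_nonneg.2 (hab j).2.2)]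

/-- The times `t > 0` at which the evolution family is differentiated: the primitives of the
controls `k n` on `[0,n]` and countably many trajectories, which fill a dense set, are
differentiable at `t`. -/
structure IsRegularTime (r : ℝ → ℝ) (φ : ℝ → ℝ → ℂ → ℂ) (k : ℕ → ℝ → ℝ) (t : ℝ) : Prop where
  pos : 0 < t
  hasDerivAt : ∀ n : ℕ, t < n → HasDerivAt (fun x => ∫ ξ in (0 : ℝ)..x, k n ξ) (k n t) t
  differentiableAt : ∀ σ : ℚ, (0 : ℝ) ≤ σ → (σ : ℝ) < t → ∀ m : ℕ,
    TopologicalSpace.denseSeq ℂ m ∈ annulus (r σ) →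
    DifferentiableAt ℝ (fun τ => φ σ τ (TopologicalSpace.denseSeq ℂ m)) t

theorem IsEvolutionFamily.ae_isRegularTime (hd : 1 ≤ d) (hφ : IsEvolutionFamily d r φ)
    {k : ℕ → ℝ → ℝ} (hk : ∀ n : ℕ, IsControl d r φ n (k n)) :
    ∀ᵐ t, 0 < t → IsRegularTime r φ k t := by
  have h1 : ∀ n : ℕ, ∀ᵐ t : ℝ, t ∈ Icc (0 : ℝ) n →
      HasDerivAt (fun x => ∫ ξ in (0 : ℝ)..x, k n ξ) (k n t) t := by
    intro n
    have hn : (0 : ℝ) ≤ n := n.cast_nonneg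
    filter_upwards [((hk n).intervalIntegrable hd hn).ae_hasDerivAt_integral] with t ht hmem
    rw [uIcc_of_le hn] at ht
    exact ht hmem 0 ⟨le_rfl, hn⟩
  have h2 : ∀ (σ : ℚ) (m n : ℕ), ∀ᵐ t : ℝ, (0 : ℝ) ≤ σ → t ∈ Icc (σ : ℝ) n →
      TopologicalSpace.denseSeq ℂ m ∈ annulus (r σ) →
      DifferentiableAt ℝ (fun τ => φ σ τ (TopologicalSpace.denseSeq ℂ m)) t := by
    intro σ m n
    by_cases h : (0 : ℝ) ≤ σ ∧ (σ : ℝ) ≤ n ∧ TopologicalSpace.denseSeq ℂ m ∈ annulus (r σ)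
    · have hac := hφ.absolutelyContinuousOnInterval hd h.1 le_rfl h.2.1 h.2.2
      filter_upwards [hac.boundedVariationOn.ae_differentiableAt_of_mem_uIcc] with t ht _ hmem _
      rw [uIcc_of_le h.2.1] at ht
      exact ht hmem
    · exact Eventually.of_forall fun t h0 hmem hm => absurd ⟨h0, hmem.1.trans hmem.2, hm⟩ h
  filter_upwards [ae_all_iff.2 h1, ae_all_iff.2 fun σ => ae_all_iff.2 fun m =>
    ae_all_iff.2 (h2 σ m)] with t ht1 ht2 hpos
  obtain ⟨N, hN⟩ := exists_nat_gt t
  exact ⟨hpos, fun n hn => ht1 n ⟨hpos.le, hn.le⟩,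
    fun σ hσ hσt m hm => ht2 σ m N hσ ⟨hσt.le, hN.le⟩ hm⟩

namespace IsRegularTime

variable {k : ℕ → ℝ → ℝ} {t : ℝ}

theorem eventually_abs_integral_le (hd : 1 ≤ d) (hk : ∀ n : ℕ, IsControl d r φ n (k n))
    (ht : IsRegularTime r φ k t) {n : ℕ} (hn : t < n) :
    ∀ᶠ τ in 𝓝[≠] t, |∫ ξ in t..τ, k n ξ| ≤ (k n t + 1) * |τ - t| := by
  have hn0 : (0 : ℝ) ≤ n := n.cast_nonneg
  have hki := (hk n).intervalIntegrable hd hn0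
  have h1 := (hasDerivAt_iff_tendsto_slope.1 (ht.hasDerivAt n hn)).abs
  have hkt : 0 ≤ k n t := (hk n).nonneg t ⟨ht.pos.le, hn.le⟩
  rw [abs_of_nonneg hkt] at h1
  filter_upwards [h1.eventually (gt_mem_nhds (lt_add_one _)), self_mem_nhdsWithin,
    mem_nhdsWithin_of_mem_nhds (Ioo_mem_nhds ht.pos hn)] with τ h2 hne hτ
  have hpos : 0 < |τ - t| := abs_pos.2 (sub_ne_zero.2 hne)
  rw [slope_def_field, intervalIntegral.integral_interval_sub_left
    (intervalIntegrable_of_mem_Icc hn0 hki ⟨le_rfl, hn0⟩ ⟨hτ.1.le, hτ.2.le⟩)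
    (intervalIntegrable_of_mem_Icc hn0 hki ⟨le_rfl, hn0⟩ ⟨ht.pos.le, hn.le⟩), abs_div,
    div_lt_iff₀ hpos] at h2
  exact h2.le

/-- At a regular time, differentiability of a dense set of trajectories gives differentiability of
the evolution family locally uniformly in the starting point. -/
theorem exists_hasHolDeriv_of_dense (hd : 1 ≤ d) (hr : IsCanonicalDomainSystem d r)
    (hφ : IsEvolutionFamily d r φ) (hk : ∀ n : ℕ, IsControl d r φ n (k n))
    (ht : IsRegularTime r φ k t) {s : ℝ} (hs : 0 ≤ s) (hst : s ≤ t) {A : Set ℂ}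
    (hA : annulus (r s) ⊆ closure A)
    (h : ∀ z ∈ A, z ∈ annulus (r s) → DifferentiableWithinAt ℝ (fun τ => φ s τ z) (Ici s) t) :
    ∃ g, HasHolDeriv (annulus (r s)) (Ici s) (φ s) g t := by
  have hne : (𝓝[Ici s \ {t}] t).NeBot :=
    NeBot.mono (inferInstance : (𝓝[>] t).NeBot) (nhdsWithin_mono _ fun x (hx : t < x) =>
      ⟨hst.trans hx.le, hx.ne'⟩)
  have hle : 𝓝[Ici s \ {t}] t ≤ 𝓝[≠] t := nhdsWithin_mono _ fun x hx => hx.2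
  obtain ⟨n, hn⟩ := exists_nat_gt t
  obtain ⟨g, hg1, hg2⟩ := exists_tendstoLocallyUniformlyOn_of_dense (F := 𝓝[Ici s \ {t}] t)
    (q := fun τ z => (φ s τ z - φ s t z) / ((τ - t : ℝ) : ℂ)) (isOpen_annulus (r s))
    (by
      filter_upwards [self_mem_nhdsWithin] with τ hτ
      exact ((hφ.holo s τ hs hτ.1).sub (hφ.holo s t hs hst)).div_const _)
    (fun K hKs hK => by
      obtain ⟨C, hC0, hC⟩ := (hk n).exists_increment_bound hd hr hφ hs (hst.trans hn.le) hK hKs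
      refine ⟨C * (k n t + 1), ?_⟩
      filter_upwards [self_mem_nhdsWithin, hle (ht.eventually_abs_integral_le hd hk hn),
        mem_nhdsWithin_of_mem_nhds (Iio_mem_nhds hn)] with τ hτ hτ2 hτn z hz
      have hpos : 0 < |τ - t| := abs_pos.2 (sub_ne_zero.2 hτ.2)
      rw [norm_div, Complex.norm_real, Real.norm_eq_abs, div_le_iff₀ hpos, mul_assoc]
      refine (hC z hz t ⟨hst, hn.le⟩ τ ⟨hτ.1, le_of_lt hτn⟩).trans ?_
      exact mul_le_mul_of_nonneg_left hτ2 hC0)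
    hA (fun z hzA hz => by
      have h1 := (hasDerivWithinAt_iff_tendsto_slope.1 (h z hzA hz).hasDerivWithinAt)
      refine ⟨_, h1.congr fun τ => ?_⟩
      rw [slope_def_module, Complex.real_smul, Complex.ofReal_inv, div_eq_inv_mul])
  refine ⟨g, hg1, fun K hK hKs => ?_⟩
  exact (tendstoLocallyUniformlyOn_iff_forall_isCompact (isOpen_annulus _)).1 hg2 K hKs hK

end IsRegularTime

theorem HasHolDeriv.hasDerivWithinAt {U : Set ℂ} {I : Set ℝ} {ψ : ℝ → ℂ → ℂ} {g : ℂ → ℂ} {t : ℝ}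
    (h : HasHolDeriv U I ψ g t) {z : ℂ} (hz : z ∈ U) :
    HasDerivWithinAt (fun τ => ψ τ z) (g z) I t := by
  rw [hasDerivWithinAt_iff_tendsto_slope]
  have h1 := (h.2 {z} isCompact_singleton (singleton_subset_iff.2 hz)).tendsto_at rfl
  refine h1.congr fun τ => ?_
  rw [slope_def_module, Complex.real_smul, Complex.ofReal_inv, div_eq_inv_mul]

theorem HasHolDeriv.congr {U : Set ℂ} {I : Set ℝ} {ψ : ℝ → ℂ → ℂ} {g g' : ℂ → ℂ} {t : ℝ}
    (h : HasHolDeriv U I ψ g t) (hg : EqOn g' g U) : HasHolDeriv U I ψ g' t :=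
  ⟨h.1.congr hg, fun K hK hKU => (h.2 K hK hKU).congr_right fun _ hz => (hg (hKU hz)).symm⟩

namespace IsRegularTime

variable {k : ℕ → ℝ → ℝ} {t : ℝ}

/-- The points reached at time `t` by the countable family of trajectories are dense in `D_t`. -/
theorem subset_closure_reached (hd : 1 ≤ d) (hr : IsCanonicalDomainSystem d r)
    (hφ : IsEvolutionFamily d r φ) (ht : 0 < t) :
    annulus (r t) ⊆ closure {p | ∃ (σ : ℚ) (m : ℕ), (0 : ℝ) ≤ σ ∧ (σ : ℝ) < t ∧
      TopologicalSpace.denseSeq ℂ m ∈ annulus (r σ) ∧ φ σ t (TopologicalSpace.denseSeq ℂ m) = p} := by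
  intro z hz
  rw [Metric.mem_closure_iff]
  intro ε hε
  obtain ⟨S, hS0, hSt, hzS⟩ : ∃ S, 0 ≤ S ∧ S < t ∧ z ∈ annulus (r S) := by
    have hc : Tendsto r (𝓝[Ico 0 t] t) (𝓝 (r t)) :=
      (hr.continuousOn t ht.le).mono Ico_subset_Ici_self
    have hne : (𝓝[Ico 0 t] t).NeBot := by
      rw [nhdsWithin_Ico_eq_nhdsLT ht]; infer_instance
    obtain ⟨S, h1, h2⟩ := ((hc.eventually (gt_mem_nhds hz.1)).and self_mem_nhdsWithin).exists
    exact ⟨S, h2.1, h2.2, h1, hz.2⟩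
  have h1 := Metric.tendsto_nhds.1 (hφ.tendsto_start_left hd hr hS0 hSt hzS) (ε / 2) (by positivity)
  obtain ⟨a, ha, hsub⟩ := (mem_nhdsLT_iff_exists_Ioo_subset' hSt).1 h1
  obtain ⟨σ, hσ1, hσ2⟩ := exists_rat_btwn (max_lt ha hSt)
  have hσS : S < σ := (le_max_right _ _).trans_lt hσ1
  have hσ0 : (0 : ℝ) ≤ σ := hS0.trans hσS.le
  have h2 : dist (φ σ t z) z < ε / 2 := hsub ⟨(le_max_left _ _).trans_lt hσ1, hσ2⟩
  have hzσ := hr.annulus_subset hS0 hσS.le hzS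
  have hopen := (isOpen_annulus (r σ)).mem_nhds hzσ
  have hcont := ((hφ.holo σ t hσ0 hσ2.le).differentiableAt hopen).continuousAt
  have h3 : {q | q ∈ annulus (r σ) ∧ dist (φ σ t q) (φ σ t z) < ε / 2} ∈ 𝓝 z :=
    inter_mem hopen (Metric.tendsto_nhds.1 hcont (ε / 2) (by positivity))
  obtain ⟨_, ⟨m, rfl⟩, hq⟩ := (TopologicalSpace.denseRange_denseSeq ℂ).inter_nhds_nonempty h3
  refine ⟨_, ⟨σ, m, hσ0, hσ2, hq.1, rfl⟩, ?_⟩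
  rw [dist_comm]
  linarith [dist_triangle (φ σ t (TopologicalSpace.denseSeq ℂ m)) (φ σ t z) z, hq.2]

/-- For `s = t` the trajectories through a dense set of points are continuations of those started at
rational times; for `s < t` the claim is first proved for rational starting times, and then follows
from the composition law for all points. -/
theorem exists_hasHolDeriv (hd : 1 ≤ d) (hr : IsCanonicalDomainSystem d r)
    (hφ : IsEvolutionFamily d r φ) (hk : ∀ n : ℕ, IsControl d r φ n (k n))
    (ht : IsRegularTime r φ k t) {s : ℝ} (hs : 0 ≤ s) (hst : s ≤ t) :
    ∃ g, HasHolDeriv (annulus (r s)) (Ici s) (φ s) g t := by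
  rcases hst.eq_or_lt with rfl | hst
  · refine ht.exists_hasHolDeriv_of_dense hd hr hφ hk hs le_rfl
      (subset_closure_reached hd hr hφ ht.pos) ?_
    rintro _ ⟨σ, m, hσ, hσt, hm, rfl⟩ -
    refine ((ht.differentiableAt σ hσ hσt m hm).differentiableWithinAt (s := Ici s)).congr ?_ ?_
    · intro τ hτ
      exact (hφ.ef2 σ s τ hσ hσt.le hτ _ hm).symm
    · exact (hφ.ef2 σ s s hσ hσt.le le_rfl _ hm).symm
  obtain ⟨σ, hσ1, hσ2⟩ := exists_rat_btwn hst
  have hσ0 : (0 : ℝ) ≤ σ := hs.trans hσ1.le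
  obtain ⟨g, hg⟩ := ht.exists_hasHolDeriv_of_dense hd hr hφ hk hσ0 hσ2.le
    (A := range (TopologicalSpace.denseSeq ℂ))
    (by rw [(TopologicalSpace.denseRange_denseSeq ℂ).closure_range]; exact subset_univ _) (by
      rintro _ ⟨m, rfl⟩ hm
      exact (ht.differentiableAt σ hσ0 hσ2 m hm).differentiableWithinAt)
  refine ht.exists_hasHolDeriv_of_dense hd hr hφ hk hs hst.le (A := univ) (by simp) fun z _ hz => ?_
  have hσn : Ici (σ : ℝ) ∈ 𝓝 t := Ici_mem_nhds hσ2
  have h1 := (hg.hasDerivWithinAt (hφ.mapsTo s σ hs hσ1.le hz)).hasDerivAt hσn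
  refine (h1.congr_of_eventuallyEq ?_).differentiableAt.differentiableWithinAt
  filter_upwards [hσn] with τ hτ
  exact hφ.ef2 s σ τ hs hσ1.le hτ z hz

end IsRegularTime

/-- The infinitesimal generator of an evolution family: the right derivative of `τ ↦ φ_{t,τ}(z)` at
`τ = t`, set to `0` at the times `t` that are not regular. -/
noncomputable def generator (r : ℝ → ℝ) (φ : ℝ → ℝ → ℂ → ℂ) (k : ℕ → ℝ → ℝ) (z : ℂ) (t : ℝ) : ℂ :=
  {t | IsRegularTime r φ k t}.indicator (fun t => derivWithin (fun τ => φ t τ z) (Ici t) t) t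

/-- The evolution family satisfies the differential equation at regular times. The two sides are
identified through their right derivatives, as `φ s τ = φ t τ ∘ φ s t` for `τ ≥ t`. -/
theorem IsRegularTime.hasHolDeriv_generator {k : ℕ → ℝ → ℝ} {t : ℝ} (hd : 1 ≤ d)
    (hr : IsCanonicalDomainSystem d r)
    (hφ : IsEvolutionFamily d r φ) (hk : ∀ n : ℕ, IsControl d r φ n (k n))
    (ht : IsRegularTime r φ k t) {s : ℝ} (hs : 0 ≤ s) (hst : s ≤ t) :
    HasHolDeriv (annulus (r s)) (Ici s) (φ s) (fun z => generator r φ k (φ s t z) t) t := by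
  obtain ⟨g, hg⟩ := ht.exists_hasHolDeriv hd hr hφ hk hs hst
  obtain ⟨g₀, hg₀⟩ := ht.exists_hasHolDeriv hd hr hφ hk ht.pos.le le_rfl
  refine hg.congr fun z hz => ?_
  have hw := hφ.mapsTo s t hs hst hz
  have h1 := (hg.hasDerivWithinAt hz).mono (Ici_subset_Ici.2 hst)
  have h2 : HasDerivWithinAt (fun τ => φ s τ z) (g₀ (φ s t z)) (Ici t) t := by
    refine (hg₀.hasDerivWithinAt hw).congr (fun τ hτ => hφ.ef2 s t τ hs hst hτ z hz) ?_
    exact hφ.ef2 s t t hs hst le_rfl z hz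
  have hu := uniqueDiffOn_Ici t t self_mem_Ici
  rw [generator, indicator_of_mem (show t ∈ {t | IsRegularTime r φ k t} from ht),
    (hg₀.hasDerivWithinAt hw).derivWithin hu, ← h1.derivWithin hu, ← h2.derivWithin hu]

theorem IsRegularTime.hasDerivWithinAt_generator {k : ℕ → ℝ → ℝ} {t : ℝ} (hd : 1 ≤ d)
    (hr : IsCanonicalDomainSystem d r)
    (hφ : IsEvolutionFamily d r φ) (hk : ∀ n : ℕ, IsControl d r φ n (k n))
    (ht : IsRegularTime r φ k t) {z : ℂ} (hz : z ∈ annulus (r t)) :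
    HasDerivWithinAt (fun τ => φ t τ z) (generator r φ k z t) (Ici t) t := by
  have h := (ht.hasHolDeriv_generator hd hr hφ hk ht.pos.le le_rfl).hasDerivWithinAt hz
  rwa [hφ.ef1 t ht.pos.le z hz] at h

theorem differentiableOn_generator {k : ℕ → ℝ → ℝ} (hd : 1 ≤ d) (hr : IsCanonicalDomainSystem d r)
    (hφ : IsEvolutionFamily d r φ) (hk : ∀ n : ℕ, IsControl d r φ n (k n)) (t : ℝ) :
    DifferentiableOn ℂ (fun z => generator r φ k z t) {z | (z, t) ∈ spaceTime r} := by
  by_cases ht : IsRegularTime r φ k t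
  · refine (ht.hasHolDeriv_generator hd hr hφ hk ht.pos.le le_rfl).1.congr_mono
      (fun z hz => ?_) (fun z hz => hz.2)
    rw [hφ.ef1 t ht.pos.le z hz.2]
  · have : (fun z => generator r φ k z t) = fun _ => 0 := by
      funext z
      exact indicator_of_notMem (s := {t | IsRegularTime r φ k t}) ht _
    rw [this]
    exact differentiableOn_const 0

/-- The generator is an almost everywhere limit of difference quotients of
`h ↦ φ t (t + h) z`, which are continuous in `t`. -/
theorem aemeasurable_generator {k : ℕ → ℝ → ℝ} (hd : 1 ≤ d) (hr : IsCanonicalDomainSystem d r)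
    (hφ : IsEvolutionFamily d r φ) (hk : ∀ n : ℕ, IsControl d r φ n (k n)) (z : ℂ) :
    AEMeasurable (fun t => generator r φ k z t) (volume.restrict {t | (z, t) ∈ spaceTime r}) := by
  set A : Set ℝ := {t | (z, t) ∈ spaceTime r} with hA
  have hup : ∀ S ∈ A, ∀ t, S ≤ t → t ∈ A := fun S hS t ht =>
    ⟨le_trans hS.1 ht, hr.annulus_subset hS.1 ht hS.2⟩
  have hord : A.OrdConnected := ⟨fun x hx y _ t ht => hup x hx t ht.1⟩
  have hmeas : MeasurableSet A := hord.measurableSet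
  have hcont : ∀ h, 0 ≤ h → ContinuousOn (fun t => φ t (t + h) z) A := by
    intro h hh t₀ ht₀
    obtain ⟨S, hS, hS'⟩ : ∃ S ∈ A, Ici S ∈ 𝓝[A] t₀ := by
      by_cases hmin : ∃ S ∈ A, S < t₀
      · obtain ⟨S, hS, hlt⟩ := hmin
        exact ⟨S, hS, mem_nhdsWithin_of_mem_nhds (Ici_mem_nhds hlt)⟩
      · push Not at hmin
        exact ⟨t₀, ht₀, mem_of_superset self_mem_nhdsWithin hmin⟩
    have := hφ.continuousOn_start hd hr hS.1 hh hS.2 t₀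
      (mem_of_mem_nhdsWithin ht₀ hS')
    exact this.mono_of_mem_nhdsWithin hS'
  refine aemeasurable_of_tendsto_metrizable_ae atTop
    (f := fun (n : ℕ) t => (φ t (t + ((n : ℝ) + 1)⁻¹) z - z) / (((n : ℝ) + 1)⁻¹ : ℝ))
    (fun n => (((hcont _ (by positivity)).aemeasurable hmeas).sub_const z).div_const _) ?_
  rw [ae_restrict_iff' hmeas]
  have h0 : ∀ᵐ t : ℝ, t ≠ 0 := by simp [ae_iff, measure_singleton]
  filter_upwards [hφ.ae_isRegularTime hd hk, h0] with t ht ht0 htA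
  have hreg := ht (lt_of_le_of_ne htA.1 (Ne.symm ht0))
  have h1 := hasDerivWithinAt_iff_tendsto_slope.1 (hreg.hasDerivWithinAt_generator hd hr hφ hk htA.2)
  have h2 : Tendsto (fun n : ℕ => t + ((n : ℝ) + 1)⁻¹) atTop (𝓝[Ici t \ {t}] t) := by
    refine tendsto_nhdsWithin_iff.2 ⟨?_, Eventually.of_forall fun n => ?_⟩
    · simpa [one_div] using (tendsto_one_div_add_atTop_nhds_zero_nat (𝕜 := ℝ)).const_add t
    · have : (0 : ℝ) < ((n : ℝ) + 1)⁻¹ := by positivity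
      exact ⟨by simp only [mem_Ici]; linarith, by simp only [mem_singleton_iff]; linarith⟩
  refine (h1.comp h2).congr fun n => ?_
  rw [Function.comp_apply, slope_def_module, Complex.real_smul, hφ.ef1 t htA.1 z htA.2,
    add_sub_cancel_left, Complex.ofReal_inv, div_eq_inv_mul]

theorem isWeakHolVectorField_generator {k : ℕ → ℝ → ℝ} (hd : 1 ≤ d)
    (hr : IsCanonicalDomainSystem d r)
    (hφ : IsEvolutionFamily d r φ) (hk : ∀ n : ℕ, IsControl d r φ n (k n)) :
    IsWeakHolVectorField d (spaceTime r) (generator r φ k) where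
  meas := aemeasurable_generator hd hr hφ hk
  holo := differentiableOn_generator hd hr hφ hk
  bound K hK hKs := by
    obtain ⟨T, hT⟩ := (hK.image continuous_snd).bddAbove
    obtain ⟨n, hn⟩ := exists_nat_gt T
    have hsub : Prod.snd '' K ⊆ Icc 0 (n : ℝ) := by
      rintro _ ⟨p, hp, rfl⟩
      exact ⟨(hKs hp).1, (hT ⟨p, hp, rfl⟩).trans hn.le⟩
    obtain ⟨R, ε, hR, hε, h⟩ := exists_uniform_annulus hr hK continuousOn_fst continuousOn_snd
      (fun p hp => hKs hp)
    obtain ⟨C, hC0, hC⟩ := (hk n).bound R ε hR hε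
    refine ⟨fun t => C * k n t, fun t ht => mul_nonneg hC0 ((hk n).nonneg t (hsub ht)),
      ((hk n).memLp.const_mul C).mono_measure (Measure.restrict_mono hsub le_rfl), ?_⟩
    rintro ⟨z, t⟩ hp
    have htn : t < n := (hT ⟨_, hp, rfl⟩).trans_lt hn
    have hp0 := hKs hp
    by_cases ht : IsRegularTime r φ k t
    swap
    · rw [generator, indicator_of_notMem (s := {t | IsRegularTime r φ k t}) ht, norm_zero]
      exact mul_nonneg hC0 ((hk n).nonneg t (hsub ⟨_, hp, rfl⟩))
    have h1 := hasDerivWithinAt_iff_tendsto_slope.1 (ht.hasDerivWithinAt_generator hd hr hφ hk hp0.2)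
    have h2 := hasDerivWithinAt_iff_tendsto_slope.1 ((ht.hasDerivAt n htn).hasDerivWithinAt (s := Ici t))
    rw [Ici_sdiff_left] at h1 h2
    refine le_of_tendsto_of_tendsto h1.norm (h2.const_mul C) ?_
    obtain ⟨δ, hδ, hb⟩ := hC t ⟨ht.pos.le, htn⟩
    have hlt : t < min (t + δ) n := lt_min (by linarith) htn
    filter_upwards [Ioo_mem_nhdsGT hlt] with τ hτ
    have hτ1 := hτ.2.trans_le (min_le_left _ _)
    have hτ2 := hτ.2.trans_le (min_le_right _ _)
    have hn0 : (0 : ℝ) ≤ n := n.cast_nonneg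
    have hki := (hk n).intervalIntegrable hd hn0
    have hpos : 0 < τ - t := sub_pos.2 hτ.1
    have hτ0 : 0 ≤ τ := ht.pos.le.trans hτ.1.le
    rw [slope_def_module, slope_def_field, intervalIntegral.integral_interval_sub_left
      (intervalIntegrable_of_mem_Icc hn0 hki ⟨le_rfl, hn0⟩ ⟨hτ0, hτ2.le⟩)
      (intervalIntegrable_of_mem_Icc hn0 hki ⟨le_rfl, hn0⟩ ⟨ht.pos.le, htn.le⟩), norm_smul,
      hφ.ef1 t ht.pos.le z hp0.2, norm_inv, Real.norm_eq_abs, abs_of_pos hpos, ← mul_div_assoc,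
      ← div_eq_inv_mul]
    have h3 := h _ hp
    have := hb τ hτ.1.le hτ1 hτ2.le z h3.1 h3.2
    gcongr

theorem isSemicomplete_generator {k : ℕ → ℝ → ℝ} (hd : 1 ≤ d) (hr : IsCanonicalDomainSystem d r)
    (hφ : IsEvolutionFamily d r φ) (hk : ∀ n : ℕ, IsControl d r φ n (k n)) :
    IsSemicomplete (spaceTime r) (generator r φ k) := by
  rintro z s ⟨hs, hz⟩
  have hs : 0 ≤ s := hs
  refine ⟨fun t => φ s t z, isSolution_of_solvesOn ordConnected_Ici self_mem_Ici (hφ.ef1 s hs z hz)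
    (Ici_subset_Ici.2 hs) fun a ha b hb hab => ⟨?_, ?_, ?_⟩⟩
  · exact hφ.absolutelyContinuousOnInterval hd hs ha hab hz
  · intro t ht
    exact hφ.mapsTo s t hs (le_trans ha ht.1) hz
  · filter_upwards [hφ.ae_isRegularTime hd hk] with t ht hmem
    have hst : s < t := lt_of_le_of_lt ha hmem.1
    exact (((ht (hs.trans_lt hst)).hasHolDeriv_generator hd hr hφ hk hs hst.le).hasDerivWithinAt
      hz).hasDerivAt (Ici_mem_nhds hst)

/-- Two vector fields that correspond to the same evolution family agree at almost all times. -/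
theorem IsCorrespondingField.ae_eq (hφ : IsEvolutionFamily d r φ) {G G' : ℂ → ℝ → ℂ}
    (hG : IsCorrespondingField d r φ G) (hG' : IsCorrespondingField d r φ G') :
    ∀ᵐ t ∂(volume.restrict (Ici (0 : ℝ))), ∀ z ∈ annulus (r t), G z t = G' z t := by
  obtain ⟨-, -, N, -, hN, h⟩ := hG
  obtain ⟨-, -, N', -, hN', h'⟩ := hG'
  rw [ae_restrict_iff' measurableSet_Ici]
  filter_upwards [measure_eq_zero_iff_ae_notMem.1 hN, measure_eq_zero_iff_ae_notMem.1 hN'] with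
    t ht ht' ht0 z hz
  have h1 := ((h t ht0).2.2 t ⟨self_mem_Ici, ht⟩).hasDerivWithinAt hz
  have h2 := ((h' t ht0).2.2 t ⟨self_mem_Ici, ht'⟩).hasDerivWithinAt hz
  rw [hφ.ef1 t ht0 z hz] at h1 h2
  have hu := uniqueDiffOn_Ici t t self_mem_Ici
  rw [← h1.derivWithin hu, h2.derivWithin hu]

theorem IsEvolutionFamily.exists_isCorrespondingField (hd : 1 ≤ d)
    (hr : IsCanonicalDomainSystem d r) (hφ : IsEvolutionFamily d r φ) :
    ∃ G, IsCorrespondingField d r φ G := by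
  choose k hk using fun n : ℕ => hφ.exists_control hd hr (T := n) n.cast_nonneg
  refine ⟨generator r φ k, isWeakHolVectorField_generator hd hr hφ hk,
    isSemicomplete_generator hd hr hφ hk, {t | 0 ≤ t ∧ ¬ IsRegularTime r φ k t}, fun t ht => ht.1,
    ?_, fun s hs => ⟨hφ.isLocallyACHol hd hr hs, ?_, ?_⟩⟩
  · rw [measure_eq_zero_iff_ae_notMem]
    have h0 : ∀ᵐ t : ℝ, t ≠ 0 := by simp [ae_iff, measure_singleton]
    filter_upwards [hφ.ae_isRegularTime hd hk, h0] with t ht ht0 hmem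
    exact hmem.2 (ht (lt_of_le_of_ne hmem.1 (Ne.symm ht0)))
  · intro t ht
    have hreg : IsRegularTime r φ k t := by
      by_contra hc
      exact ht.2 ⟨hs.trans ht.1, hc⟩
    exact ⟨_, hreg.hasHolDeriv_generator hd hr hφ hk hs ht.1⟩
  · intro t ht
    have hreg : IsRegularTime r φ k t := by
      by_contra hc
      exact ht.2 ⟨hs.trans ht.1, hc⟩
    exact hreg.hasHolDeriv_generator hd hr hφ hk hs ht.1

end

end AnnulusLoewner

theorem theorem5p1 (d : ℝ≥0∞) (hd : 1 ≤ d) (r : ℝ → ℝ)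
    (hr : AnnulusLoewner.IsCanonicalDomainSystem d r) :
    -- (A) every evolution family has an essentially unique corresponding vector field
    (∀ φ : ℝ → ℝ → ℂ → ℂ, AnnulusLoewner.IsEvolutionFamily d r φ →
      ∃ G : ℂ → ℝ → ℂ, AnnulusLoewner.IsCorrespondingField d r φ G ∧
        ∀ G' : ℂ → ℝ → ℂ, AnnulusLoewner.IsCorrespondingField d r φ G' →
          ∀ᵐ t ∂(volume.restrict (Ici (0 : ℝ))),
            ∀ z ∈ AnnulusLoewner.annulus (r t), G z t = G' z t) ∧
    -- (B) the non-autonomous semiflow of a semicomplete field is an evolution family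
    (∀ G : ℂ → ℝ → ℂ,
      AnnulusLoewner.IsWeakHolVectorField d (AnnulusLoewner.spaceTime r) G →
      AnnulusLoewner.IsSemicomplete (AnnulusLoewner.spaceTime r) G →
      ∃ (J : ℝ → ℂ → Set ℝ) (w : ℝ → ℂ → ℝ → ℂ),
        (∀ s z, (z, s) ∈ AnnulusLoewner.spaceTime r →
          AnnulusLoewner.IsNonextendableSolution (AnnulusLoewner.spaceTime r) G s z
            (J s z) (w s z) ∧ Ici s ⊆ J s z) ∧
        AnnulusLoewner.IsEvolutionFamily d r (fun s t z => w s z t)) := by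
  refine ⟨fun φ hφ => ?_, fun G hG hsc =>
    AnnulusLoewner.exists_nonextendable_evolutionFamily hd hr hG hsc⟩
  obtain ⟨G, hG⟩ := hφ.exists_isCorrespondingField hd hr
  exact ⟨G, hG, fun G' hG' => hG.ae_eq hφ hG'⟩
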